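/- **Setting.** Let $D\subseteq\mathbb R^d$ with its Borel $\sigma$-algebra $\mathfrak B(D)$, let $\Omega=(0,\infty)^{\mathbb N}\times(0,\infty)^{\mathbb N}\times D$ with its product $\sigma$-algebra $\Sigma$, and let $W=(W_n)_{n\ge1}$, $X=(X_n)_{n\ge1}$, $\Theta$ be the three coordinate maps. Put $T_n=\sum_{k\le n}W_k$, $N_t=\#\{n\ge1:T_n\le t\}$, $S_t=\sum_{k=1}^{N_t}X_k$ and $\mathcal F_t=\sigma(S_s:s\le t)\vee\sigma(\Theta)$. For a probability measure $Q$ on $\Sigma$ and a Markov kernel $\theta\mapsto\Lambda(\theta)$ from $D$ to $(0,\infty)$, $S$ is a *$Q$-CMRP$(\Lambda(\Theta),Q_{X_1})$* if $X$ is $Q$-i.i.d., $N$ and $X$ are $Q$-independent, the $W_n$ are $Q$-conditionally independent given $\Theta$, and $\Lambda(\Theta)$ is the conditional distribution of each $W_n$ given $\Theta$. $S$ is a *$Q$-CRP$(F,Q_{X_1})$* if $X$ is $Q$-i.i.d., $N$ and $X$ are $Q$-independent, and $W$ is $Q$-i.i.d. with law $F$. Consider the conditions: (a1) $W$ and $X$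 are conditionally independent given $\Theta$; (a2) $\Theta$ and $X$ are independent. Let $P$ be a probability measure on $\Sigma$ satisfying (a1) and (a2) under which $S$ is a $P$-CMRP$(\mathbf K(\Theta),P_{X_1})$ for a Markov kernel $\mathbf K$. For a positive $\mathfrak B(D)$-measurable $\rho:D\to(0,\infty)$ let $\mathcal M_{S,\mathbf{Exp}(\rho(\Theta))}$ be the class of probability measures $Q$ on $\Sigma$ that satisfy (a1), (a2), are progressively equivalent to $P$ (i.e. equivalent to $P$ on every $\mathcal F_t$, $t\ge0$), and make $S$ a $Q$-CMRP$(\mathbf{Exp}(\rho(\Theta)),Q_{X_1})$ (a compound mixed Poisson process with parameter $\rho(\Theta)$). Let $\mathcal F_{P,\Theta}$ be the class of functions $\beta(x,\theta)=\gamma(x)+\alpha(\theta)$ on $(0,\infty)\times D$ with $\gamma,\alpha$ real-valued and measurable and $E_P[e^{\gamma(X_1)}]=1$, and let $\mathcal R_+(D)$ be the class of real-valued measurable $\xi$ on $D$ with $\xi>0$ $P_\Theta$-a.s. and $E_P[\xi(\Theta)]=1$. For $\theta\in D$, $m>0$ and $S^{(\beta)}_t(\theta)=\sum_{j=1}^{N_t}\beta(X_j,\theta)$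 put $$L^{(\beta)}_t(\theta,m)=\frac{e^{S^{(\beta)}_t(\theta)-\rho(\theta)(t-T_{N_t})}\,(\rho(\theta)m)^{-N_t}}{1-\mathbf K(\theta)\big((0,t-T_{N_t}]\big)}\prod_{j=1}^{N_t}\frac{d\mathbf{Exp}(\rho(\theta))}{d\mathbf K(\theta)}(W_j),$$ where the Radon–Nikodym derivative is taken jointly measurable in $(\theta,w)$. Consider the conditions * $(\ast)$ $\gamma=\ln f$ for a $P_{X_1}$-a.s. positive Radon–Nikodym derivative $f$ of $Q_{X_1}$ with respect to $P_{X_1}$, and $\alpha(\Theta)=\ln\rho(\Theta)+\ln E_P[W_1\mid\Theta]$ $P$-a.s.; * $(RPM_\xi)$ $Q(A)=\int_A\xi(\Theta)\,L^{(\beta)}_t(\Theta,E_P[W_1\mid\Theta])\,dP$ for all $0\le u\le t$ and $A\in\mathcal F_u$. **Statement.** Assume $0<E_P[W_1\mid\Theta]<\infty$ $P$-a.s. (i) For every positive measurable $\rho$ and every $Q\in\mathcal M_{S,\mathbf{Exp}(\rho(\Theta))}$ there is a pair $(\beta,\xi)\in\mathcal F_{P,\Theta}\times\mathcal R_+(D)$,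 with $\xi$ a Radon–Nikodym derivative of $Q_\Theta$ with respect to $P_\Theta$, satisfying $(\ast)$ and $(RPM_\xi)$. It is essentially unique: any pair $(\beta',\xi')\in\mathcal F_{P,\Theta}\times\mathcal R_+(D)$ satisfying $(RPM_{\xi'})$ for the same $(\rho,Q)$ has $\beta'=\beta$ $P_{X_1}\otimes P_\Theta$-a.s. and $\xi'=\xi$ $P_\Theta$-a.s. (ii) Assume that for $P_\Theta$-almost every $\theta$ the law $\mathbf K(\theta)$ and Lebesgue measure on $(0,\infty)$ have the same null sets. Then for every $(\beta,\xi)\in\mathcal F_{P,\Theta}\times\mathcal R_+(D)$ there are a positive measurable $\rho$ and a $Q\in\mathcal M_{S,\mathbf{Exp}(\rho(\Theta))}$ satisfying $(RPM_\xi)$ and $(\ast)$, and $\xi$ is a Radon–Nikodym derivative of $Q_\Theta$ with respect to $P_\Theta$. The pair is unique: if $\rho'$ is positive measurable and $Q'$ is a probability measure on $\Sigma$ such that $(RPM_\xi)$ holds for $(\rho',Q')$ and the same $(\beta,\xi)$, then $\rho'=\rho$ $P_\Theta$-a.s. and $Q'=Q$. (iii) Let $\{P_\theta\}_{\theta\in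 D}$ be a regular conditional probability of $P$ over $P_\Theta$ consistent with $\Theta$. If $\rho$ is positive measurable, $Q\in\mathcal M_{S,\mathbf{Exp}(\rho(\Theta))}$, $\beta=\gamma+\alpha\in\mathcal F_{P,\Theta}$ and $\xi\in\mathcal R_+(D)$ satisfy $(\ast)$ and $(RPM_\xi)$, then there is an essentially unique regular conditional probability $\{Q_\theta\}_{\theta\in D}$ of $Q$ over $Q_\Theta$ consistent with $\Theta$, and for $P_\Theta$-almost every $\theta$: $Q_\theta$ is equivalent to $P_\theta$ on every $\mathcal F_t$ and $S$ is a $Q_\theta$-CRP$(\mathbf{Exp}(\rho(\theta)),(Q_\theta)_{X_1})$; $\gamma=\ln f$ with $f$ as in $(\ast)$ and $\rho(\theta)=e^{\alpha(\theta)}/E_{P_\theta}[W_1]$; and $$(RPM_\theta)\qquad Q_\theta(A)=\int_A L^{(\beta)}_t(\theta,E_{P_\theta}[W_1])\,dP_\theta\quad\text{for all }0\le u\le t\text{ and }A\in\mathcal F_u .$$ (iv) In particular, if for $P_\Theta$-almost every $\theta$ the law $\mathbf K(\theta)$ and Lebesgue measure on $(0,\infty)$ have the same null sets, then $\mathcal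 M_{S,\mathbf{Exp}(\rho(\Theta))}\neq\emptyset$ for every positive measurable $\rho$: $S$ can be converted into a compound mixed Poisson process by a change of measure. -/

import Mathlib

open MeasureTheory ProbabilityTheory
open scoped ENNReal NNReal

noncomputable section

namespace CMRP

/-- The interval `(0, ∞)`, with its Borel σ-algebra. -/
abbrev PosReal : Type := Set.Ioi (0 : ℝ)

/-- The canonical space `(0,∞)^ℕ × (0,∞)^ℕ × D` (interarrival times, claim sizes, parameter), with
its product σ-algebra. -/
abbrev CanonSpace (D : Type) : Type := (ℕ → PosReal) × (ℕ → PosReal) × D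

section Processes

variable {D : Type}

/-- Interarrival times; the index starts at `0`, so `W n` is the `(n+1)`-st interarrival time. -/
def W (n : ℕ) (ω : CanonSpace D) : PosReal := ω.1 n

/-- Claim sizes; the index starts at `0`, so `X n` is the `(n+1)`-st claim. -/
def X (n : ℕ) (ω : CanonSpace D) : PosReal := ω.2.1 n

/-- The structural parameter. -/
def Th (ω : CanonSpace D) : D := ω.2.2

/-- Arrival times: `T 0 = 0`, and `T n` is the sum of the first `n` interarrival times. -/
def T (n : ℕ) (ω : CanonSpace D) : ℝ := ∑ k ∈ Finset.range n, (W k ω : ℝ)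

/-- The claim number process: the number of `n ≥ 1` with `T n ≤ t` (it is `∞` after explosion). -/
def N (t : ℝ≥0) (ω : CanonSpace D) : ℕ∞ := Set.encard {n : ℕ | T (n + 1) ω ≤ t}

/-- The aggregate claims process: the sum of the first `N t` claims. It is `[0,∞]`-valued, so that
it also makes sense after explosion. -/
def S (t : ℝ≥0) (ω : CanonSpace D) : ℝ≥0∞ :=
  ∑' k : ℕ, if (k : ℕ∞) < N t ω then ENNReal.ofReal (X k ω : ℝ) else 0

end Processes

section Measures

variable {D : Type} [MeasurableSpace D]

/-- The σ-algebra `σ(Θ)`. -/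
abbrev sigmaTh : MeasurableSpace (CanonSpace D) := MeasurableSpace.comap Th inferInstance

/-- The canonical filtration generated by `S` and `Θ`: `σ(S_s : s ≤ t) ∨ σ(Θ)`. -/
abbrev filt (t : ℝ≥0) : MeasurableSpace (CanonSpace D) :=
  (⨆ s : Set.Iic t, MeasurableSpace.comap (S (s : ℝ≥0)) inferInstance) ⊔ sigmaTh

/-- Equivalence of measures on every σ-algebra of the filtration. -/
def ProgEquiv (Q P : Measure (CanonSpace D)) : Prop :=
  ∀ t : ℝ≥0, ∀ A : Set (CanonSpace D), MeasurableSet[filt t] A → (Q A = 0 ↔ P A = 0)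

/-- Condition (a1): the processes `W` and `X` are conditionally independent given `Θ`. -/
def CondA1 (Q : Measure (CanonSpace D)) : Prop :=
  ∀ A B : Set (ℕ → PosReal), MeasurableSet A → MeasurableSet B →
    Q⟦{ω | (fun n => W n ω) ∈ A} ∩ {ω | (fun n => X n ω) ∈ B} | sigmaTh⟧ =ᵐ[Q]
      fun ω => (Q⟦{ω | (fun n => W n ω) ∈ A} | sigmaTh⟧) ω *
        (Q⟦{ω | (fun n => X n ω) ∈ B} | sigmaTh⟧) ω

/-- Condition (a2): `Θ` and the process `X` are independent. -/
def CondA2 (Q : Measure (CanonSpace D)) : Prop :=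
  IndepFun (Th : CanonSpace D → D) (fun ω n => X n ω) Q

/-- `(N, X)` is a risk process: the claims are i.i.d., and `N` and `X` are independent. -/
structure IsRiskProcess (Q : Measure (CanonSpace D)) : Prop where
  claims_indep : iIndepFun (fun (n : ℕ) (ω : CanonSpace D) => X n ω) Q
  claims_identDistrib : ∀ n : ℕ, Q.map (X n) = Q.map (X 0)
  indep : IndepFun (fun (ω : CanonSpace D) (t : ℝ≥0) => N t ω) (fun ω (n : ℕ) => X n ω) Q

/-- `N` is a mixed renewal process with interarrival time conditional distribution `Λ(Θ)`: the
interarrival times are conditionally independent given `Θ`, and `Λ(Θ)` is the conditional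
distribution over `Θ` of each of them. -/
structure IsMRP (Q : Measure (CanonSpace D)) (Λ : Kernel D PosReal) : Prop where
  condIndep : ∀ (s : Finset ℕ) (B : ℕ → Set PosReal), (∀ n, MeasurableSet (B n)) →
    Q⟦⋂ n ∈ s, W n ⁻¹' B n | sigmaTh⟧ =ᵐ[Q] fun ω => ∏ n ∈ s, (Q⟦W n ⁻¹' B n | sigmaTh⟧) ω
  condLaw : ∀ (n : ℕ) (B : Set PosReal), MeasurableSet B →
    Q⟦W n ⁻¹' B | sigmaTh⟧ =ᵐ[Q] fun ω => (Λ (Th ω)).real B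

/-- `S` is a compound mixed renewal process with parameters `Λ(Θ)` and the law of `X 0`. -/
structure IsCMRP (Q : Measure (CanonSpace D)) (Λ : Kernel D PosReal) : Prop where
  risk : IsRiskProcess Q
  mrp : IsMRP Q Λ

/-- `S` is a compound renewal process with interarrival law `F` (and claim law that of `X 0`). -/
structure IsCRP (Q : Measure (CanonSpace D)) (F : Measure PosReal) : Prop where
  risk : IsRiskProcess Q
  renewal_indep : iIndepFun (fun (n : ℕ) (ω : CanonSpace D) => W n ω) Q
  renewal_law : ∀ n : ℕ, Q.map (W n) = F

/-- The class of probability measures `Q` satisfying (a1) and (a2), progressively equivalent to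
`P`, and under which `S` is a compound mixed renewal process with parameters `Λ(Θ)` and the law
of `X 0`. -/
structure MemM (P : Measure (CanonSpace D)) (Λ : Kernel D PosReal)
    (Q : Measure (CanonSpace D)) : Prop where
  prob : IsProbabilityMeasure Q
  a1 : CondA1 Q
  a2 : CondA2 Q
  progEquiv : ProgEquiv Q P
  cmrp : IsCMRP Q Λ

/-- The class of probability measures `Q` progressively equivalent to `P`, and under which `S` is a
compound renewal process with interarrival law `F`. -/
structure MemMpoint (P : Measure (CanonSpace D)) (F : Measure PosReal)
    (Q : Measure (CanonSpace D)) : Prop where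
  prob : IsProbabilityMeasure Q
  progEquiv : ProgEquiv Q P
  crp : IsCRP Q F

/-- `κ` is a regular conditional probability of `Q` over the law of `f`, consistent with `f`. -/
structure IsRCP {Ω Y : Type} [MeasurableSpace Ω] [MeasurableSpace Y]
    (Q : Measure Ω) (f : Ω → Y) (κ : Kernel Y Ω) : Prop where
  prob : ∀ y, IsProbabilityMeasure (κ y)
  disint : ∀ E : Set Ω, MeasurableSet E → ∫⁻ y, κ y E ∂(Q.map f) = Q E
  consistent : ∀ B : Set Y, MeasurableSet B → ∀ᵐ y ∂(Q.map f), y ∈ B → κ y (f ⁻¹' B) = 1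

/-- `f` is a (real-valued) Radon-Nikodym derivative of `ν` with respect to `μ`. -/
structure IsRNDeriv {Y : Type} [MeasurableSpace Y] (f : Y → ℝ) (ν μ : Measure Y) : Prop where
  measurable : Measurable f
  nonneg : ∀ᵐ y ∂μ, 0 ≤ f y
  eq_withDensity : ν = μ.withDensity (fun y => ENNReal.ofReal (f y))

variable (D) in
/-- Positive measurable functions on `D`. -/
def PosFun : Type := {ρ : D → ℝ // Measurable ρ ∧ ∀ θ, 0 < ρ θ}

instance : CoeFun (PosFun D) (fun _ => D → ℝ) := ⟨fun ρ => ρ.1⟩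

/-- The kernel `θ ↦ Exp(ρ(θ))` from `D` to `(0,∞)`. -/
def expKernel (ρ : PosFun D) : Kernel D PosReal where
  toFun θ := (expMeasure (ρ θ)).comap ((↑) : PosReal → ℝ)
  measurable' := by
    refine Measure.measurable_of_measurable_coe _ fun s hs => ?_
    have hms : MeasurableSet (((↑) : PosReal → ℝ) '' s) := measurableSet_Ioi.subtype_image hs
    have key : ∀ θ, ((expMeasure (ρ θ)).comap ((↑) : PosReal → ℝ)) s =
        ∫⁻ x in ((↑) : PosReal → ℝ) '' s,
          ENNReal.ofReal (if 0 ≤ x then ρ θ * Real.exp (-(ρ θ * x)) else 0) := by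
      intro θ
      rw [(MeasurableEmbedding.subtype_coe measurableSet_Ioi).comap_apply]
      change (volume.withDensity (exponentialPDF (ρ θ))) _ = _
      rw [withDensity_apply _ hms]
      simp only [exponentialPDF_eq]
    simp only [key]
    have hρ := ρ.2.1
    refine Measurable.lintegral_prod_right' (f := fun p : D × ℝ =>
      ENNReal.ofReal (if 0 ≤ p.2 then ρ p.1 * Real.exp (-(ρ p.1 * p.2)) else 0)) ?_
    refine ENNReal.measurable_ofReal.comp (Measurable.ite ?_ ?_ measurable_const)
    · exact measurableSet_le measurable_const measurable_snd
    · exact (hρ.comp measurable_fst).mul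
        (((hρ.comp measurable_fst).mul measurable_snd).neg.exp)

/-- Membership of `γ` in the class of measurable functions with `E_P[exp γ(X_1)] = 1`. -/
structure MemFln (P : Measure (CanonSpace D)) (γ : PosReal → ℝ) : Prop where
  measurable : Measurable γ
  integral_eq_one : ∫ ω, Real.exp (γ (X 0 ω)) ∂P = 1

/-- `β(x,θ) = γ(x) + α(θ)` with `γ` measurable, `E_P[exp γ(X_1)] = 1`, and `α` measurable. -/
structure Decomp (P : Measure (CanonSpace D)) (β : PosReal × D → ℝ) (γ : PosReal → ℝ)
    (α : D → ℝ) : Prop where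
  mem_left : MemFln P γ
  measurable_right : Measurable α
  eq_add : ∀ x θ, β (x, θ) = γ x + α θ

/-- The class of all functions `β` of the form `β(x,θ) = γ(x) + α(θ)` as above. -/
def MemFTh (P : Measure (CanonSpace D)) (β : PosReal × D → ℝ) : Prop :=
  ∃ γ α, Decomp P β γ α

/-- The class of measurable `ξ` with `ξ > 0` almost surely and `E_P[ξ(Θ)] = 1`. -/
structure MemRplus (P : Measure (CanonSpace D)) (ξ : D → ℝ) : Prop where
  measurable : Measurable ξ
  pos : ∀ᵐ θ ∂(P.map Th), 0 < ξ θ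
  integral_eq_one : ∫ ω, ξ (Th ω) ∂P = 1

/-- The conditional expectation `E_P[W_1 | Θ]`, as a `[0,∞]`-valued function. -/
def condMeanW (P : Measure (CanonSpace D)) : CanonSpace D → ℝ≥0∞ :=
  condLExp sigmaTh P (fun ω => ENNReal.ofReal (W 0 ω : ℝ))

/-- `γ = ln f` for a `P_{X_1}`-a.s. positive Radon-Nikodym derivative `f` of `Q_{X_1}` with respect
to `P_{X_1}`. -/
def IsLogRN (P Q : Measure (CanonSpace D)) (γ : PosReal → ℝ) : Prop :=
  ∃ f : PosReal → ℝ, IsRNDeriv f (Q.map (X 0)) (P.map (X 0)) ∧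
    (∀ᵐ x ∂(P.map (X 0)), 0 < f x) ∧ ∀ x, γ x = Real.log (f x)

/-- Condition (∗): `γ = ln f` and `α(Θ) = ln ρ(Θ) + ln E_P[W_1 | Θ]` almost surely. -/
structure StarCond (P Q : Measure (CanonSpace D)) (ρ : PosFun D) (γ : PosReal → ℝ) (α : D → ℝ) :
    Prop where
  gamma_eq : IsLogRN P Q γ
  alpha_eq : ∀ᵐ ω ∂P, α (Th ω) = Real.log (ρ (Th ω)) + Real.log (condMeanW P ω).toReal

/-- The common expression
`e^{S_t^{(β)}(θ) - ρ(θ)(t - T_{N_t})} (ρ(θ) m)^{-N_t} / (1 - K(θ)(t - T_{N_t})) *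
  ∏_{j ≤ N_t} (dExp(ρ(θ)) / dK(θ))(W_j)`,
where `S_t^{(β)}(θ) = ∑_{j ≤ N_t} β(X_j, θ)` and `K(θ)(·)` is the distribution function of `K(θ)`.
The jointly measurable version of the Radon-Nikodym derivative is used. -/
def density (K : Kernel D PosReal) (ρ : PosFun D) (β : PosReal × D → ℝ) (t : ℝ≥0) (m : ℝ) (θ : D)
    (ω : CanonSpace D) : ℝ :=
  let n : ℕ := (N t ω).toNat
  Real.exp ((∑ j ∈ Finset.range n, β (X j ω, θ)) - ρ θ * (t - T n ω)) * ((ρ θ * m) ^ n)⁻¹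
      / (1 - (K θ).real {x : PosReal | (x : ℝ) ≤ t - T n ω})
    * ∏ j ∈ Finset.range n, (Kernel.rnDeriv (expKernel ρ) K θ (W j ω)).toReal

/-- Condition (RPM_ξ): `Q(A) = ∫_A M_t^{(β)}(Θ) dP` for all `u ≤ t` and `A` in the σ-algebra at
time `u`, where `M_t^{(β)}(Θ)` is `ξ(Θ)` times the above expression at `θ = Θ`,
`m = E_P[W_1 | Θ]`. -/
def RPMxi (P : Measure (CanonSpace D)) (K : Kernel D PosReal) (ρ : PosFun D)
    (β : PosReal × D → ℝ) (ξ : D → ℝ) (Q : Measure (CanonSpace D)) : Prop :=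
  ∀ u t : ℝ≥0, u ≤ t → ∀ A : Set (CanonSpace D), MeasurableSet[filt u] A →
    Q A = ∫⁻ ω in A, ENNReal.ofReal
      (ξ (Th ω) * density K ρ β t (condMeanW P ω).toReal (Th ω) ω) ∂P

/-- Condition (RPM_θ): `Q_θ(A) = ∫_A M̃_t^{(β)}(θ) dP_θ` for all `u ≤ t` and `A` in the σ-algebra
at time `u`, where `M̃_t^{(β)}(θ)` is the above expression with `m = E_{P_θ}[W_1]`. -/
def RPMth (Pθ : Measure (CanonSpace D)) (K : Kernel D PosReal) (ρ : PosFun D)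
    (β : PosReal × D → ℝ) (θ : D) (Qθ : Measure (CanonSpace D)) : Prop :=
  ∀ u t : ℝ≥0, u ≤ t → ∀ A : Set (CanonSpace D), MeasurableSet[filt u] A →
    Qθ A = ∫⁻ ω in A, ENNReal.ofReal (density K ρ β t (∫ ω', (W 0 ω' : ℝ) ∂Pθ) θ ω) ∂Pθ

/-- `K(θ)` and Lebesgue measure on `(0,∞)` have the same null sets for almost every `θ`; this says
that the likelihood ratios `dExp(ρ(θ))/dK(θ)` exist and are positive. -/
def EquivLebesgue (P : Measure (CanonSpace D)) (K : Kernel D PosReal) : Prop :=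
  ∀ᵐ θ ∂(P.map Th), K θ ≪ (volume : Measure ℝ).comap ((↑) : PosReal → ℝ) ∧
    (volume : Measure ℝ).comap ((↑) : PosReal → ℝ) ≪ K θ

end Measures

end CMRP

end

open CMRP

/-! Under (a1), (a2) and the mixed renewal property, the joint law of `(W, X, Θ)` is forced: it is
the mixture `canon π K ν` over `θ ~ π` of the product laws `point (K θ) ν θ` (`eq_canon`). This
applies to `P` and to every `Q` in the class, so all claims become statements about a triple
consisting of a structural law, an interarrival kernel and a claim law.

Fix `θ`. On `{N t = n}` an event of the σ-algebra at time `t` depends only on the first `n`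
interarrival times and claims; the one further piece of information is that the next interarrival
time exceeds `t - T n`. The likelihood ratio is therefore a product of one-coordinate densities
times a quotient of tails (`point_withDensity_inter`, `point_withDensity_apply`). For an exponential
target the new tail is `exp (-ρ (t - T n))`, and when `e^α = ρ m` the factor `e^{nα}` cancels `(ρ
m)^{-n}`, so the ratio is exactly the density of the theorem (`ae_ofReal_density_eq`). Integrating
over `θ` with weight `ξ` gives `canon_expKernel_apply`.

For (i), progressive equivalence makes the structural laws, the claim laws and almost all
interarrival laws mutually absolutely continuous (`ac_of_progEquiv`); their densities furnish `ξ`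
and `f`. For (ii), take `ρ = e^α / m` and the corresponding mixture. Uniqueness uses two
observations: at time `0` the density is `1`, so `ξ` is read off from `σ(Θ)`; and at time `1` the
event of exactly one arrival has positive probability for almost every `θ`, and a change in `β` or
`α` is visible there (`rpmxi_unique_left`, `exp_eq_of_rpmxi`). The measure itself is determined
because the filtration generates the whole σ-algebra (`iSup_filt`). For (iii), the laws `point` are
the disintegration, unique up to null sets (`IsRCP.ae_eq`), and the formula for fixed `θ` applies.
For (iv), take `γ = 0` and `ξ = 1`. -/

noncomputable section

namespace CMRP

/-! ### Paths of the counting and aggregate claims processes -/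

section Paths

variable {D : Type}

lemma T_zero (ω : CanonSpace D) : T 0 ω = 0 := by simp [T]

lemma T_succ (n : ℕ) (ω : CanonSpace D) : T (n + 1) ω = T n ω + W n ω := by
  simp [T, Finset.sum_range_succ]

lemma T_lt_succ (n : ℕ) (ω : CanonSpace D) : T n ω < T (n + 1) ω := by
  have : (0 : ℝ) < W n ω := (W n ω).2
  rw [T_succ]; linarith

lemma T_strictMono (ω : CanonSpace D) : StrictMono fun n => T n ω :=
  strictMono_nat_of_lt_succ fun n => T_lt_succ n ω

lemma T_nonneg (n : ℕ) (ω : CanonSpace D) : 0 ≤ T n ω := by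
  rw [← T_zero ω]; exact (T_strictMono ω).monotone (Nat.zero_le n)

lemma lt_N_iff (n : ℕ) (t : ℝ≥0) (ω : CanonSpace D) : (n : ℕ∞) < N t ω ↔ T (n + 1) ω ≤ t := by
  constructor
  · intro h
    by_contra hc
    refine absurd h (not_lt.2 ?_)
    have hsub : {k : ℕ | T (k + 1) ω ≤ t} ⊆ ((Finset.range n : Finset ℕ) : Set ℕ) := by
      intro k hk
      simp only [Finset.coe_range, Set.mem_Iio]
      by_contra hkn
      exact hc (((T_strictMono ω).monotone (by omega : n + 1 ≤ k + 1)).trans hk)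
    calc N t ω ≤ ((Finset.range n : Finset ℕ) : Set ℕ).encard := Set.encard_le_encard hsub
      _ = n := by rw [Set.encard_coe_eq_coe_finsetCard, Finset.card_range]
  · intro h
    have hsub : ((Finset.range (n + 1) : Finset ℕ) : Set ℕ) ⊆ {k : ℕ | T (k + 1) ω ≤ t} := by
      intro k hk
      simp only [Finset.coe_range, Set.mem_Iio] at hk
      exact ((T_strictMono ω).monotone (by omega : k + 1 ≤ n + 1)).trans h
    have := Set.encard_le_encard hsub
    rw [Set.encard_coe_eq_coe_finsetCard, Finset.card_range] at this
    exact lt_of_lt_of_le (by exact_mod_cast Nat.lt_succ_self n) this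

lemma le_N_iff (n : ℕ) (t : ℝ≥0) (ω : CanonSpace D) : (n : ℕ∞) ≤ N t ω ↔ T n ω ≤ t := by
  cases n with
  | zero => simp [T_zero]
  | succ n =>
    rw [← lt_N_iff, Nat.cast_succ]
    exact ENat.add_one_le_iff (ENat.natCast_ne_top n)

lemma N_eq_iff (n : ℕ) (t : ℝ≥0) (ω : CanonSpace D) :
    N t ω = n ↔ T n ω ≤ t ∧ (t : ℝ) < T (n + 1) ω := by
  rw [← le_N_iff, ← not_le, ← lt_N_iff, not_lt, and_comm]
  exact le_antisymm_iff

lemma N_zero (ω : CanonSpace D) : N 0 ω = 0 := by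
  have := (N_eq_iff 0 0 ω).2 ⟨by simp [T_zero], by
    have := T_lt_succ 0 ω; rw [T_zero] at this; simpa using this⟩
  simpa using this

lemma N_mono (ω : CanonSpace D) : Monotone fun t => N t ω := by
  intro s t hst
  exact Set.encard_le_encard fun n (hn : T (n + 1) ω ≤ s) => hn.trans (by exact_mod_cast hst)

lemma S_of_N_eq {n : ℕ} {t : ℝ≥0} {ω : CanonSpace D} (h : N t ω = n) :
    S t ω = ∑ k ∈ Finset.range n, ENNReal.ofReal (X k ω : ℝ) := by
  rw [S, tsum_eq_sum (s := Finset.range n)]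
  · refine Finset.sum_congr rfl fun k hk => ?_
    rw [if_pos]
    rw [h]; exact_mod_cast Finset.mem_range.1 hk
  · intro k hk
    rw [if_neg]
    rw [h, not_lt]; exact_mod_cast not_lt.1 fun hc => hk (Finset.mem_range.2 hc)

lemma sum_le_S {n : ℕ} {t : ℝ≥0} {ω : CanonSpace D} (h : (n : ℕ∞) ≤ N t ω) :
    ∑ k ∈ Finset.range n, ENNReal.ofReal (X k ω : ℝ) ≤ S t ω := by
  rw [S]
  refine le_trans (le_of_eq ?_) (ENNReal.sum_le_tsum (Finset.range n))
  refine Finset.sum_congr rfl fun k hk => ?_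
  rw [if_pos]
  exact lt_of_lt_of_le (by exact_mod_cast Finset.mem_range.1 hk) h

lemma S_le_of_N_le {s t : ℝ≥0} {ω : CanonSpace D} (h : N s ω ≤ N t ω) : S s ω ≤ S t ω := by
  refine ENNReal.tsum_le_tsum fun k => ?_
  by_cases hk : (k : ℕ∞) < N s ω
  · rw [if_pos hk, if_pos (hk.trans_le h)]
  · rw [if_neg hk]; exact zero_le

lemma S_of_N_eq_one {t : ℝ≥0} {ω : CanonSpace D} (h : N t ω = 1) :
    S t ω = ENNReal.ofReal (X 0 ω : ℝ) := by
  rw [S_of_N_eq (n := 1) (by simpa using h)]; simp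

/-- Interarrival times are strictly positive, so `[T n, T (n + 1))` has nonempty interior and meets
a fixed countable dense set. This replaces unions over all times by countable ones. -/
lemma exists_N_eq (n : ℕ) (ω : CanonSpace D) :
    ∃ i, N (TopologicalSpace.denseSeq ℝ≥0 i) ω = n ∧
      T n ω ≤ TopologicalSpace.denseSeq ℝ≥0 i ∧
      ((TopologicalSpace.denseSeq ℝ≥0 i : ℝ≥0) : ℝ) < T (n + 1) ω := by
  have h : (⟨T n ω, T_nonneg n ω⟩ : ℝ≥0) < ⟨T (n + 1) ω, T_nonneg _ ω⟩ := T_lt_succ n ω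
  obtain ⟨_, ⟨i, rfl⟩, h1, h2⟩ :=
    (TopologicalSpace.denseRange_denseSeq ℝ≥0).exists_between h
  have h1' : T n ω ≤ TopologicalSpace.denseSeq ℝ≥0 i := le_of_lt h1
  exact ⟨i, (N_eq_iff _ _ _).2 ⟨h1', h2⟩, h1', h2⟩

/-- Claims are strictly positive, so every arrival makes `S` jump. Counting jumps along a countable
dense set of times recovers `N` from `S`; this is what makes `N` adapted. -/
lemma succ_le_N_iff (n : ℕ) (t : ℝ≥0) (ω : CanonSpace D) :
    ((n + 1 : ℕ) : ℕ∞) ≤ N t ω ↔ ∃ i, TopologicalSpace.denseSeq ℝ≥0 i ≤ t ∧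
      (n : ℕ∞) ≤ N (TopologicalSpace.denseSeq ℝ≥0 i) ω ∧
      S (TopologicalSpace.denseSeq ℝ≥0 i) ω < S t ω := by
  constructor
  · intro h
    obtain ⟨i, hi, h1, h2⟩ := exists_N_eq n ω
    refine ⟨i, ?_, hi.ge, ?_⟩
    · exact_mod_cast h2.le.trans ((le_N_iff _ _ _).1 h)
    · rw [S_of_N_eq hi]
      refine lt_of_lt_of_le ?_ (sum_le_S h)
      rw [Finset.sum_range_succ]
      refine ENNReal.lt_add_right ?_ ?_
      · exact ENNReal.sum_ne_top.2 fun _ _ => ENNReal.ofReal_ne_top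
      · exact (ENNReal.ofReal_pos.2 (X n ω).2).ne'
  · rintro ⟨i, -, h1, h2⟩
    have : N (TopologicalSpace.denseSeq ℝ≥0 i) ω < N t ω := by
      by_contra hc
      exact absurd h2 (not_lt.2 (S_le_of_N_le (not_lt.1 hc)))
    rw [Nat.cast_succ]
    refine le_trans ?_ (Order.add_one_le_of_lt this)
    gcongr

end Paths

/-! ### The filtration: adaptedness of `N` and generation of the full σ-algebra -/

section Filtration

variable {D : Type} [MeasurableSpace D]

lemma measurable_W (n : ℕ) : Measurable (W n : CanonSpace D → PosReal) := by
  unfold W; fun_prop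

lemma measurable_X (n : ℕ) : Measurable (X n : CanonSpace D → PosReal) := by
  unfold X; fun_prop

lemma measurable_Th : Measurable (Th : CanonSpace D → D) := by
  unfold Th; fun_prop

lemma measurable_Wseq : Measurable (fun (ω : CanonSpace D) n => W n ω) := by
  unfold W; fun_prop

lemma measurable_Xseq : Measurable (fun (ω : CanonSpace D) n => X n ω) := by
  unfold X; fun_prop

lemma measurable_T (n : ℕ) : Measurable (T n : CanonSpace D → ℝ) := by
  unfold T
  exact Finset.measurable_sum _ fun k _ => (measurable_W k).subtype_val

lemma measurable_N (t : ℝ≥0) : Measurable (N t : CanonSpace D → ℕ∞) := by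
  refine measurable_to_countable fun ω => ?_
  induction h : N t ω using ENat.recTopCoe with
  | top =>
    have : N t ⁻¹' {(⊤ : ℕ∞)} = ⋂ n : ℕ, {ω : CanonSpace D | T n ω ≤ t} := by
      ext ω
      simp only [Set.mem_preimage, Set.mem_singleton_iff, Set.mem_iInter, Set.mem_ofPred_eq,
        ← le_N_iff]
      exact ⟨fun h n => by simp [h], fun h => ENat.eq_top_iff_forall_ge.2 h⟩
    rw [this]
    exact MeasurableSet.iInter fun n => measurableSet_le (measurable_T n) measurable_const
  | coe n =>
    have : N t ⁻¹' {(n : ℕ∞)} = {ω : CanonSpace D | T n ω ≤ t} ∩ {ω | (t : ℝ) < T (n + 1) ω} := by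
      ext ω
      simp [N_eq_iff]
    rw [this]
    exact (measurableSet_le (measurable_T n) measurable_const).inter
      (measurableSet_lt measurable_const (measurable_T _))

lemma measurable_S (t : ℝ≥0) : Measurable (S t : CanonSpace D → ℝ≥0∞) := by
  refine Measurable.tsum fun k => Measurable.ite ?_ ?_ measurable_const
  · exact measurable_N t (.of_discrete (s := Set.Ioi (k : ℕ∞)))
  · exact (measurable_X k).subtype_val.ennreal_ofReal

lemma sigmaTh_le : (sigmaTh : MeasurableSpace (CanonSpace D)) ≤ Prod.instMeasurableSpace :=
  measurable_Th.comap_le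

lemma filt_le (t : ℝ≥0) : (filt t : MeasurableSpace (CanonSpace D)) ≤ Prod.instMeasurableSpace :=
  sup_le (iSup_le fun s => (measurable_S s).comap_le) sigmaTh_le

lemma filt_mono : Monotone (filt : ℝ≥0 → MeasurableSpace (CanonSpace D)) := by
  intro s t hst
  refine sup_le_sup_right (iSup_le fun u => ?_) _
  exact le_iSup (fun s : Set.Iic t => MeasurableSpace.comap (S (D := D) (s : ℝ≥0)) inferInstance)
    ⟨u.1, le_trans u.2 hst⟩

lemma measurable_S_filt {s t : ℝ≥0} (hst : s ≤ t) :
    Measurable[filt t] (S s : CanonSpace D → ℝ≥0∞) := by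
  have h : MeasurableSpace.comap (S (D := D) s) inferInstance ≤ filt t :=
    le_trans (le_iSup (fun s : Set.Iic t =>
      MeasurableSpace.comap (S (D := D) (s : ℝ≥0)) inferInstance) ⟨s, hst⟩) le_sup_left
  exact Measurable.mono (comap_measurable _) h le_rfl

lemma measurable_Th_filt (t : ℝ≥0) : Measurable[filt t] (Th : CanonSpace D → D) :=
  Measurable.mono (comap_measurable _) le_sup_right le_rfl

lemma measurableSet_le_N_filt (n : ℕ) (t : ℝ≥0) :
    MeasurableSet[filt t] {ω : CanonSpace D | (n : ℕ∞) ≤ N t ω} := by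
  induction n generalizing t with
  | zero => simp
  | succ n ih =>
    have : {ω : CanonSpace D | ((n + 1 : ℕ) : ℕ∞) ≤ N t ω} =
        ⋃ i : {i : ℕ // TopologicalSpace.denseSeq ℝ≥0 i ≤ t},
          ({ω | (n : ℕ∞) ≤ N (TopologicalSpace.denseSeq ℝ≥0 i) ω} ∩
            {ω | S (TopologicalSpace.denseSeq ℝ≥0 i) ω < S t ω}) := by
      ext ω
      simp only [Set.mem_ofPred_eq, succ_le_N_iff, Set.mem_iUnion, Set.mem_inter_iff,
        Subtype.exists, exists_prop]
    rw [this]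
    refine MeasurableSet.iUnion fun i => MeasurableSet.inter ?_ ?_
    · exact filt_mono i.2 _ (ih _)
    · exact measurableSet_lt (measurable_S_filt i.2) (measurable_S_filt le_rfl)

lemma measurableSet_N_eq_filt (n : ℕ) (t : ℝ≥0) :
    MeasurableSet[filt t] {ω : CanonSpace D | N t ω = n} := by
  have : {ω : CanonSpace D | N t ω = n} =
      {ω | (n : ℕ∞) ≤ N t ω} \ {ω | ((n + 1 : ℕ) : ℕ∞) ≤ N t ω} := by
    ext ω
    simp only [Set.mem_ofPred_eq, Set.mem_sdiff, le_N_iff, N_eq_iff, not_le]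
  rw [this]
  exact MeasurableSet.diff (measurableSet_le_N_filt n t) (measurableSet_le_N_filt (n + 1) t)

/-- Two sample points with the same parameter and the same path of `S` up to time `t` belong to
the same events of the σ-algebra at time `t`. -/
lemma mem_iff_of_measurableSet_filt {t : ℝ≥0} {ω ω' : CanonSpace D}
    (hS : ∀ s ≤ t, S s ω = S s ω') (hTh : Th ω = Th ω') {A : Set (CanonSpace D)}
    (hA : MeasurableSet[filt t] A) : ω ∈ A ↔ ω' ∈ A := by
  -- The sets that do not separate the two points form a σ-algebra, so it is enough to check the
  -- generators.
  let m : MeasurableSpace (CanonSpace D) :=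
    { MeasurableSet' := fun A => ω ∈ A ↔ ω' ∈ A
      measurableSet_empty := by simp
      measurableSet_compl := fun A h => by simp [h]
      measurableSet_iUnion := fun f h => by simp [h] }
  have hm : filt t ≤ m := by
    refine sup_le (iSup_le fun s => ?_) ?_
    · rintro _ ⟨B, -, rfl⟩
      change ω ∈ _ ↔ ω' ∈ _
      simp [hS s s.2]
    · rintro _ ⟨B, -, rfl⟩
      change ω ∈ _ ↔ ω' ∈ _
      simp [hTh]
  exact hm A hA

lemma measurable_T_iSup (n : ℕ) :
    Measurable[⨆ t, filt t] (T n : CanonSpace D → ℝ) := by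
  refine measurable_of_Iic fun r => ?_
  by_cases hr : r < 0
  · have : (T n : CanonSpace D → ℝ) ⁻¹' Set.Iic r = ∅ := by
      ext ω
      simp only [Set.mem_preimage, Set.mem_Iic, Set.mem_empty_iff_false, iff_false, not_le]
      exact hr.trans_le (T_nonneg n ω)
    rw [this]; exact @MeasurableSet.empty _ (⨆ t, filt t)
  · have : (T n : CanonSpace D → ℝ) ⁻¹' Set.Iic r = {ω | (n : ℕ∞) ≤ N r.toNNReal ω} := by
      ext ω
      simp only [Set.mem_preimage, Set.mem_Iic, Set.mem_ofPred_eq, le_N_iff,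
        Real.coe_toNNReal _ (not_lt.1 hr)]
    rw [this]
    exact le_iSup (filt (D := D)) r.toNNReal _ (measurableSet_le_N_filt n _)

/-- At any dense time between the `n`-th and the next arrival, `S` equals this partial sum. -/
lemma measurable_sumX_iSup (n : ℕ) :
    Measurable[⨆ t, filt t]
      (fun ω : CanonSpace D => ∑ k ∈ Finset.range n, ENNReal.ofReal (X k ω : ℝ)) := by
  intro B hB
  have : (fun ω : CanonSpace D => ∑ k ∈ Finset.range n, ENNReal.ofReal (X k ω : ℝ)) ⁻¹' B =
      ⋃ i, ({ω | N (TopologicalSpace.denseSeq ℝ≥0 i) ω = n} ∩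
        S (TopologicalSpace.denseSeq ℝ≥0 i) ⁻¹' B) := by
    ext ω
    simp only [Set.mem_preimage, Set.mem_iUnion, Set.mem_inter_iff, Set.mem_ofPred_eq]
    constructor
    · intro h
      obtain ⟨i, hi, -⟩ := exists_N_eq n ω
      exact ⟨i, hi, by rwa [S_of_N_eq hi]⟩
    · rintro ⟨i, hi, h⟩
      rwa [S_of_N_eq hi] at h
  rw [this]
  refine MeasurableSet.iUnion fun i => MeasurableSet.inter ?_ ?_
  · exact le_iSup (filt (D := D)) _ _ (measurableSet_N_eq_filt n _)
  · exact le_iSup (filt (D := D)) _ _ (measurable_S_filt le_rfl hB)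

lemma measurable_canon {Ω : Type*} {m : MeasurableSpace Ω} {f : Ω → CanonSpace D}
    (hW : ∀ n, Measurable fun a => (W n (f a) : ℝ)) (hX : ∀ n, Measurable fun a => (X n (f a) : ℝ))
    (hT : Measurable fun a => Th (f a)) : Measurable f := by
  have h1 : Measurable fun a n => W n (f a) :=
    measurable_pi_lambda _ fun n => Measurable.subtype_mk (hW n)
  have h2 : Measurable fun a n => X n (f a) :=
    measurable_pi_lambda _ fun n => Measurable.subtype_mk (hX n)
  exact h1.prodMk (h2.prodMk hT)

/-- Every coordinate can be recovered: `W` from differences of arrival times, `X` from differences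
of partial claim sums, and `Θ` already at time `0`. Hence the identity map is measurable from the
generated σ-algebra. -/
lemma iSup_filt :
    (⨆ t, filt t : MeasurableSpace (CanonSpace D)) = Prod.instMeasurableSpace := by
  refine le_antisymm (iSup_le filt_le) ?_
  have hid : @Measurable (CanonSpace D) (CanonSpace D) (⨆ t, filt t) Prod.instMeasurableSpace
      (fun ω => ω) := by
    refine measurable_canon (fun n => ?_) (fun n => ?_) ?_
    · simp only [show ∀ ω : CanonSpace D, (W n ω : ℝ) = T (n + 1) ω - T n ω from
        fun ω => by rw [T_succ]; ring]
      exact (measurable_T_iSup _).sub (measurable_T_iSup _)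
    · have : (fun ω : CanonSpace D => (X n ω : ℝ)) = fun ω =>
          (∑ k ∈ Finset.range (n + 1), ENNReal.ofReal (X k ω : ℝ) -
            ∑ k ∈ Finset.range n, ENNReal.ofReal (X k ω : ℝ)).toReal := by
        ext ω
        rw [Finset.sum_range_succ, ENNReal.add_sub_cancel_left, ENNReal.toReal_ofReal]
        · exact (X n ω).2.le
        · exact ENNReal.sum_ne_top.2 fun _ _ => ENNReal.ofReal_ne_top
      rw [this]
      exact ((measurable_sumX_iSup _).sub (measurable_sumX_iSup _)).ennreal_toReal
    · exact Measurable.mono (measurable_Th_filt 0) (le_iSup filt 0) le_rfl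
  intro A hA
  exact hid hA

/-- A probability measure is determined by its restrictions to the filtration. -/
lemma ext_of_filt {Q Q' : Measure (CanonSpace D)} [IsProbabilityMeasure Q]
    [IsProbabilityMeasure Q']
    (h : ∀ t : ℝ≥0, ∀ A, MeasurableSet[filt t] A → Q A = Q' A) : Q = Q' := by
  refine ext_of_generate_finite (⋃ t, {A | MeasurableSet[filt t] A}) ?_ ?_ ?_ (by simp)
  · exact ((MeasurableSpace.generateFrom_iUnion_measurableSet filt).trans iSup_filt).symm
  · refine isPiSystem_iUnion_of_monotone _ (fun t => ?_) fun s t hst A hA => ?_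
    · exact @MeasurableSpace.isPiSystem_measurableSet _ (filt t)
    · exact filt_mono hst A hA
  · intro A hA
    obtain ⟨t, ht⟩ := Set.mem_iUnion.1 hA
    exact h t A ht

end Filtration

/-! ### Infinite product measures: resampling and reweighting finitely many coordinates -/

section ProductMeasure

variable {E : Type*}

lemma update_preimage_pi (n : ℕ) (s : Finset ℕ) (t : ℕ → Set E) :
    (fun p : (ℕ → E) × E => Function.update p.1 n p.2) ⁻¹' (Set.pi s t) =
      (Set.pi (s.erase n : Finset ℕ) t) ×ˢ (if n ∈ s then t n else Set.univ) := by
  ext ⟨x, y⟩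
  simp only [Set.mem_preimage, Set.mem_pi, Set.mem_prod, Finset.coe_erase, Set.mem_sdiff,
    Finset.mem_coe, Set.mem_singleton_iff]
  constructor
  · intro h
    refine ⟨fun i hi => by simpa [Function.update_of_ne hi.2] using h i hi.1, ?_⟩
    split_ifs with hn
    · simpa using h n hn
    · trivial
  · rintro ⟨h1, h2⟩ i hi
    by_cases hin : i = n
    · subst hin; simpa [hi] using h2
    · simpa [Function.update_of_ne hin] using h1 i ⟨hi, hin⟩

/-- Replace all coordinates from the `n`-th on by the constant `c`. -/
def freeze (n : ℕ) (c : E) (w : ℕ → E) (j : ℕ) : E := if j < n then w j else c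

lemma freeze_of_lt {n j : ℕ} (h : j < n) (c : E) (w : ℕ → E) : freeze n c w j = w j := if_pos h

lemma freeze_of_le {n j : ℕ} (h : n ≤ j) (c : E) (w : ℕ → E) : freeze n c w j = c :=
  if_neg (not_lt.2 h)

lemma freeze_update (n : ℕ) (c y : E) (w : ℕ → E) :
    freeze n c (Function.update w n y) = freeze n c w := by
  ext1 j
  unfold freeze
  split_ifs with h
  · rw [Function.update_of_ne h.ne]
  · rfl

variable [MeasurableSpace E]

lemma measurable_update_prod (n : ℕ) :
    Measurable fun p : (ℕ → E) × E => Function.update p.1 n p.2 := by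
  refine measurable_pi_lambda _ fun j => ?_
  by_cases h : j = n
  · subst h; simpa using measurable_snd
  · simp only [Function.update_of_ne h]; fun_prop

/-- Resampling one coordinate does not change a product measure. -/
lemma infinitePi_resample (μ : ℕ → Measure E) [∀ i, IsProbabilityMeasure (μ i)] (n : ℕ) :
    ((Measure.infinitePi μ).prod (μ n)).map (fun p => Function.update p.1 n p.2) =
      Measure.infinitePi μ := by
  refine Measure.eq_infinitePi _ fun s t ht => ?_
  rw [Measure.map_apply (measurable_update_prod n) (.pi s.countable_toSet fun i _ => ht i),
    update_preimage_pi, Measure.prod_prod, Measure.infinitePi_pi _ fun i _ => ht i]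
  split_ifs with hn
  · exact Finset.prod_erase_mul s (fun i => μ i (t i)) hn
  · rw [measure_univ, mul_one, Finset.erase_eq_of_notMem hn]

lemma lintegral_infinitePi_resample (μ : ℕ → Measure E) [∀ i, IsProbabilityMeasure (μ i)]
    (n : ℕ) {f : (ℕ → E) → ℝ≥0∞} (hf : Measurable f) :
    ∫⁻ w, f w ∂(Measure.infinitePi μ) =
      ∫⁻ w, ∫⁻ y, f (Function.update w n y) ∂(μ n) ∂(Measure.infinitePi μ) := by
  conv_lhs => rw [← infinitePi_resample μ n]
  rw [lintegral_map hf (measurable_update_prod n), lintegral_prod]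
  exact (hf.comp (measurable_update_prod n)).aemeasurable

/-- After resampling coordinate `n`, the weight depends only on the fresh copy, so the mass of a box
splits into the untouched coordinates times the reweighted one. -/
lemma infinitePi_withDensity_eval (μ : ℕ → Measure E) [∀ i, IsProbabilityMeasure (μ i)] (n : ℕ)
    {r : E → ℝ≥0∞} (hr : Measurable r) [IsProbabilityMeasure ((μ n).withDensity r)] :
    (Measure.infinitePi μ).withDensity (fun w => r (w n)) =
      Measure.infinitePi (Function.update μ n ((μ n).withDensity r)) := by
  have : ∀ i, IsProbabilityMeasure (Function.update μ n ((μ n).withDensity r) i) := by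
    intro i
    by_cases h : i = n
    · subst h; simpa
    · simpa [Function.update_of_ne h] using (inferInstance : IsProbabilityMeasure (μ i))
  refine Measure.eq_infinitePi _ fun s t ht => ?_
  have hbox : MeasurableSet (Set.pi (s : Set ℕ) t) := .pi s.countable_toSet fun i _ => ht i
  have hn' : MeasurableSet (if n ∈ s then t n else Set.univ) := by
    split_ifs
    exacts [ht n, .univ]
  rw [withDensity_apply _ hbox]
  conv_lhs => rw [← infinitePi_resample μ n]
  rw [setLIntegral_map hbox (f := fun w : ℕ → E => r (w n)) (by fun_prop)
    (measurable_update_prod n),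
    update_preimage_pi]
  simp only [Function.update_self]
  rw [← Measure.prod_restrict, lintegral_prod _ (by fun_prop)]
  simp only [lintegral_const, Measure.restrict_apply MeasurableSet.univ, Set.univ_inter]
  rw [Measure.infinitePi_pi _ fun i _ => ht i, ← withDensity_apply _ hn', mul_comm]
  have hprod : ∏ i ∈ s.erase n, μ i (t i) =
      ∏ i ∈ s.erase n, Function.update μ n ((μ n).withDensity r) i (t i) := by
    refine Finset.prod_congr rfl fun i hi => ?_
    rw [Function.update_of_ne (Finset.ne_of_mem_erase hi)]
  rw [hprod]
  split_ifs with hn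
  · rw [← Finset.prod_erase_mul s _ hn, Function.update_self]
  · rw [measure_univ, mul_one, Finset.erase_eq_of_notMem hn]

/-- Induction on `n`: when the weight at coordinate `n` is applied, that coordinate still has law
`k`. Only finitely many coordinates are reweighted, as the two full product laws are in general
mutually singular. -/
lemma infinitePi_withDensity_prod (k : Measure E) [IsProbabilityMeasure k]
    {r : E → ℝ≥0∞} (hr : Measurable r) [IsProbabilityMeasure (k.withDensity r)] (n : ℕ) :
    (Measure.infinitePi fun _ : ℕ => k).withDensity (fun w => ∏ j ∈ Finset.range n, r (w j)) =
      Measure.infinitePi fun j => if j < n then k.withDensity r else k := by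
  induction n with
  | zero => simp
  | succ n ih =>
    have hp : ∀ j, IsProbabilityMeasure (if j < n then k.withDensity r else k) := by
      intro j; split_ifs <;> infer_instance
    have h0 : (if n < n then k.withDensity r else k) = k := by simp
    have hp' : IsProbabilityMeasure
        ((if n < n then k.withDensity r else k).withDensity r) := by rw [h0]; infer_instance
    have h1 := infinitePi_withDensity_eval (fun j => if j < n then k.withDensity r else k) n hr
    simp only [Finset.prod_range_succ]
    have h2 : (fun w : ℕ → E => (∏ j ∈ Finset.range n, r (w j)) * r (w n)) =
        (fun w : ℕ → E => ∏ j ∈ Finset.range n, r (w j)) * fun w => r (w n) := rfl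
    rw [h2, withDensity_mul _ (by fun_prop) (by fun_prop), ih, h1]
    congr 1
    ext1 j
    by_cases hj : j = n
    · subst hj; simp
    · rw [Function.update_of_ne hj]
      have : j < n ↔ j < n + 1 := by omega
      simp only [this]

lemma measurable_freeze (n : ℕ) (c : E) : Measurable (freeze n c) := by
  refine measurable_pi_lambda _ fun j => ?_
  unfold freeze
  split_ifs
  · exact measurable_pi_apply j
  · exact measurable_const

lemma infinitePi_map_freeze (μ : ℕ → Measure E) [∀ i, IsProbabilityMeasure (μ i)] (n : ℕ) (c : E) :
    (Measure.infinitePi μ).map (freeze n c) =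
      Measure.infinitePi fun j => if j < n then μ j else Measure.dirac c := by
  have h := Measure.infinitePi_map_pi μ (f := fun j x => if j < n then x else c) (fun j => by
    split_ifs
    · exact measurable_id
    · exact measurable_const)
  refine h.trans ?_
  congr 1
  ext1 j
  split_ifs
  · exact Measure.map_id
  · rw [Measure.map_const, measure_univ, one_smul]

/-- Change of measure in the first `n` coordinates. -/
lemma lintegral_infinitePi_withDensity (k : Measure E) [IsProbabilityMeasure k]
    {r : E → ℝ≥0∞} (hr : Measurable r) [IsProbabilityMeasure (k.withDensity r)] (n : ℕ) (c : E)
    {f : (ℕ → E) → ℝ≥0∞} (hf : Measurable f) :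
    ∫⁻ w, f (freeze n c w) ∂(Measure.infinitePi fun _ => k.withDensity r) =
      ∫⁻ w, (∏ j ∈ Finset.range n, r (w j)) * f (freeze n c w)
        ∂(Measure.infinitePi fun _ => k) := by
  have hp : ∀ j, IsProbabilityMeasure (if j < n then k.withDensity r else k) := by
    intro j; split_ifs <;> infer_instance
  have hf' : Measurable fun w => f (freeze n c w) := hf.comp (measurable_freeze n c)
  rw [← lintegral_map hf (measurable_freeze n c), infinitePi_map_freeze]
  -- Freezing discards the coordinates from `n` on, so their law may be taken to be `k` instead of
  -- the reweighted one.
  have : (fun j => if j < n then k.withDensity r else Measure.dirac c) =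
      fun j => if j < n then (if j < n then k.withDensity r else k) else Measure.dirac c := by
    ext1 j; split_ifs <;> rfl
  rw [this, ← infinitePi_map_freeze (fun j => if j < n then k.withDensity r else k),
    lintegral_map hf (measurable_freeze n c), ← infinitePi_withDensity_prod k hr,
    lintegral_withDensity_eq_lintegral_mul _ (by fun_prop) hf']
  rfl

end ProductMeasure

lemma lintegral_prod_infinitePi {E : Type*} [MeasurableSpace E] (μ : Measure E)
    [IsProbabilityMeasure μ] {u : E → ℝ≥0∞} (hu : Measurable u) (n : ℕ) :
    ∫⁻ w, ∏ j ∈ Finset.range n, u (w j) ∂(Measure.infinitePi fun _ : ℕ => μ) =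
      (∫⁻ y, u y ∂μ) ^ n := by
  induction n with
  | zero => simp
  | succ n ih =>
    rw [lintegral_infinitePi_resample _ n (by fun_prop)]
    have : ∀ (w : ℕ → E) (y : E), ∏ j ∈ Finset.range (n + 1), u (Function.update w n y j) =
        (∏ j ∈ Finset.range n, u (w j)) * u y := by
      intro w y
      rw [Finset.prod_range_succ, Function.update_self]
      congr 1
      refine Finset.prod_congr rfl fun j hj => ?_
      rw [Function.update_of_ne (Finset.mem_range.1 hj).ne]
    simp only [this]
    have h2 : ∀ w : ℕ → E, ∫⁻ y, (∏ j ∈ Finset.range n, u (w j)) * u y ∂μ =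
        (∏ j ∈ Finset.range n, u (w j)) * ∫⁻ y, u y ∂μ := fun w => lintegral_const_mul _ hu
    simp only [h2]
    rw [lintegral_mul_const _ (by fun_prop), ih, pow_succ]

/-- Partial sums of i.i.d. positive random variables are almost surely unbounded. -/
lemma ae_exists_lt_sum (μ : Measure PosReal) [IsProbabilityMeasure μ] :
    ∀ᵐ w ∂(Measure.infinitePi fun _ : ℕ => μ), ∀ t : ℝ, ∃ n : ℕ,
      t < ∑ k ∈ Finset.range n, (w k : ℝ) := by
  -- Chernoff bound: the Laplace transform of `μ` at `1` is strictly below `1` because the variables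
  -- are positive, and no moment assumption is needed.
  set u : PosReal → ℝ≥0∞ := fun y => ENNReal.ofReal (Real.exp (-(y : ℝ))) with hu
  have hum : Measurable u := by rw [hu]; fun_prop
  have hprod : ∀ (n : ℕ) (w : ℕ → PosReal), ∏ j ∈ Finset.range n, u (w j) =
      ENNReal.ofReal (Real.exp (-∑ k ∈ Finset.range n, (w k : ℝ))) := by
    intro n w
    rw [hu, ← ENNReal.ofReal_prod_of_nonneg fun _ _ => (Real.exp_pos _).le, ← Real.exp_sum,
      Finset.sum_neg_distrib]
  have hc : ∫⁻ y, u y ∂μ < 1 := by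
    have : ∫⁻ y, u y ∂μ < ∫⁻ _, 1 ∂μ := by
      have hlt : ∀ y, u y < 1 := by
        intro y
        rw [hu, ← ENNReal.ofReal_one]
        refine (ENNReal.ofReal_lt_ofReal_iff one_pos).2 ?_
        rw [Real.exp_lt_one_iff]
        have : (0 : ℝ) < y := y.2
        linarith
      refine lintegral_strict_mono (IsProbabilityMeasure.ne_zero μ) aemeasurable_const ?_
        (ae_of_all _ hlt)
      refine ne_top_of_le_ne_top (b := 1) (by simp) ?_
      calc ∫⁻ y, u y ∂μ ≤ ∫⁻ _, 1 ∂μ := lintegral_mono fun y => (hlt y).le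
        _ = 1 := by simp
    simpa using this
  have key : ∀ m : ℕ, ∀ᵐ w ∂(Measure.infinitePi fun _ : ℕ => μ), ∃ n : ℕ,
      (m : ℝ) < ∑ k ∈ Finset.range n, (w k : ℝ) := by
    intro m
    rw [ae_iff]
    set A := {w : ℕ → PosReal | ¬ ∃ n : ℕ, (m : ℝ) < ∑ k ∈ Finset.range n, (w k : ℝ)} with hA
    -- On `A` every partial sum is at most `m`; Markov's inequality for the product of the `u (w j)`
    -- gives a bound that tends to `0` as `n` grows.
    have hle : ∀ n : ℕ, ENNReal.ofReal (Real.exp (-m)) * (Measure.infinitePi fun _ : ℕ => μ) A ≤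
        (∫⁻ y, u y ∂μ) ^ n := by
      intro n
      rw [← lintegral_prod_infinitePi μ hum n]
      refine le_trans ?_ (mul_meas_ge_le_lintegral (f := fun w : ℕ → PosReal =>
        ∏ j ∈ Finset.range n, u (w j)) (by fun_prop) (ENNReal.ofReal (Real.exp (-m))))
      gcongr
      intro w hw
      simp only [hA, not_exists, not_lt, Set.mem_ofPred_eq] at hw
      simp only [Set.mem_ofPred_eq, hprod]
      exact ENNReal.ofReal_le_ofReal (Real.exp_le_exp.2 (neg_le_neg (hw n)))
    have h0 : ENNReal.ofReal (Real.exp (-m)) * (Measure.infinitePi fun _ : ℕ => μ) A ≤ 0 :=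
      ge_of_tendsto' (ENNReal.tendsto_pow_atTop_nhds_zero_of_lt_one hc) hle
    have h1 := mul_eq_zero.1 (le_antisymm h0 zero_le)
    refine h1.resolve_left ?_
    exact (ENNReal.ofReal_pos.2 (Real.exp_pos _)).ne'
  filter_upwards [ae_all_iff.2 key] with w hw t
  obtain ⟨m, hm⟩ := exists_nat_gt t
  obtain ⟨n, hn⟩ := hw m
  exact ⟨n, hm.trans hn⟩

/-! ### Change of law for a finite past and a constraint on the next coordinate -/

section FirstCoordinates

variable {E : Type*} [MeasurableSpace E]

/-- The frozen past ignores coordinate `n`, so that coordinate can be resampled independently of it.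
-/
lemma lintegral_infinitePi_freeze_eval (k : Measure E) [IsProbabilityMeasure k] (n : ℕ) (c : E)
    {f : (ℕ → E) × E → ℝ≥0∞} (hf : Measurable f) :
    ∫⁻ w, f (freeze n c w, w n) ∂(Measure.infinitePi fun _ : ℕ => k) =
      ∫⁻ w, ∫⁻ y, f (freeze n c w, y) ∂k ∂(Measure.infinitePi fun _ : ℕ => k) := by
  have hm : Measurable fun w : ℕ → E => f (freeze n c w, w n) :=
    hf.comp ((measurable_freeze n c).prodMk (measurable_pi_apply n))
  rw [lintegral_infinitePi_resample _ n hm]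
  simp only [freeze_update, Function.update_self]

/-- The source of the quotient of tails in the density. Of coordinate `n` only membership in a slice
of `B` is observed, so integrating it out leaves the new mass of the slice. The past is then
reweighted, and dividing by the old mass of the slice brings the indicator back under the old law.
-/
lemma lintegral_infinitePi_girsanov (k : Measure E) [IsProbabilityMeasure k]
    {r : E → ℝ≥0∞} (hr : Measurable r) [IsProbabilityMeasure (k.withDensity r)] (n : ℕ) (c : E)
    {ψ : (ℕ → E) → ℝ≥0∞} (hψ : Measurable ψ) {B : Set ((ℕ → E) × E)} (hB : MeasurableSet B)
    (hk : ∀ w, k (Prod.mk w ⁻¹' B) ≠ 0) :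
    ∫⁻ w, ψ (freeze n c w) * B.indicator 1 (freeze n c w, w n)
        ∂(Measure.infinitePi fun _ : ℕ => k.withDensity r) =
      ∫⁻ w, (∏ j ∈ Finset.range n, r (w j)) *
        (k.withDensity r (Prod.mk (freeze n c w) ⁻¹' B) / k (Prod.mk (freeze n c w) ⁻¹' B) *
          (ψ (freeze n c w) * B.indicator 1 (freeze n c w, w n)))
        ∂(Measure.infinitePi fun _ : ℕ => k) := by
  have hind : ∀ (m : Measure E) (w : ℕ → E),
      ∫⁻ y, B.indicator (1 : (ℕ → E) × E → ℝ≥0∞) (w, y) ∂m = m (Prod.mk w ⁻¹' B) := by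
    intro m w
    rw [← lintegral_indicator_one (measurable_prodMk_left hB)]
    rfl
  have hl : Measurable fun w => k.withDensity r (Prod.mk w ⁻¹' B) :=
    measurable_measure_prodMk_left hB
  have hk' : Measurable fun w => k (Prod.mk w ⁻¹' B) :=
    measurable_measure_prodMk_left hB
  rw [lintegral_infinitePi_freeze_eval (k.withDensity r) n c
    (f := fun p => ψ p.1 * B.indicator 1 p)
    ((hψ.comp measurable_fst).mul (measurable_one.indicator hB))]
  have hm : ∀ w : ℕ → E, Measurable fun y => B.indicator (1 : (ℕ → E) × E → ℝ≥0∞) (w, y) :=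
    fun w => (measurable_one.indicator hB).comp measurable_prodMk_left
  have e1 : ∀ w : ℕ → E, ∫⁻ y, ψ (freeze n c w) * B.indicator 1 (freeze n c w, y)
      ∂(k.withDensity r) = ψ (freeze n c w) * k.withDensity r (Prod.mk (freeze n c w) ⁻¹' B) := by
    intro w
    rw [lintegral_const_mul _ (hm _), hind]
  simp only [e1]
  rw [lintegral_infinitePi_withDensity k hr n c
    (f := fun w => ψ w * k.withDensity r (Prod.mk w ⁻¹' B)) (hψ.mul hl)]
  have hfr : ∀ w : ℕ → E, ∏ j ∈ Finset.range n, r (freeze n c w j) =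
      ∏ j ∈ Finset.range n, r (w j) := fun w =>
    Finset.prod_congr rfl fun j hj => by rw [freeze_of_lt (Finset.mem_range.1 hj)]
  have h3 := lintegral_infinitePi_freeze_eval k n c (f := fun p =>
    (∏ j ∈ Finset.range n, r (p.1 j)) *
        (k.withDensity r (Prod.mk p.1 ⁻¹' B) / k (Prod.mk p.1 ⁻¹' B) *
          (ψ p.1 * B.indicator 1 p)))
    (Measurable.mul (by fun_prop) (Measurable.mul
      (Measurable.div (hl.comp measurable_fst) (hk'.comp measurable_fst))
      ((hψ.comp measurable_fst).mul (measurable_one.indicator hB))))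
  simp only [hfr] at h3
  rw [h3]
  refine lintegral_congr fun w => ?_
  rw [lintegral_const_mul _ (((hm _).const_mul _).const_mul _),
    lintegral_const_mul _ ((hm _).const_mul _), lintegral_const_mul _ (hm _), hind]
  congr 1
  have h0 := hk (freeze n c w)
  have h0' : k (Prod.mk (freeze n c w) ⁻¹' B) ≠ ⊤ := measure_ne_top _ _
  rw [mul_comm (ψ _) (k _), ← mul_assoc, ENNReal.div_mul_cancel h0 h0', mul_comm]

end FirstCoordinates

/-! ### The renewal law at a fixed parameter and its Girsanov formula -/

section Point

variable {D : Type} [MeasurableSpace D]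

/-- The law of `(W, X, Θ)` when `Θ = θ`, `W` is i.i.d. with law `k`, and `X` is i.i.d. with law `ν`
and independent of `W`. -/
def point (k ν : Measure PosReal) (θ : D) : Measure (CanonSpace D) :=
  (Measure.infinitePi fun _ : ℕ => k).prod
    ((Measure.infinitePi fun _ : ℕ => ν).prod (Measure.dirac θ))

instance (k ν : Measure PosReal) [IsProbabilityMeasure k] [IsProbabilityMeasure ν] (θ : D) :
    IsProbabilityMeasure (point k ν θ) := by
  unfold point; infer_instance

variable (k ν : Measure PosReal) [IsProbabilityMeasure k] [IsProbabilityMeasure ν] (θ : D)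

lemma lintegral_point {f : CanonSpace D → ℝ≥0∞} (hf : Measurable f) :
    ∫⁻ ω, f ω ∂(point k ν θ) = ∫⁻ x, ∫⁻ w, f (w, x, θ) ∂(Measure.infinitePi fun _ : ℕ => k)
      ∂(Measure.infinitePi fun _ : ℕ => ν) := by
  rw [point, lintegral_prod_symm _ hf.aemeasurable, lintegral_prod _
    (Measurable.aemeasurable (Measurable.lintegral_prod_left' hf))]
  refine lintegral_congr fun x => ?_
  rw [lintegral_dirac' _]
  exact (Measurable.lintegral_prod_left' hf).comp measurable_prodMk_left

omit [IsProbabilityMeasure k] in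
lemma point_map_W : (point k ν θ).map (fun ω n => W n ω) = Measure.infinitePi fun _ => k := by
  have : (fun (ω : CanonSpace D) n => W n ω) = Prod.fst := rfl
  rw [this, point, Measure.map_fst_prod, measure_univ, one_smul]

lemma ae_Th_eq {p : D → Prop} (hp : p θ) (hpm : MeasurableSet {θ | p θ}) :
    ∀ᵐ ω ∂(point k ν θ), p (Th ω) := by
  have h : (point k ν θ).map Th = Measure.dirac θ := by
    have : (Th : CanonSpace D → D) = Prod.snd ∘ Prod.snd := rfl
    rw [this, ← Measure.map_map measurable_snd measurable_snd, point, Measure.map_snd_prod,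
      measure_univ, one_smul, Measure.map_snd_prod, measure_univ, one_smul]
  have h2 : ∀ᵐ θ' ∂((point k ν θ).map Th), p θ' := by
    rw [h, ae_dirac_iff hpm]; exact hp
  exact ae_of_ae_map measurable_Th.aemeasurable h2

lemma ae_N_ne_top : ∀ᵐ ω ∂(point k ν θ), ∀ t, N t ω ≠ ⊤ := by
  have h := ae_exists_lt_sum k
  rw [← point_map_W k ν θ] at h
  filter_upwards [ae_of_ae_map measurable_Wseq.aemeasurable h] with ω hω t htop
  obtain ⟨n, hn⟩ := hω t
  have : (n : ℕ∞) ≤ N t ω := by rw [htop]; exact le_top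
  rw [le_N_iff] at this
  exact absurd hn (not_lt.2 this)

/-- Replace everything that happens after the `n`-th arrival. -/
def freezePath (n : ℕ) (c : PosReal) (ω : CanonSpace D) : CanonSpace D :=
  (freeze n c ω.1, freeze n c ω.2.1, ω.2.2)

omit [MeasurableSpace D] in
lemma T_freezePath {m n : ℕ} (h : m ≤ n) (c : PosReal) (ω : CanonSpace D) :
    T m (freezePath n c ω) = T m ω := by
  refine Finset.sum_congr rfl fun j hj => ?_
  rw [show W j (freezePath n c ω) = freeze n c ω.1 j from rfl,
    freeze_of_lt ((Finset.mem_range.1 hj).trans_le h)]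
  rfl

omit [MeasurableSpace D] in
-- Since `c > t`, the first replaced interarrival time alone carries the frozen path beyond `t`, so
-- no arrival before `t` is added or lost.
lemma N_freezePath {n : ℕ} {t : ℝ≥0} {c : PosReal} (hc : (t : ℝ) < c) {ω : CanonSpace D}
    (h : N t ω = n) {s : ℝ≥0} (hs : s ≤ t) : N s (freezePath n c ω) = N s ω := by
  have hN : ∀ ω' : CanonSpace D, T n ω' = T n ω → (t : ℝ) < T (n + 1) ω' → N t ω' = n :=
    fun ω' h1 h2 => by
    rw [N_eq_iff] at h ⊢
    exact ⟨h1 ▸ h.1, h2⟩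
  have hfr : N t (freezePath n c ω) = n := by
    refine hN _ (T_freezePath le_rfl c ω) ?_
    rw [T_succ, show W n (freezePath n c ω) = freeze n c ω.1 n from rfl, freeze_of_le le_rfl]
    have := T_nonneg n (freezePath n c ω)
    linarith
  have hle : N s ω ≤ n := h ▸ N_mono ω hs
  obtain ⟨m, hm⟩ := ENat.ne_top_iff_exists.1 (ne_top_of_le_ne_top (ENat.natCast_ne_top n) hle)
  have hmn : m ≤ n := by rw [← hm] at hle; exact_mod_cast hle
  rw [← hm, N_eq_iff]
  have h2 := (N_eq_iff m s ω).1 hm.symm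
  rw [T_freezePath hmn]
  refine ⟨h2.1, ?_⟩
  -- If `m = n`, the next arrival is one of those moved by freezing, but it still lies after `t ≥
  -- s`.
  rcases hmn.lt_or_eq with hlt | rfl
  · rw [T_freezePath (by omega : m + 1 ≤ n)]; exact h2.2
  · exact lt_of_le_of_lt (by exact_mod_cast hs) ((N_eq_iff _ _ _).1 hfr).2

lemma mem_iff_freezePath_mem {n : ℕ} {t : ℝ≥0} {c : PosReal} (hc : (t : ℝ) < c)
    {A : Set (CanonSpace D)} (hA : MeasurableSet[filt t] A) {ω : CanonSpace D} (h : N t ω = n) :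
    ω ∈ A ↔ freezePath n c ω ∈ A := by
  refine mem_iff_of_measurableSet_filt (ω := ω) (ω' := freezePath n c ω) (fun s hs => ?_) rfl hA
  have hs' := N_freezePath hc h hs
  have hle : N s ω ≤ n := h ▸ N_mono ω hs
  obtain ⟨m, hm⟩ := ENat.ne_top_iff_exists.1 (ne_top_of_le_ne_top (ENat.natCast_ne_top n) hle)
  have hmn : m ≤ n := by rw [← hm] at hle; exact_mod_cast hle
  rw [S_of_N_eq hm.symm, S_of_N_eq (hs'.trans hm.symm)]
  refine Finset.sum_congr rfl fun j hj => ?_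
  rw [show X j (freezePath n c ω) = freeze n c ω.2.1 j from rfl,
    freeze_of_lt ((Finset.mem_range.1 hj).trans_le hmn)]
  rfl

lemma measurableSet_tail (n : ℕ) (t : ℝ≥0) :
    MeasurableSet {p : (ℕ → PosReal) × PosReal |
      (t : ℝ) - ∑ k ∈ Finset.range n, (p.1 k : ℝ) < p.2} :=
  measurableSet_lt (by fun_prop) (by fun_prop)

/-- The likelihood ratio at time `t` when the interarrival law changes from `k` to
`k.withDensity r` and the claim law from `ν` to `ν.withDensity g`. -/
def likelihood (k l : Measure PosReal) (r g : PosReal → ℝ≥0∞) (n : ℕ) (t : ℝ≥0)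
    (ω : CanonSpace D) : ℝ≥0∞ :=
  (∏ j ∈ Finset.range n, r (W j ω)) * (∏ j ∈ Finset.range n, g (X j ω)) *
    (l {y : PosReal | (t : ℝ) - T n ω < y} / k {y : PosReal | (t : ℝ) - T n ω < y})

lemma measurable_measure_lt (m : Measure PosReal) [SFinite m] :
    Measurable fun s : ℝ => m {y : PosReal | s < y} :=
  measurable_measure_prodMk_left (s := {p : ℝ × PosReal | p.1 < p.2})
    (measurableSet_lt (by fun_prop) (by fun_prop))

lemma measurable_likelihood (k l : Measure PosReal) [SFinite k] [SFinite l]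
    {r g : PosReal → ℝ≥0∞} (hr : Measurable r) (hg : Measurable g) (n : ℕ) (t : ℝ≥0) :
    Measurable (likelihood (D := D) k l r g n t) := by
  have hT := measurable_T (D := D) n
  have hW := measurable_W (D := D)
  have hX := measurable_X (D := D)
  refine Measurable.mul (Measurable.mul ?_ ?_) (Measurable.div ?_ ?_)
  · exact Finset.measurable_prod _ fun j _ => hr.comp (hW j)
  · exact Finset.measurable_prod _ fun j _ => hg.comp (hX j)
  · exact (measurable_measure_lt l).comp (measurable_const.sub hT)
  · exact (measurable_measure_lt k).comp (measurable_const.sub hT)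

/-- With `n` arrivals up to `t`, the indicator of the event is a function of the frozen path times
the indicator that the next interarrival time exceeds `t - T n`. The interarrival law is changed for
fixed claims, and the claim law afterwards. -/
lemma point_withDensity_inter {r g : PosReal → ℝ≥0∞} (hr : Measurable r) (hg : Measurable g)
    [IsProbabilityMeasure (k.withDensity r)] [IsProbabilityMeasure (ν.withDensity g)]
    (hk : ∀ s : ℝ, k {y : PosReal | s < y} ≠ 0) {t : ℝ≥0} {A : Set (CanonSpace D)}
    (hA : MeasurableSet[filt t] A) (n : ℕ) :
    point (k.withDensity r) (ν.withDensity g) θ (A ∩ {ω | N t ω = n}) =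
      ∫⁻ ω in A ∩ {ω | N t ω = n}, likelihood k (k.withDensity r) r g n t ω ∂(point k ν θ) := by
  have hA' : MeasurableSet A := filt_le t A hA
  have hN : MeasurableSet {ω : CanonSpace D | N t ω = n} :=
    measurable_N t (measurableSet_singleton _)
  obtain ⟨c, hc⟩ : ∃ c : PosReal, (t : ℝ) < c :=
    ⟨⟨t + 1, by have := t.2; exact Set.mem_Ioi.2 (by positivity)⟩, by simp⟩
  set B : Set ((ℕ → PosReal) × PosReal) :=
    {p | (t : ℝ) - ∑ k ∈ Finset.range n, (p.1 k : ℝ) < p.2} with hBdef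
  have hB : MeasurableSet B := measurableSet_tail n t
  have hsl : ∀ w : ℕ → PosReal, Prod.mk w ⁻¹' B =
      {y : PosReal | (t : ℝ) - ∑ k ∈ Finset.range n, (w k : ℝ) < y} := fun w => rfl
  have hsum : ∀ w : ℕ → PosReal, ∑ k ∈ Finset.range n, ((freeze n c w k : PosReal) : ℝ) =
      ∑ k ∈ Finset.range n, (w k : ℝ) := fun w =>
    Finset.sum_congr rfl fun j hj => by rw [freeze_of_lt (Finset.mem_range.1 hj)]
  set C : Set (CanonSpace D) := A ∩ {ω | T n ω ≤ t} with hC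
  have hCm : MeasurableSet C := hA'.inter (measurableSet_le (measurable_T n) measurable_const)
  -- The factorization into past and next coordinate. The requirement `T n ≤ t` is put into `C`,
  -- where it survives freezing; the tail requirement is `B`.
  have hind : ∀ (w x : ℕ → PosReal),
      (A ∩ {ω : CanonSpace D | N t ω = n}).indicator (1 : CanonSpace D → ℝ≥0∞) (w, x, θ) =
        C.indicator 1 (freeze n c w, freeze n c x, θ) * B.indicator 1 (freeze n c w, w n) := by
    intro w x
    have hTT : T n ((freeze n c w, freeze n c x, θ) : CanonSpace D) = T n ((w, x, θ)) :=
      T_freezePath le_rfl c (w, x, θ)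
    have hBm : (freeze n c w, w n) ∈ B ↔ (t : ℝ) < T (n + 1) ((w, x, θ) : CanonSpace D) := by
      simp only [hBdef, Set.mem_ofPred_eq]
      rw [hsum, T_succ, sub_lt_iff_lt_add']
      rfl
    by_cases hmem : N t ((w, x, θ) : CanonSpace D) = n
    · have h1 := mem_iff_freezePath_mem hc hA hmem
      have h2 := (N_eq_iff _ _ _).1 hmem
      have h3 : ((w, x, θ) : CanonSpace D) ∈ A ↔
          ((freeze n c w, freeze n c x, θ) : CanonSpace D) ∈ C := by
        rw [h1, hC, Set.mem_inter_iff, Set.mem_ofPred_eq, hTT]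
        exact ⟨fun h => ⟨h, h2.1⟩, fun h => h.1⟩
      rw [Set.indicator_of_mem (hBm.2 h2.2)]
      by_cases ha : ((w, x, θ) : CanonSpace D) ∈ A
      · rw [Set.indicator_of_mem (Set.mem_inter ha hmem), Set.indicator_of_mem (h3.1 ha)]; simp
      · rw [Set.indicator_of_notMem fun h => ha h.1, Set.indicator_of_notMem fun h => ha (h3.2 h)]
        simp
    · rw [Set.indicator_of_notMem fun h => hmem h.2]
      rw [N_eq_iff, not_and_or] at hmem
      rcases hmem with hmem | hmem
      · rw [Set.indicator_of_notMem (s := C), zero_mul]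
        rintro ⟨-, h⟩
        exact hmem (hTT ▸ h)
      · rw [Set.indicator_of_notMem (s := B), mul_zero]
        exact fun h => hmem (hBm.1 h)
  have hψ : ∀ x : ℕ → PosReal, Measurable fun w : ℕ → PosReal =>
      C.indicator (1 : CanonSpace D → ℝ≥0∞) (w, x, θ) := fun x =>
    (measurable_one.indicator hCm).comp (by fun_prop)
  have hgen := fun x => lintegral_infinitePi_girsanov k hr n c (hψ x) hB (fun w => by
    rw [hsl]; exact hk _)
  have hl : Measurable fun w => k.withDensity r (Prod.mk w ⁻¹' B) :=
    measurable_measure_prodMk_left hB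
  have hk' : Measurable fun w => k (Prod.mk w ⁻¹' B) :=
    measurable_measure_prodMk_left hB
  have hfm := measurable_freeze n c
  set J : (ℕ → PosReal) × (ℕ → PosReal) → ℝ≥0∞ := fun p =>
      (∏ j ∈ Finset.range n, r (p.2 j)) *
        (k.withDensity r (Prod.mk (freeze n c p.2) ⁻¹' B) / k (Prod.mk (freeze n c p.2) ⁻¹' B) *
          (C.indicator (1 : CanonSpace D → ℝ≥0∞) (freeze n c p.2, p.1, θ) *
            B.indicator 1 (freeze n c p.2, p.2 n))) with hJdef
  have hJ : Measurable J := by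
    refine Measurable.mul (by fun_prop) (Measurable.mul (Measurable.div ?_ ?_)
      (Measurable.mul ?_ ?_))
    · exact hl.comp (hfm.comp measurable_snd)
    · exact hk'.comp (hfm.comp measurable_snd)
    · exact (measurable_one.indicator hCm).comp (by fun_prop)
    · exact (measurable_one.indicator hB).comp (by fun_prop)
  rw [← lintegral_indicator_one (hA'.inter hN),
    lintegral_point _ _ _ (measurable_one.indicator (hA'.inter hN))]
  simp only [hind, hgen]
  -- The inner integral sees the claims only through their first `n` values, so their change of law
  -- costs the product of the `g (x j)`.
  have hx := lintegral_infinitePi_withDensity ν hg n c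
    (f := fun x => ∫⁻ w, J (x, w) ∂(Measure.infinitePi fun _ : ℕ => k)) hJ.lintegral_prod_right'
  refine hx.trans ?_
  rw [← lintegral_indicator (hA'.inter hN), lintegral_point _ _ _
    ((measurable_likelihood _ _ hr hg n t).indicator (hA'.inter hN))]
  refine lintegral_congr fun x => ?_
  have hJx : Measurable fun w => J (freeze n c x, w) := hJ.comp measurable_prodMk_left
  rw [← lintegral_const_mul _ hJx]
  refine lintegral_congr fun w => ?_
  have hmul : (A ∩ {ω : CanonSpace D | N t ω = n}).indicator
      (fun ω => likelihood k (k.withDensity r) r g n t ω) (w, x, θ) =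
      likelihood k (k.withDensity r) r g n t (w, x, θ) *
        (A ∩ {ω : CanonSpace D | N t ω = n}).indicator (1 : CanonSpace D → ℝ≥0∞) (w, x, θ) := by
    rw [← Set.indicator_mul_right]; simp
  rw [hmul, hind]
  simp only [hJdef, hsl, hsum, likelihood, W, X, T]
  ring

/-- Girsanov's formula for compound renewal processes. -/
lemma point_withDensity_apply {r g : PosReal → ℝ≥0∞} (hr : Measurable r) (hg : Measurable g)
    [IsProbabilityMeasure (k.withDensity r)] [IsProbabilityMeasure (ν.withDensity g)]
    (hk : ∀ s : ℝ, k {y : PosReal | s < y} ≠ 0) {t : ℝ≥0} {A : Set (CanonSpace D)}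
    (hA : MeasurableSet[filt t] A) :
    point (k.withDensity r) (ν.withDensity g) θ A =
      ∫⁻ ω in A, likelihood k (k.withDensity r) r g (N t ω).toNat t ω ∂(point k ν θ) := by
  have hA' : MeasurableSet A := filt_le t A hA
  have hN : ∀ n : ℕ, MeasurableSet (A ∩ {ω : CanonSpace D | N t ω = n}) := fun n =>
    hA'.inter (measurable_N t (measurableSet_singleton _))
  have hdisj : Pairwise (Function.onFun Disjoint
      fun n : ℕ => A ∩ {ω : CanonSpace D | N t ω = n}) := by
    intro m n hmn
    refine Set.disjoint_left.2 fun ω h1 h2 => hmn ?_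
    have : (m : ℕ∞) = n := h1.2.symm.trans h2.2
    exact_mod_cast this
  -- Non-explosion is needed under the old and under the new law, hence the quantification over both
  -- arguments.
  have hunion : ∀ (k ν : Measure PosReal) [IsProbabilityMeasure k] [IsProbabilityMeasure ν],
      A =ᵐ[point k ν θ] ⋃ n : ℕ, A ∩ {ω | N t ω = n} := by
    intro k ν _ _
    filter_upwards [ae_N_ne_top k ν θ] with ω hω
    obtain ⟨m, hm⟩ := ENat.ne_top_iff_exists.1 (hω t)
    refine propext ⟨fun h => Set.mem_iUnion.2 ⟨m, h, hm.symm⟩, fun h => ?_⟩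
    obtain ⟨n, hn, -⟩ := Set.mem_iUnion.1 h
    exact hn
  rw [measure_congr (hunion _ _), measure_iUnion hdisj hN, setLIntegral_congr (hunion _ _),
    lintegral_iUnion hN hdisj]
  refine tsum_congr fun n => ?_
  rw [point_withDensity_inter k ν θ hr hg hk hA n]
  refine setLIntegral_congr_fun (hN n) fun ω hω => ?_
  have : N t ω = n := hω.2
  simp only [this, ENat.toNat_natCast]

end Point

lemma ext_of_pi {E : Type*} [MeasurableSpace E] {μ ν : Measure (ℕ → E)} [IsFiniteMeasure μ]
    (h : ∀ (s : Finset ℕ) (t : ℕ → Set E), (∀ i, MeasurableSet (t i)) →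
      μ (Set.pi s t) = ν (Set.pi s t)) : μ = ν := by
  refine ext_of_generate_finite (squareCylinders fun _ : ℕ => {s : Set E | MeasurableSet s})
    generateFrom_squareCylinders.symm
    (isPiSystem_squareCylinders (fun _ => MeasurableSpace.isPiSystem_measurableSet)
      fun _ => MeasurableSet.univ) ?_ ?_
  · rintro _ ⟨s, t, ht, rfl⟩
    exact h s t fun i => ht i trivial
  · simpa using h ∅ (fun _ => Set.univ) fun _ => .univ

/-! ### The canonical mixture, and its characterization by the renewal conditions -/

section Canon

variable {D : Type} [MeasurableSpace D]

lemma measurableSet_W_mem {A : Set (ℕ → PosReal)} (hA : MeasurableSet A) :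
    MeasurableSet {ω : CanonSpace D | (fun n => W n ω) ∈ A} := measurable_Wseq hA

lemma measurableSet_X_mem {B : Set (ℕ → PosReal)} (hB : MeasurableSet B) :
    MeasurableSet {ω : CanonSpace D | (fun n => X n ω) ∈ B} := measurable_Xseq hB

/-- The kernel of laws of i.i.d. sequences. -/
def iidKernel (Λ : Kernel D PosReal) [IsMarkovKernel Λ] : Kernel D (ℕ → PosReal) where
  toFun θ := Measure.infinitePi fun _ => Λ θ
  measurable' := by
    refine Measurable.measure_of_isPiSystem_of_isProbabilityMeasure
      (S := squareCylinders fun _ : ℕ => {s : Set PosReal | MeasurableSet s})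
      generateFrom_squareCylinders.symm
      (isPiSystem_squareCylinders (fun _ => MeasurableSpace.isPiSystem_measurableSet)
        fun _ => (MeasurableSet.univ : MeasurableSet (Set.univ : Set PosReal))) ?_
    rintro _ ⟨s, t, ht, rfl⟩
    have : ∀ θ, (Measure.infinitePi fun _ => Λ θ) (Set.pi s t) = ∏ i ∈ s, Λ θ (t i) :=
      fun θ => Measure.infinitePi_pi _ fun i _ => ht i trivial
    simp only [this]
    exact Finset.measurable_prod _ fun i _ => Kernel.measurable_coe _ (ht i trivial)

lemma iidKernel_apply (Λ : Kernel D PosReal) [IsMarkovKernel Λ] (θ : D) :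
    iidKernel Λ θ = Measure.infinitePi fun _ => Λ θ := rfl

instance (Λ : Kernel D PosReal) [IsMarkovKernel Λ] : IsMarkovKernel (iidKernel Λ) :=
  ⟨fun θ => by rw [iidKernel_apply]; infer_instance⟩

/-- The kernel `θ ↦ point (Λ θ) ν θ`. -/
def pointKernel (Λ : Kernel D PosReal) [IsMarkovKernel Λ] (ν : Measure PosReal)
    [IsProbabilityMeasure ν] : Kernel D (CanonSpace D) :=
  iidKernel Λ ×ₖ (Kernel.const D (Measure.infinitePi fun _ : ℕ => ν) ×ₖ Kernel.id)

/-- The law of the canonical compound mixed renewal process with structural law `π`. -/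
def canon (π : Measure D) (Λ : Kernel D PosReal) [IsMarkovKernel Λ] (ν : Measure PosReal)
    [IsProbabilityMeasure ν] : Measure (CanonSpace D) :=
  π.bind (pointKernel Λ ν)

variable (π : Measure D) [IsProbabilityMeasure π] (Λ : Kernel D PosReal) [IsMarkovKernel Λ]
  (ν : Measure PosReal) [IsProbabilityMeasure ν]

lemma pointKernel_apply (θ : D) : pointKernel Λ ν θ = point (Λ θ) ν θ := by
  rw [pointKernel, Kernel.prod_apply, Kernel.prod_apply, Kernel.const_apply, Kernel.id_apply]
  rfl

instance : IsMarkovKernel (pointKernel Λ ν) := ⟨fun θ => by rw [pointKernel_apply]; infer_instance⟩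

instance : IsProbabilityMeasure (canon π Λ ν) :=
  (inferInstance : IsProbabilityMeasure ((pointKernel Λ ν) ∘ₘ π))

omit [IsProbabilityMeasure π] in
lemma canon_apply {E : Set (CanonSpace D)} (hE : MeasurableSet E) :
    canon π Λ ν E = ∫⁻ θ, point (Λ θ) ν θ E ∂π := by
  rw [canon, Measure.bind_apply hE (Kernel.aemeasurable _)]
  simp only [pointKernel_apply]

omit [IsProbabilityMeasure π] in
lemma lintegral_canon {f : CanonSpace D → ℝ≥0∞} (hf : Measurable f) :
    ∫⁻ ω, f ω ∂(canon π Λ ν) = ∫⁻ θ, ∫⁻ ω, f ω ∂(point (Λ θ) ν θ) ∂π := by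
  rw [canon, Measure.lintegral_bind (Kernel.aemeasurable _) hf.aemeasurable]
  simp only [pointKernel_apply]

lemma measurable_point_apply {E : Set (CanonSpace D)} (hE : MeasurableSet E) :
    Measurable fun θ => point (Λ θ) ν θ E := by
  simp only [← pointKernel_apply]
  exact Kernel.measurable_coe _ hE

lemma measurable_lintegral_point {f : CanonSpace D → ℝ≥0∞} (hf : Measurable f) :
    Measurable fun θ => ∫⁻ ω, f ω ∂(point (Λ θ) ν θ) := by
  simp only [← pointKernel_apply]
  exact hf.lintegral_kernel

/-- The parameter coordinate has a Dirac law, so `h (Th ω)` is a constant under the integral. -/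
lemma lintegral_point_Th_mul (θ : D) {h : D → ℝ≥0∞} (hh : Measurable h)
    {f : CanonSpace D → ℝ≥0∞} (hf : Measurable f) :
    ∫⁻ ω, h (Th ω) * f ω ∂(point (Λ θ) ν θ) = h θ * ∫⁻ ω, f ω ∂(point (Λ θ) ν θ) := by
  rw [← lintegral_const_mul _ hf, lintegral_point _ _ _ (f := fun ω => h (Th ω) * f ω)
    ((hh.comp measurable_Th).mul hf),
    lintegral_point _ _ _ (hf.const_mul _)]
  rfl

omit [IsProbabilityMeasure π] in
lemma setLIntegral_canon_Th {f : CanonSpace D → ℝ≥0∞} (hf : Measurable f) {C : Set D}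
    (hC : MeasurableSet C) :
    ∫⁻ ω in Th ⁻¹' C, f ω ∂(canon π Λ ν) = ∫⁻ θ in C, ∫⁻ ω, f ω ∂(point (Λ θ) ν θ) ∂π := by
  rw [← lintegral_indicator (measurable_Th hC), ← lintegral_indicator hC,
    lintegral_canon _ _ _ (hf.indicator (measurable_Th hC))]
  refine lintegral_congr fun θ => ?_
  have h1 : ∀ ω, (Th ⁻¹' C).indicator f ω = C.indicator (1 : D → ℝ≥0∞) (Th ω) * f ω := by
    intro ω
    by_cases h : Th ω ∈ C
    · rw [Set.indicator_of_mem h, Set.indicator_of_mem (s := Th ⁻¹' C) h]; simp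
    · rw [Set.indicator_of_notMem h, Set.indicator_of_notMem (s := Th ⁻¹' C) h]; simp
  simp only [h1]
  rw [lintegral_point_Th_mul Λ ν θ (measurable_one.indicator hC) hf]
  by_cases h : θ ∈ C
  · rw [Set.indicator_of_mem h, Set.indicator_of_mem h]; simp
  · rw [Set.indicator_of_notMem h, Set.indicator_of_notMem h]; simp

omit [IsProbabilityMeasure π] in
lemma canon_inter_Th {E : Set (CanonSpace D)} (hE : MeasurableSet E) {C : Set D}
    (hC : MeasurableSet C) :
    canon π Λ ν (E ∩ Th ⁻¹' C) = ∫⁻ θ in C, point (Λ θ) ν θ E ∂π := by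
  have h := setLIntegral_canon_Th π Λ ν (measurable_one.indicator hE) hC
  simp only [lintegral_indicator_one hE] at h
  rw [← h, Measure.restrict_apply hE]

omit [IsProbabilityMeasure π] in
lemma canon_map_Th : (canon π Λ ν).map Th = π := by
  ext C hC
  have h := canon_inter_Th π Λ ν MeasurableSet.univ hC
  rw [Set.univ_inter] at h
  rw [Measure.map_apply measurable_Th hC, h]
  simp

omit [IsProbabilityMeasure π] in
lemma ae_canon {p : CanonSpace D → Prop} (hp : MeasurableSet {ω | p ω})
    (h : ∀ᵐ θ ∂π, ∀ᵐ ω ∂(point (Λ θ) ν θ), p ω) : ∀ᵐ ω ∂(canon π Λ ν), p ω := by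
  have hc : MeasurableSet {ω | ¬ p ω} := hp.compl
  rw [ae_iff, canon_apply _ _ _ hc, lintegral_eq_zero_iff (measurable_point_apply _ _ hc)]
  filter_upwards [h] with θ hθ using ae_iff.1 hθ

lemma condLExp_canon {f : CanonSpace D → ℝ≥0∞} (hf : Measurable f) :
    condLExp sigmaTh (canon π Λ ν) f =ᵐ[canon π Λ ν]
      fun ω => ∫⁻ ω', f ω' ∂(point (Λ (Th ω)) ν (Th ω)) := by
  have hm := measurable_lintegral_point Λ ν hf
  refine (ae_eq_condLExp sigmaTh_le (canon π Λ ν) f (hm.comp (comap_measurable _)) ?_).symm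
  rintro _ ⟨C, hC, rfl⟩
  rw [setLIntegral_canon_Th _ _ _ hf hC]
  refine (setLIntegral_map hC hm measurable_Th).symm.trans ?_
  rw [canon_map_Th]

/-- The right-hand side is a bounded function of `Θ` with the correct integrals over the events `Th
⁻¹' C`. Conditioning on `Θ` thus becomes evaluation of `point`, and the conditional independence
statements reduce to products. -/
lemma condExp_canon {E : Set (CanonSpace D)} (hE : MeasurableSet E) :
    (canon π Λ ν)⟦E | sigmaTh⟧ =ᵐ[canon π Λ ν] fun ω => (point (Λ (Th ω)) ν (Th ω)).real E := by
  have hm : Measurable fun θ => (point (Λ θ) ν θ).real E :=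
    (measurable_point_apply Λ ν hE).ennreal_toReal
  have hint : Integrable (fun ω : CanonSpace D => (point (Λ (Th ω)) ν (Th ω)).real E)
      (canon π Λ ν) := by
    refine Integrable.of_bound (hm.comp measurable_Th).aestronglyMeasurable 1 (ae_of_all _ ?_)
    intro ω
    rw [Real.norm_of_nonneg measureReal_nonneg]
    exact measureReal_le_one
  refine (ae_eq_condExp_of_forall_setIntegral_eq sigmaTh_le ?_ ?_ ?_ ?_).symm
  · exact (integrable_const (1 : ℝ)).indicator hE
  · intro s _ _
    exact hint.integrableOn
  · rintro _ ⟨C, hC, rfl⟩ -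
    rw [integral_indicator_const _ hE, smul_eq_mul, mul_one, measureReal_def,
      Measure.restrict_apply hE, canon_inter_Th _ _ _ hE hC]
    have h1 : ∫ ω in Th ⁻¹' C, (point (Λ (Th ω)) ν (Th ω)).real E ∂(canon π Λ ν) =
        ∫ θ in C, (point (Λ θ) ν θ).real E ∂π := by
      rw [← canon_map_Th π Λ ν, setIntegral_map hC hm.aestronglyMeasurable
        measurable_Th.aemeasurable, canon_map_Th]
    rw [h1]
    exact integral_toReal (measurable_point_apply Λ ν hE).aemeasurable
      (ae_of_all _ fun θ => measure_lt_top _ _)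
  · exact (hm.comp (comap_measurable _)).aestronglyMeasurable

omit [MeasurableSpace D] in
lemma inter_eq_prod (A B : Set (ℕ → PosReal)) (C : Set D) :
    {ω : CanonSpace D | (fun n => W n ω) ∈ A} ∩ {ω | (fun n => X n ω) ∈ B} ∩ Th ⁻¹' C =
      A ×ˢ (B ×ˢ C) := by
  ext ⟨w, x, θ⟩
  simp only [Set.mem_inter_iff, Set.mem_prod, and_assoc]
  rfl

lemma point_WX (k : Measure PosReal) [IsProbabilityMeasure k] (θ : D)
    (A B : Set (ℕ → PosReal)) :
    point k ν θ ({ω | (fun n => W n ω) ∈ A} ∩ {ω | (fun n => X n ω) ∈ B}) =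
      (Measure.infinitePi fun _ => k) A * (Measure.infinitePi fun _ => ν) B := by
  have := inter_eq_prod A B (Set.univ : Set D)
  rw [Set.preimage_univ, Set.inter_univ] at this
  rw [this, point, Measure.prod_prod, Measure.prod_prod]
  simp

lemma point_W (k : Measure PosReal) [IsProbabilityMeasure k] (θ : D) (A : Set (ℕ → PosReal)) :
    point k ν θ {ω | (fun n => W n ω) ∈ A} = (Measure.infinitePi fun _ => k) A := by
  simpa using point_WX ν k θ A Set.univ

lemma point_X (k : Measure PosReal) [IsProbabilityMeasure k] (θ : D) (B : Set (ℕ → PosReal)) :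
    point k ν θ {ω | (fun n => X n ω) ∈ B} = (Measure.infinitePi fun _ => ν) B := by
  simpa using point_WX ν k θ Set.univ B

omit [IsProbabilityMeasure π] in
lemma canon_WX {A B : Set (ℕ → PosReal)} (hA : MeasurableSet A) (hB : MeasurableSet B)
    {C : Set D} (hC : MeasurableSet C) :
    canon π Λ ν ({ω | (fun n => W n ω) ∈ A} ∩ {ω | (fun n => X n ω) ∈ B} ∩ Th ⁻¹' C) =
      (∫⁻ θ in C, (Measure.infinitePi fun _ => Λ θ) A ∂π) *
        (Measure.infinitePi fun _ => ν) B := by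
  rw [canon_inter_Th _ _ _ ((measurableSet_W_mem hA).inter (measurableSet_X_mem hB)) hC]
  simp only [point_WX]
  exact lintegral_mul_const _ (Kernel.measurable_coe (iidKernel Λ) hA)

lemma condA1_canon : CondA1 (canon π Λ ν) := by
  intro A B hA hB
  filter_upwards [condExp_canon π Λ ν ((measurableSet_W_mem hA).inter (measurableSet_X_mem hB)),
    condExp_canon π Λ ν (measurableSet_W_mem hA), condExp_canon π Λ ν (measurableSet_X_mem hB)]
    with ω h1 h2 h3
  refine h1.trans ?_
  refine Eq.trans ?_ (congrArg₂ (· * ·) h2 h3).symm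
  simp only [measureReal_def, point_WX, point_W, point_X, ENNReal.toReal_mul]

lemma condA2_canon : CondA2 (canon π Λ ν) := by
  refine indepFun_iff_measure_inter_preimage_eq_mul.2 fun C B hC hB => ?_
  have h1 := canon_WX π Λ ν MeasurableSet.univ hB hC
  have h2 := canon_WX π Λ ν MeasurableSet.univ hB MeasurableSet.univ
  have h3 := canon_WX π Λ ν MeasurableSet.univ MeasurableSet.univ hC
  simp only [Set.mem_univ, Set.ofPred_true, Set.univ_inter, measure_univ, Set.inter_univ,
    Set.preimage_univ, lintegral_one, Measure.restrict_apply, MeasurableSet.univ, one_mul,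
    mul_one] at h1 h2 h3
  rw [Set.inter_comm, h3]
  refine Eq.trans h1 ?_
  rw [← h2]; rfl

lemma isRiskProcess_of_forall {Q : Measure (CanonSpace D)} [IsProbabilityMeasure Q]
    (h : ∀ A B : Set (ℕ → PosReal), MeasurableSet A → MeasurableSet B →
      Q ({ω | (fun n => W n ω) ∈ A} ∩ {ω | (fun n => X n ω) ∈ B}) =
        Q {ω | (fun n => W n ω) ∈ A} * (Measure.infinitePi fun _ => ν) B) :
    IsRiskProcess Q := by
  have hX : Q.map (fun ω n => X n ω) = Measure.infinitePi fun _ => ν := by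
    ext B hB
    rw [Measure.map_apply measurable_Xseq hB]
    have := h Set.univ B MeasurableSet.univ hB
    simp only [Set.mem_univ, Set.ofPred_true, Set.univ_inter, measure_univ, one_mul] at this
    exact this
  have hXn : ∀ n, Q.map (X n) = ν := by
    intro n
    have : (X n : CanonSpace D → PosReal) = (fun x => x n) ∘ (fun ω n => X n ω) := rfl
    rw [this, ← Measure.map_map (measurable_pi_apply n) measurable_Xseq, hX,
      Measure.infinitePi_map_eval]
  refine ⟨?_, fun n => by rw [hXn, hXn], ?_⟩
  · rw [iIndepFun_iff_map_fun_eq_infinitePi_map measurable_X, hX]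
    congr 1
    ext1 n
    exact (hXn n).symm
  · have hWX : IndepFun (fun (ω : CanonSpace D) n => W n ω) (fun ω n => X n ω) Q := by
      refine indepFun_iff_measure_inter_preimage_eq_mul.2 fun A B hA hB => ?_
      refine (h A B hA hB).trans ?_
      rw [← hX, Measure.map_apply measurable_Xseq hB]
      rfl
    -- The counts are a function of `W` alone; the claims and the one-point parameter are fillers.
    have hN : Measurable fun (w : ℕ → PosReal) (t : ℝ≥0) => N t ((w, w, ()) : CanonSpace Unit) :=
      measurable_pi_lambda _ fun t => (measurable_N t).comp (by fun_prop)
    exact hWX.comp hN measurable_id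

omit [IsProbabilityMeasure π] in
lemma canon_map_X [IsProbabilityMeasure π] (n : ℕ) : (canon π Λ ν).map (X n) = ν := by
  have h : (canon π Λ ν).map (fun ω n => X n ω) = Measure.infinitePi fun _ => ν := by
    ext B hB
    rw [Measure.map_apply measurable_Xseq hB]
    have h2 := canon_WX π Λ ν MeasurableSet.univ hB MeasurableSet.univ
    simp only [Set.mem_univ, Set.ofPred_true, Set.univ_inter, measure_univ, Set.inter_univ,
      Set.preimage_univ, lintegral_one, Measure.restrict_apply, MeasurableSet.univ, one_mul] at h2
    exact h2
  have : (X n : CanonSpace D → PosReal) = (fun x => x n) ∘ (fun ω n => X n ω) := rfl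
  rw [this, ← Measure.map_map (measurable_pi_apply n) measurable_Xseq, h,
    Measure.infinitePi_map_eval]

lemma isCMRP_canon : IsCMRP (canon π Λ ν) Λ := by
  refine ⟨isRiskProcess_of_forall ν fun A B hA hB => ?_, ?_⟩
  · have h1 := canon_WX π Λ ν hA hB MeasurableSet.univ
    have h2 := canon_WX π Λ ν hA MeasurableSet.univ MeasurableSet.univ
    simp only [Set.mem_univ, Set.ofPred_true, measure_univ, Set.inter_univ, Set.preimage_univ,
      mul_one] at h1 h2
    rw [h1, h2]
  · have hbox : ∀ (s : Finset ℕ) (B : ℕ → Set PosReal), (⋂ n ∈ s, W (D := D) n ⁻¹' B n) =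
        {ω | (fun n => W n ω) ∈ Set.pi s B} := by
      intro s B
      ext ω
      simp
    have hW : ∀ (n : ℕ) (B : Set PosReal), MeasurableSet B → ∀ θ : D,
        (point (Λ θ) ν θ).real (W n ⁻¹' B) = (Λ θ).real B := by
      intro n B hB θ
      have := hbox {n} fun _ => B
      simp only [Finset.mem_singleton, Set.iInter_iInter_eq_left] at this
      rw [measureReal_def, this, point_W, Measure.infinitePi_pi _ fun _ _ => hB]
      simp [measureReal_def]
    refine ⟨fun s B hB => ?_, fun n B hB => ?_⟩
    · have hall : ∀ᵐ ω ∂(canon π Λ ν), ∀ n, ((canon π Λ ν)⟦W n ⁻¹' B n | sigmaTh⟧) ω =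
          (Λ (Th ω)).real (B n) := by
        rw [ae_all_iff]
        intro n
        filter_upwards [condExp_canon π Λ ν (measurable_W n (hB n))] with ω hω
        rw [hω, hW n _ (hB n)]
      have hm : MeasurableSet (⋂ n ∈ s, W (D := D) n ⁻¹' B n) :=
        Finset.measurableSet_biInter _ fun n _ => measurable_W n (hB n)
      filter_upwards [hall, condExp_canon π Λ ν hm] with ω h1 h2
      rw [h2, hbox, measureReal_def, point_W, Measure.infinitePi_pi _ fun n _ => hB n,
        ENNReal.toReal_prod]
      exact Finset.prod_congr rfl fun n _ => (h1 n).symm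
    · filter_upwards [condExp_canon π Λ ν (measurable_W n hB)] with ω hω
      rw [hω, hW n _ hB]

lemma isCRP_point (k : Measure PosReal) [IsProbabilityMeasure k] (θ : D) :
    IsCRP (point k ν θ) k := by
  have hWn : ∀ n, (point k ν θ).map (W n) = k := by
    intro n
    have : (W n : CanonSpace D → PosReal) = (fun x => x n) ∘ (fun ω n => W n ω) := rfl
    rw [this, ← Measure.map_map (measurable_pi_apply n) measurable_Wseq, point_map_W,
      Measure.infinitePi_map_eval]
  refine ⟨isRiskProcess_of_forall ν fun A B _ _ => ?_, ?_, hWn⟩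
  · rw [point_WX, point_W]
  · rw [iIndepFun_iff_map_fun_eq_infinitePi_map measurable_W, point_map_W]
    congr 1
    ext1 n
    exact (hWn n).symm

/-- A compound mixed renewal process satisfying (a1) and (a2) is the canonical one. -/
lemma eq_canon {P : Measure (CanonSpace D)} [IsProbabilityMeasure P] (h1 : CondA1 P)
    (h2 : CondA2 P) (hS : IsCMRP P Λ) [IsProbabilityMeasure (P.map (X 0))] :
    P = canon (P.map Th) Λ (P.map (X 0)) := by
  have hPT : IsProbabilityMeasure (P.map Th) :=
    Measure.isProbabilityMeasure_map measurable_Th.aemeasurable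
  have hX : P.map (fun ω n => X n ω) = Measure.infinitePi fun _ => P.map (X 0) := by
    rw [(iIndepFun_iff_map_fun_eq_infinitePi_map measurable_X).1 hS.risk.claims_indep]
    congr 1
    ext1 n
    exact hS.risk.claims_identDistrib n
  have hset : ∀ (E : Set (CanonSpace D)) (C : Set D), MeasurableSet E → MeasurableSet C →
      P.real (E ∩ Th ⁻¹' C) = ∫ ω in Th ⁻¹' C, (P⟦E | sigmaTh⟧) ω ∂P := by
    intro E C hE hC
    rw [setIntegral_condExp sigmaTh_le ((integrable_const (1 : ℝ)).indicator hE) ⟨C, hC, rfl⟩,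
      integral_indicator_const _ hE, smul_eq_mul, mul_one, measureReal_def, measureReal_def,
      Measure.restrict_apply hE]
  have hWT : ∀ (A : Set (ℕ → PosReal)) (C : Set D), MeasurableSet A → MeasurableSet C →
      P ({ω | (fun n => W n ω) ∈ A} ∩ Th ⁻¹' C) =
        ∫⁻ θ in C, (Measure.infinitePi fun _ => Λ θ) A ∂(P.map Th) := by
    intro A C hA hC
    -- For fixed `C` both sides are finite measures on sequences, so boxes suffice; on boxes,
    -- conditional independence and the conditional laws give the product.
    have hm : (P.restrict (Th ⁻¹' C)).map (fun ω n => W n ω) =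
        ((P.map Th).restrict C).bind (iidKernel Λ) := by
      refine ext_of_pi fun s t ht => ?_
      have hbox : MeasurableSet (Set.pi (s : Set ℕ) t) := .pi s.countable_toSet fun i _ => ht i
      rw [Measure.map_apply measurable_Wseq hbox, Measure.restrict_apply (measurable_Wseq hbox),
        Measure.bind_apply hbox (Kernel.aemeasurable _)]
      simp only [iidKernel_apply]
      have hE : (fun (ω : CanonSpace D) n => W n ω) ⁻¹' (Set.pi s t) = ⋂ n ∈ s, W n ⁻¹' t n := by
        ext ω; simp
      have hce : P⟦⋂ n ∈ s, W n ⁻¹' t n | sigmaTh⟧ =ᵐ[P]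
          fun ω => ((Measure.infinitePi fun _ => Λ (Th ω)) (Set.pi s t)).toReal := by
        have hall := ae_all_iff.2 fun n => hS.mrp.condLaw n (t n) (ht n)
        filter_upwards [hS.mrp.condIndep s t ht, hall] with ω ha hb
        rw [ha, Measure.infinitePi_pi _ fun n _ => ht n, ENNReal.toReal_prod]
        exact Finset.prod_congr rfl fun n _ => hb n
      have hmeas : Measurable fun θ => (Measure.infinitePi fun _ : ℕ => Λ θ) (Set.pi s t) :=
        Kernel.measurable_coe (iidKernel Λ) hbox
      have hr := hset _ C (measurable_Wseq hbox) hC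
      rw [hE, setIntegral_congr_ae (g := fun ω =>
        ((Measure.infinitePi fun _ => Λ (Th ω)) (Set.pi s t)).toReal) (measurable_Th hC)
        (hce.mono fun ω h _ => h), ← setIntegral_map hC
          (f := fun θ => ((Measure.infinitePi fun _ => Λ θ) (Set.pi s t)).toReal)
          hmeas.ennreal_toReal.aestronglyMeasurable measurable_Th.aemeasurable,
        integral_toReal hmeas.aemeasurable (ae_of_all _ fun θ => measure_lt_top _ _),
        measureReal_def] at hr
      rw [hE]
      refine (ENNReal.toReal_eq_toReal_iff' (measure_ne_top _ _) ?_).1 hr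
      refine ne_top_of_le_ne_top (b := ∫⁻ θ in C, 1 ∂(P.map Th)) ?_
        (lintegral_mono fun θ => prob_le_one)
      simp [measure_ne_top]
    have := congrArg (fun m => m A) hm
    simp only [Measure.map_apply measurable_Wseq hA, Measure.restrict_apply (measurable_Wseq hA),
      Measure.bind_apply hA (Kernel.aemeasurable _)] at this
    exact this
  refine Measure.ext_prod₃ fun {A B C} hA hB hC => ?_
  rw [← inter_eq_prod, canon_WX _ _ _ hA hB hC, ← hWT A C hA hC, ← hX,
    Measure.map_apply measurable_Xseq hB]
  -- By (a2) this conditional probability is constant; with (a1), the claims then split off as a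
  -- factor.
  have hBc : P⟦{ω | (fun n => X n ω) ∈ B} | sigmaTh⟧ =ᵐ[P]
      fun _ => P.real {ω | (fun n => X n ω) ∈ B} := by
    have hi : Indep (MeasurableSpace.comap (fun (ω : CanonSpace D) n => X n ω) inferInstance)
        sigmaTh P := (IndepFun_iff_Indep _ _ _).1 h2.symm
    refine (condExp_indep_eq measurable_Xseq.comap_le sigmaTh_le ?_ hi).trans ?_
    · exact (stronglyMeasurable_const (b := (1 : ℝ))).indicator ⟨B, hB, rfl⟩
    · rw [integral_indicator_const _ (measurableSet_X_mem hB), smul_eq_mul, mul_one]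
  have hr := hset _ C ((measurableSet_W_mem hA).inter (measurableSet_X_mem hB)) hC
  have hWr := hset _ C (measurableSet_W_mem hA) hC
  have hcong : ∫ ω in Th ⁻¹' C, (P⟦{ω | (fun n => W n ω) ∈ A} ∩ {ω | (fun n => X n ω) ∈ B} |
      sigmaTh⟧) ω ∂P = ∫ ω in Th ⁻¹' C, (P⟦{ω | (fun n => W n ω) ∈ A} | sigmaTh⟧) ω *
        P.real {ω | (fun n => X n ω) ∈ B} ∂P := by
    refine setIntegral_congr_ae (measurable_Th hC) ?_
    filter_upwards [h1 A B hA hB, hBc] with ω ha hb _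
    rw [ha, hb]
  have hr' := hr.trans (hcong.trans (integral_mul_const _ _))
  have hr'' := hr'.trans (congrArg (· * P.real {ω | (fun n => X n ω) ∈ B}) hWr.symm)
  simp only [measureReal_def, ← ENNReal.toReal_mul] at hr''
  exact (ENNReal.toReal_eq_toReal_iff' (measure_ne_top _ _)
    (ENNReal.mul_ne_top (measure_ne_top _ _) (measure_ne_top _ _))).1 hr''

end Canon

/-! ### The exponential kernel -/

section Exponential

variable {D : Type} [MeasurableSpace D] (ρ : PosFun D)

lemma PosFun.measurable : Measurable (ρ : D → ℝ) := ρ.2.1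

lemma PosFun.pos (θ : D) : 0 < ρ θ := ρ.2.2 θ

lemma expKernel_apply (θ : D) {s : Set PosReal} :
    expKernel ρ θ s = expMeasure (ρ θ) (((↑) : PosReal → ℝ) '' s) :=
  (MeasurableEmbedding.subtype_coe measurableSet_Ioi).comap_apply _ _

lemma expMeasure_Iic {r : ℝ} (hr : 0 < r) {s : ℝ} (hs : 0 ≤ s) :
    expMeasure r (Set.Iic s) = ENNReal.ofReal (1 - Real.exp (-(r * s))) := by
  have := isProbabilityMeasure_expMeasure hr
  rw [← ofReal_measureReal, ← cdf_eq_real, cdf_expMeasure_eq hr, if_pos hs]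

lemma expMeasure_Ioi {r : ℝ} (hr : 0 < r) {s : ℝ} (hs : 0 ≤ s) :
    expMeasure r (Set.Ioi s) = ENNReal.ofReal (Real.exp (-(r * s))) := by
  have := isProbabilityMeasure_expMeasure hr
  rw [← Set.compl_Iic, prob_compl_eq_one_sub measurableSet_Iic, expMeasure_Iic hr hs,
    ← ENNReal.ofReal_one, ← ENNReal.ofReal_sub]
  · congr 1; ring
  · have : Real.exp (-(r * s)) ≤ 1 := Real.exp_le_one_iff.2 (by
      have := mul_nonneg hr.le hs; linarith)
    linarith

lemma expKernel_lt (θ : D) {s : ℝ} (hs : 0 ≤ s) :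
    expKernel ρ θ {y : PosReal | s < y} = ENNReal.ofReal (Real.exp (-(ρ θ * s))) := by
  rw [expKernel_apply, ← expMeasure_Ioi (ρ.pos θ) hs]
  congr 1
  ext y
  simp only [Set.mem_image, Set.mem_ofPred_eq, Subtype.exists, exists_and_left, exists_prop,
    Set.mem_Ioi]
  exact ⟨fun ⟨a, h1, _, h2⟩ => h2 ▸ h1, fun h => ⟨y, h, hs.trans_lt h, rfl⟩⟩

instance : IsMarkovKernel (expKernel ρ) := by
  refine ⟨fun θ => ⟨?_⟩⟩
  have h := expKernel_lt ρ θ le_rfl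
  have hu : {y : PosReal | (0 : ℝ) < y} = Set.univ := Set.eq_univ_of_forall fun y => y.2
  rw [hu] at h
  rw [h]; simp

/-- Absolute continuity passes this on to `K θ`, which keeps the denominator `1 - K(θ)` of the
density away from zero. -/
lemma expKernel_lt_ne_zero (θ : D) (s : ℝ) : expKernel ρ θ {y : PosReal | s < y} ≠ 0 := by
  have h := expKernel_lt ρ θ (le_max_right s 0)
  have hpos : 0 < expKernel ρ θ {y : PosReal | max s 0 < y} := by
    rw [h]; exact ENNReal.ofReal_pos.2 (Real.exp_pos _)
  exact (hpos.trans_le (measure_mono fun y (hy : max s 0 < y) => (le_max_left s 0).trans_lt hy)).ne'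

lemma expKernel_le_pos (θ : D) {s : ℝ} (hs : 0 < s) :
    expKernel ρ θ {y : PosReal | (y : ℝ) ≤ s} ≠ 0 := by
  have hm : MeasurableSet {y : PosReal | s < y} := measurableSet_lt measurable_const (by fun_prop)
  have hc : {y : PosReal | (y : ℝ) ≤ s} = {y : PosReal | s < y}ᶜ := by ext y; simp
  rw [hc, prob_compl_eq_one_sub hm, expKernel_lt ρ θ hs.le, ← ENNReal.ofReal_one,
    ← ENNReal.ofReal_sub _ (Real.exp_pos _).le]
  refine (ENNReal.ofReal_pos.2 ?_).ne'
  have : Real.exp (-(ρ θ * s)) < 1 := by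
    rw [Real.exp_lt_one_iff]
    have := mul_pos (ρ.pos θ) hs
    linarith
  linarith

lemma expKernel_ac (θ : D) :
    expKernel ρ θ ≪ (volume : Measure ℝ).comap ((↑) : PosReal → ℝ) ∧
      (volume : Measure ℝ).comap ((↑) : PosReal → ℝ) ≪ expKernel ρ θ := by
  have hemb := MeasurableEmbedding.subtype_coe (measurableSet_Ioi (a := (0 : ℝ)))
  have hpdf : Measurable (exponentialPDF (ρ θ)) :=
    (measurable_exponentialPDFReal _).ennreal_ofReal
  constructor
  · refine Measure.AbsolutelyContinuous.mk fun s hs h => ?_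
    rw [hemb.comap_apply] at h
    rw [expKernel_apply]
    exact withDensity_absolutelyContinuous _ _ h
  · refine Measure.AbsolutelyContinuous.mk fun s hs h => ?_
    have hs' : MeasurableSet (((↑) : PosReal → ℝ) '' s) := measurableSet_Ioi.subtype_image hs
    rw [expKernel_apply] at h
    rw [hemb.comap_apply]
    have h2 : volume.withDensity (exponentialPDF (ρ θ)) (((↑) : PosReal → ℝ) '' s) = 0 := h
    rw [withDensity_apply_eq_zero hpdf] at h2
    refine measure_mono_null ?_ h2
    rintro _ ⟨y, hy, rfl⟩
    refine ⟨?_, y, hy, rfl⟩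
    exact (ENNReal.ofReal_pos.2 (exponentialPDFReal_pos (ρ.pos θ) y.2)).ne'

end Exponential

/-! ### The density of the theorem as a likelihood ratio -/

section Density

variable {D : Type} [MeasurableSpace D]

/-- The mean of `K θ`. -/
def mean (K : Kernel D PosReal) (θ : D) : ℝ≥0∞ := ∫⁻ y, ENNReal.ofReal (y : ℝ) ∂(K θ)

lemma measurable_mean (K : Kernel D PosReal) : Measurable (mean K) :=
  Measurable.lintegral_kernel (by fun_prop)

lemma lintegral_point_W (k ν : Measure PosReal) [IsProbabilityMeasure k]
    [IsProbabilityMeasure ν] (θ : D) {f : PosReal → ℝ≥0∞} (hf : Measurable f) (n : ℕ) :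
    ∫⁻ ω, f (W n ω) ∂(point k ν θ) = ∫⁻ y, f y ∂k := by
  have h : ∫⁻ ω, f (W n ω) ∂(point k ν θ) =
      ∫⁻ w : ℕ → PosReal, f (w n) ∂((point k ν θ).map fun ω n => W n ω) :=
    (lintegral_map (hf.comp (measurable_pi_apply n)) measurable_Wseq).symm
  rw [h, point_map_W]
  conv_rhs => rw [← Measure.infinitePi_map_eval (fun _ : ℕ => k) n]
  rw [lintegral_map hf (measurable_pi_apply n)]

lemma condMeanW_canon (π : Measure D) [IsProbabilityMeasure π] (K : Kernel D PosReal)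
    [IsMarkovKernel K] (ν : Measure PosReal) [IsProbabilityMeasure ν] :
    condMeanW (canon π K ν) =ᵐ[canon π K ν] fun ω => mean K (Th ω) := by
  refine (condLExp_canon π K ν (measurable_W 0).subtype_val.ennreal_ofReal).trans ?_
  refine ae_of_all _ fun ω => ?_
  exact lintegral_point_W (K (Th ω)) ν (Th ω) (f := fun y => ENNReal.ofReal (y : ℝ))
    (by fun_prop) 0

lemma ae_point_W (k ν : Measure PosReal) [IsProbabilityMeasure k] (θ : D)
    [IsProbabilityMeasure ν] {p : PosReal → Prop} (h : ∀ᵐ y ∂k, p y) :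
    ∀ᵐ ω ∂(point k ν θ), ∀ n, p (W n ω) := by
  rw [ae_all_iff]
  intro n
  have hm : (point k ν θ).map (W n) = k := (isCRP_point ν k θ).renewal_law n
  exact ae_of_ae_map (measurable_W n).aemeasurable (hm.symm ▸ h)

variable (K : Kernel D PosReal) [IsMarkovKernel K] (ρ : PosFun D)

lemma one_sub_real_le (θ : D) (s : ℝ) :
    1 - (K θ).real {x : PosReal | (x : ℝ) ≤ s} = (K θ {x : PosReal | s < x}).toReal := by
  have hm : MeasurableSet {y : PosReal | (y : ℝ) ≤ s} :=
    measurableSet_le (by fun_prop) measurable_const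
  have hc : {y : PosReal | s < y} = {y : PosReal | (y : ℝ) ≤ s}ᶜ := by ext y; simp
  rw [hc, ← measureReal_def, probReal_compl_eq_one_sub hm]

lemma density_nonneg (β : PosReal × D → ℝ) (t : ℝ≥0) {m : ℝ} (hm : 0 ≤ m) (θ : D)
    (ω : CanonSpace D) : 0 ≤ density K ρ β t m θ ω := by
  have hρ := (ρ.pos θ).le
  unfold density
  simp only [one_sub_real_le]
  have h2 : 0 ≤ ∏ j ∈ Finset.range (N t ω).toNat,
      (Kernel.rnDeriv (expKernel ρ) K θ (W j ω)).toReal :=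
    Finset.prod_nonneg fun _ _ => ENNReal.toReal_nonneg
  positivity

omit [IsMarkovKernel K] in
-- No arrival has occurred at time `0`. Hence (RPM_ξ) at time `0` says that `ξ` is the density of
-- the structural laws.
lemma density_zero (β : PosReal × D → ℝ) (m : ℝ) (θ : D) (ω : CanonSpace D) :
    density K ρ β 0 m θ ω = 1 := by
  have hempty : {x : PosReal | (x : ℝ) ≤ 0} = ∅ := by
    ext x; simp only [Set.mem_ofPred_eq, Set.mem_empty_iff_false, iff_false, not_le]; exact x.2
  simp [density, N_zero, T_zero, hempty]

lemma measurable_kernel_le :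
    Measurable fun q : D × ℝ => (K q.1).real {x : PosReal | (x : ℝ) ≤ q.2} := by
  have h := Kernel.measurable_kernel_prodMk_left
    (κ := K.comap (Prod.fst : D × ℝ → D) measurable_fst)
    (t := {p : (D × ℝ) × PosReal | (p.2 : ℝ) ≤ p.1.2})
    (measurableSet_le (by fun_prop) (by fun_prop))
  simp only [Kernel.comap_apply] at h
  exact h.ennreal_toReal

/-- The density on the event that there are `n` arrivals up to time `t`. -/
def densityAt (β : PosReal × D → ℝ) (t : ℝ≥0) (n : ℕ) (m : ℝ) (θ : D) (ω : CanonSpace D) : ℝ :=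
  Real.exp ((∑ j ∈ Finset.range n, β (X j ω, θ)) - ρ θ * (t - T n ω)) * ((ρ θ * m) ^ n)⁻¹
      / (1 - (K θ).real {x : PosReal | (x : ℝ) ≤ t - T n ω})
    * ∏ j ∈ Finset.range n, (Kernel.rnDeriv (expKernel ρ) K θ (W j ω)).toReal

lemma measurable_densityAt {Ω' : Type*} [MeasurableSpace Ω'] {β : PosReal × D → ℝ}
    (hβ : Measurable β) (t : ℝ≥0) (n : ℕ) {m : Ω' → ℝ} {τ : Ω' → D} {f : Ω' → CanonSpace D}
    (hm : Measurable m) (hτ : Measurable τ) (hf : Measurable f) :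
    Measurable fun a => densityAt K ρ β t n (m a) (τ a) (f a) := by
  have hρ : Measurable fun a => ρ (τ a) := ρ.measurable.comp hτ
  have hT : Measurable fun a => (t : ℝ) - T n (f a) :=
    measurable_const.sub ((measurable_T n).comp hf)
  have hX : Measurable fun a => ∑ j ∈ Finset.range n, β (X j (f a), τ a) :=
    Finset.measurable_sum _ fun j _ => hβ.comp (((measurable_X j).comp hf).prodMk hτ)
  have hW : Measurable fun a => ∏ j ∈ Finset.range n,
      (Kernel.rnDeriv (expKernel ρ) K (τ a) (W j (f a))).toReal :=
    Finset.measurable_prod _ fun j _ => ((Kernel.measurable_rnDeriv (expKernel ρ) K).comp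
      (hτ.prodMk ((measurable_W j).comp hf))).ennreal_toReal
  have hK : Measurable fun a => (K (τ a)).real {x : PosReal | (x : ℝ) ≤ t - T n (f a)} :=
    (measurable_kernel_le K).comp (hτ.prodMk hT)
  unfold densityAt
  exact ((((hX.sub (hρ.mul hT)).exp).mul ((hρ.mul hm).pow_const n).inv).div
    (measurable_const.sub hK)).mul hW

/-- The numbers of factors and summands in the density are random; splitting over the countably many
values of the index settles measurability. -/
lemma measurable_nat_index {Ω' : Type*} [MeasurableSpace Ω'] {G : ℕ → Ω' → ℝ}
    (hG : ∀ n, Measurable (G n)) {i : Ω' → ℕ} (hi : Measurable i) :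
    Measurable fun a => G (i a) a :=
  (measurable_from_prod_countable_right (f := fun q : ℕ × Ω' => G q.1 q.2) hG).comp
    (hi.prodMk measurable_id)

lemma measurable_toNat_N (t : ℝ≥0) : Measurable fun ω : CanonSpace D => (N t ω).toNat :=
  (measurable_of_countable ENat.toNat).comp (measurable_N t)

lemma measurable_density {Ω' : Type*} [MeasurableSpace Ω'] {β : PosReal × D → ℝ}
    (hβ : Measurable β) (t : ℝ≥0) {m : Ω' → ℝ} {τ : Ω' → D} {f : Ω' → CanonSpace D}
    (hm : Measurable m) (hτ : Measurable τ) (hf : Measurable f) :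
    Measurable fun a => density K ρ β t (m a) (τ a) (f a) := by
  exact measurable_nat_index (G := fun n a => densityAt K ρ β t n (m a) (τ a) (f a))
    (fun n => measurable_densityAt K ρ hβ t n hm hτ hf) ((measurable_toNat_N t).comp hf)

/-- For almost every `ω`, the density is the likelihood ratio. -/
lemma ae_ofReal_density_eq (ν : Measure PosReal) [IsProbabilityMeasure ν] {θ : D}
    (hac : expKernel ρ θ ≪ K θ) (γ : PosReal → ℝ) {β : PosReal × D → ℝ} {a m : ℝ}
    (hβ : ∀ x, β (x, θ) = γ x + a) (ham : Real.exp a = ρ θ * m) (t : ℝ≥0) :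
    ∀ᵐ ω ∂(point (K θ) ν θ), ENNReal.ofReal (density K ρ β t m θ ω) =
      likelihood (K θ) (expKernel ρ θ) (Kernel.rnDeriv (expKernel ρ) K θ)
        (fun x => ENNReal.ofReal (Real.exp (γ x))) (N t ω).toNat t ω := by
  filter_upwards [ae_N_ne_top (K θ) ν θ, ae_point_W (K θ) ν θ (Kernel.rnDeriv_ne_top
    (expKernel ρ) K)] with ω hN hr
  obtain ⟨n, hn⟩ := ENat.ne_top_iff_exists.1 (hN t)
  have hTn : T n ω ≤ t := ((N_eq_iff n t ω).1 hn.symm).1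
  have hk0 : K θ {y : PosReal | (t : ℝ) - T n ω < y} ≠ 0 := fun h =>
    expKernel_lt_ne_zero ρ θ _ (hac h)
  have hktop : K θ {y : PosReal | (t : ℝ) - T n ω < y} ≠ ⊤ := measure_ne_top _ _
  -- Finiteness makes the `toReal`s in the density lossless, so the two expressions can be compared
  -- as real numbers.
  have hfin : likelihood (K θ) (expKernel ρ θ) (Kernel.rnDeriv (expKernel ρ) K θ)
      (fun x => ENNReal.ofReal (Real.exp (γ x))) n t ω ≠ ⊤ := by
    refine ENNReal.mul_ne_top (ENNReal.mul_ne_top ?_ ?_) ?_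
    · exact ENNReal.prod_ne_top fun j _ => hr j
    · exact ENNReal.prod_ne_top fun j _ => ENNReal.ofReal_ne_top
    · exact ENNReal.div_ne_top (measure_ne_top _ _) hk0
  rw [← hn, ENat.toNat_natCast, ← ENNReal.ofReal_toReal hfin]
  congr 1
  have hm : ρ θ * m ≠ 0 := by rw [← ham]; exact (Real.exp_pos _).ne'
  simp only [density, ← hn, ENat.toNat_natCast, one_sub_real_le, likelihood, ENNReal.toReal_mul,
    ENNReal.toReal_div, ENNReal.toReal_prod, hβ, Finset.sum_add_distrib, Finset.sum_const,
    Finset.card_range, nsmul_eq_mul, expKernel_lt ρ θ (sub_nonneg.2 hTn),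
    ENNReal.toReal_ofReal (Real.exp_pos _).le]
  -- The exponential splits into the claim densities, `e^{na} = (ρ m)^n`, which cancels the inverse
  -- power, and the exponential tail.
  rw [show ∑ j ∈ Finset.range n, γ (X j ω) + n * a - ρ θ * (t - T n ω) =
    ∑ j ∈ Finset.range n, γ (X j ω) + n * a + -(ρ θ * (t - T n ω)) by ring,
    Real.exp_add, Real.exp_add, Real.exp_nat_mul, ham, Real.exp_sum]
  have hp : (ρ θ * m) ^ n ≠ 0 := pow_ne_zero _ hm
  have hK : (K θ {y : PosReal | (t : ℝ) - T n ω < y}).toReal ≠ 0 :=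
    ENNReal.toReal_ne_zero.2 ⟨hk0, hktop⟩
  field_simp

attribute [local irreducible] density

lemma point_expKernel_apply (ν : Measure PosReal) [IsProbabilityMeasure ν] {θ : D}
    (hac : expKernel ρ θ ≪ K θ) {γ : PosReal → ℝ} (hγ : Measurable γ)
    [IsProbabilityMeasure (ν.withDensity fun x => ENNReal.ofReal (Real.exp (γ x)))]
    {β : PosReal × D → ℝ} {a m : ℝ}
    (hβ : ∀ x, β (x, θ) = γ x + a) (ham : Real.exp a = ρ θ * m) {t : ℝ≥0}
    {A : Set (CanonSpace D)} (hA : MeasurableSet[filt t] A) :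
    point (expKernel ρ θ) (ν.withDensity fun x => ENNReal.ofReal (Real.exp (γ x))) θ A =
      ∫⁻ ω in A, ENNReal.ofReal (density K ρ β t m θ ω) ∂(point (K θ) ν θ) := by
  have hwd : (K θ).withDensity (Kernel.rnDeriv (expKernel ρ) K θ) = expKernel ρ θ := by
    rw [← Kernel.withDensity_apply _ (Kernel.measurable_rnDeriv _ _),
      Kernel.withDensity_rnDeriv_eq hac]
  have : IsProbabilityMeasure ((K θ).withDensity (Kernel.rnDeriv (expKernel ρ) K θ)) := by
    rw [hwd]; infer_instance
  have h := point_withDensity_apply (K θ) ν θ (Kernel.measurable_rnDeriv_right (expKernel ρ) K θ)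
    (g := fun x => ENNReal.ofReal (Real.exp (γ x))) (by fun_prop)
    (fun s hs => expKernel_lt_ne_zero ρ θ s (hac hs)) hA
  simp only [hwd] at h
  rw [h]
  exact lintegral_congr_ae (ae_restrict_of_ae
    ((ae_ofReal_density_eq K ρ ν hac γ hβ ham t).mono fun ω h => h.symm))

/-- Integration against the Dirac factor substitutes `θ` exactly, whether or not `{θ}` is
measurable. -/
lemma lintegral_point_Th (k ν : Measure PosReal) [IsProbabilityMeasure k] [IsProbabilityMeasure ν]
    (θ : D) {f : D × CanonSpace D → ℝ≥0∞} (hf : Measurable f) :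
    ∫⁻ ω, f (Th ω, ω) ∂(point k ν θ) = ∫⁻ ω, f (θ, ω) ∂(point k ν θ) := by
  rw [lintegral_point _ _ _ (f := fun ω => f (Th ω, ω))
    (hf.comp (measurable_Th.prodMk measurable_id)),
    lintegral_point _ _ _ (f := fun ω => f (θ, ω)) (hf.comp measurable_prodMk_left)]
  rfl

lemma measurable_density_Th {β : PosReal × D → ℝ} (hβ : Measurable β) {m : D → ℝ}
    (hm : Measurable m) (t : ℝ≥0) :
    Measurable fun ω : CanonSpace D => density K ρ β t (m (Th ω)) (Th ω) ω :=
  measurable_density K ρ hβ t (hm.comp measurable_Th) measurable_Th measurable_id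

/-- Girsanov's formula for compound mixed renewal processes. -/
lemma canon_expKernel_apply (π : Measure D) (ν : Measure PosReal)
    [IsProbabilityMeasure ν] (hac : ∀ᵐ θ ∂π, expKernel ρ θ ≪ K θ)
    {γ : PosReal → ℝ} (hγ : Measurable γ)
    [IsProbabilityMeasure (ν.withDensity fun x => ENNReal.ofReal (Real.exp (γ x)))]
    {β : PosReal × D → ℝ} {α m : D → ℝ} (hα : Measurable α) (hm : Measurable m)
    (hm0 : ∀ θ, 0 ≤ m θ)
    (hβ : ∀ x θ, β (x, θ) = γ x + α θ) (ham : ∀ᵐ θ ∂π, Real.exp (α θ) = ρ θ * m θ)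
    {ξ : D → ℝ} (hξ : Measurable ξ) {t : ℝ≥0}
    {A : Set (CanonSpace D)} (hA : MeasurableSet[filt t] A) :
    canon (π.withDensity fun θ => ENNReal.ofReal (ξ θ)) (expKernel ρ)
        (ν.withDensity fun x => ENNReal.ofReal (Real.exp (γ x))) A =
      ∫⁻ ω in A, ENNReal.ofReal (ξ (Th ω) * density K ρ β t (m (Th ω)) (Th ω) ω)
        ∂(canon π K ν) := by
  have hA' := filt_le t A hA
  have hβm : Measurable β := by
    have : β = fun p => γ p.1 + α p.2 := by ext ⟨x, θ⟩; exact hβ x θ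
    rw [this]; fun_prop
  have hF : Measurable fun p : D × CanonSpace D =>
      ENNReal.ofReal (ξ p.1 * density K ρ β t (m p.1) p.1 p.2) := by
    refine Measurable.ennreal_ofReal (Measurable.mul (by fun_prop) ?_)
    exact measurable_density K ρ hβm t (hm.comp measurable_fst) measurable_fst measurable_snd
  -- The parameter is kept apart from the sample point, so that `lintegral_point_Th` can replace `Th
  -- ω` by `θ` in the integrand.
  have hF2 : Measurable fun p : D × CanonSpace D =>
      A.indicator (fun ω => ENNReal.ofReal (ξ p.1 * density K ρ β t (m p.1) p.1 ω)) p.2 := by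
    have : (fun p : D × CanonSpace D =>
      A.indicator (fun ω => ENNReal.ofReal (ξ p.1 * density K ρ β t (m p.1) p.1 ω)) p.2) =
      (Prod.snd ⁻¹' A).indicator fun p : D × CanonSpace D =>
        ENNReal.ofReal (ξ p.1 * density K ρ β t (m p.1) p.1 p.2) := by
      ext p; by_cases h : p.2 ∈ A <;> simp [h]
    rw [this]
    exact hF.indicator (measurable_snd hA')
  have hF3 : Measurable fun ω : CanonSpace D => A.indicator
      (fun ω' => ENNReal.ofReal (ξ (Th ω) * density K ρ β t (m (Th ω)) (Th ω) ω')) ω :=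
    hF2.comp (measurable_Th.prodMk measurable_id)
  have hind : A.indicator (fun ω : CanonSpace D => ENNReal.ofReal (ξ (Th ω) *
      density K ρ β t (m (Th ω)) (Th ω) ω)) = fun ω => A.indicator
      (fun ω' => ENNReal.ofReal (ξ (Th ω) * density K ρ β t (m (Th ω)) (Th ω) ω')) ω := by
    ext ω; by_cases h : ω ∈ A <;> simp [h]
  rw [← lintegral_indicator hA', hind, lintegral_canon _ _ _ hF3, canon_apply _ _ _ hA',
    lintegral_withDensity_eq_lintegral_mul _ (by fun_prop) (measurable_point_apply _ _ hA')]
  refine lintegral_congr_ae ?_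
  filter_upwards [hac, ham] with θ h1 h2
  rw [lintegral_point_Th (K θ) ν θ hF2]
  simp only
  rw [lintegral_indicator hA', Pi.mul_apply,
    point_expKernel_apply K ρ ν h1 hγ (fun x => hβ x θ) h2 hA, ← lintegral_const_mul]
  · refine lintegral_congr fun ω => ?_
    -- No sign is assumed for `ξ` here; nonnegativity of the other factor suffices.
    rw [ENNReal.ofReal_mul' (density_nonneg K ρ β t (hm0 θ) θ ω)]
  · exact (measurable_density K ρ hβm t measurable_const measurable_const
      measurable_id).ennreal_ofReal

lemma ae_point_density_pos (ν : Measure PosReal) [IsProbabilityMeasure ν] {θ : D}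
    (hac : expKernel ρ θ ≪ K θ) (hac' : K θ ≪ expKernel ρ θ) (β : PosReal × D → ℝ) {m : ℝ}
    (hm : 0 < m) (t : ℝ≥0) : ∀ᵐ ω ∂(point (K θ) ν θ), 0 < density K ρ β t m θ ω := by
  filter_upwards [ae_point_W (K θ) ν θ (hac'.ae_le (Kernel.rnDeriv_toReal_pos hac))] with ω hω
  have hpos : 0 < ∏ j ∈ Finset.range (N t ω).toNat,
      (Kernel.rnDeriv (expKernel ρ) K θ (W j ω)).toReal := Finset.prod_pos fun j _ => hω j
  have htail : 0 < (K θ {x : PosReal | (t : ℝ) - T (N t ω).toNat ω < x}).toReal :=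
    ENNReal.toReal_pos (fun h => expKernel_lt_ne_zero ρ θ _ (hac h)) (measure_ne_top _ _)
  have := ρ.pos θ
  rw [density]
  simp only [one_sub_real_le]
  positivity

/-- Almost sure positivity of the density. -/
lemma ae_density_pos [MeasurableSingletonClass D] (π : Measure D) (ν : Measure PosReal)
    [IsProbabilityMeasure ν] (hac : ∀ᵐ θ ∂π, expKernel ρ θ ≪ K θ ∧ K θ ≪ expKernel ρ θ)
    {β : PosReal × D → ℝ} (hβ : Measurable β) {m : D → ℝ} (hm : Measurable m)
    (hm0 : ∀ᵐ θ ∂π, 0 < m θ) (t : ℝ≥0) :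
    ∀ᵐ ω ∂(canon π K ν), 0 < density K ρ β t (m (Th ω)) (Th ω) ω := by
  refine ae_canon π K ν (measurableSet_lt measurable_const (measurable_density_Th K ρ hβ hm t)) ?_
  filter_upwards [hac, hm0] with θ h1 h2
  filter_upwards [ae_point_density_pos K ρ ν h1.1 h1.2 β h2 t,
    ae_Th_eq (K θ) ν θ (p := fun θ' => θ' = θ) rfl
    (measurableSet_singleton θ)] with ω h3 h4
  rw [h4]
  exact h3

end Density

/-! ### Observable events carrying the first claim and the first arrival -/

section Events

variable {D : Type} [MeasurableSpace D]

/-- The element of `(0,∞)` given by an extended nonnegative real (`1` if there is none). -/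
def toPos (x : ℝ≥0∞) : PosReal :=
  if h : 0 < x.toReal then ⟨x.toReal, h⟩ else ⟨1, Set.mem_Ioi.2 one_pos⟩

lemma toPos_ofReal (x : PosReal) : toPos (ENNReal.ofReal (x : ℝ)) = x := by
  have hx : (0 : ℝ) < x := x.2
  have : (ENNReal.ofReal (x : ℝ)).toReal = x := ENNReal.toReal_ofReal hx.le
  simp only [toPos, this, hx, dif_pos]

lemma measurable_toPos : Measurable toPos := by
  have : Measurable fun x : ℝ≥0∞ => if 0 < x.toReal then x.toReal else 1 :=
    Measurable.ite (measurableSet_lt measurable_const ENNReal.measurable_toReal)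
      ENNReal.measurable_toReal measurable_const
  have h2 : ∀ x : ℝ≥0∞, (if 0 < x.toReal then x.toReal else 1) = (toPos x : ℝ) := by
    intro x
    unfold toPos
    split_ifs <;> rfl
  simp only [h2] at this
  exact Measurable.subtype_mk this

/-- With exactly one arrival, `S t` is the first claim, so that claim is observed together with `Θ`.
-/
lemma measurableSet_filt_claim (t : ℝ≥0) {B : Set (PosReal × D)} (hB : MeasurableSet B) :
    MeasurableSet[filt t] ({ω : CanonSpace D | N t ω = 1} ∩ {ω | (X 0 ω, Th ω) ∈ B}) := by
  have : {ω : CanonSpace D | N t ω = 1} ∩ {ω | (X 0 ω, Th ω) ∈ B} =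
      {ω | N t ω = (1 : ℕ)} ∩ {ω | (toPos (S t ω), Th ω) ∈ B} := by
    ext ω
    simp only [Set.mem_inter_iff, Set.mem_ofPred_eq, Nat.cast_one]
    refine and_congr_right fun h => ?_
    rw [S_of_N_eq_one h, toPos_ofReal]
  rw [this]
  refine MeasurableSet.inter (measurableSet_N_eq_filt 1 t) ?_
  exact ((measurable_toPos.comp (measurable_S_filt le_rfl)).prodMk (measurable_Th_filt t)) hB

omit [MeasurableSpace D] in
lemma one_le_N_iff (t : ℝ≥0) (ω : CanonSpace D) : 1 ≤ N t ω ↔ (W 0 ω : ℝ) ≤ t := by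
  have := le_N_iff 1 t ω
  rw [T_succ, T_zero, zero_add] at this
  simpa using this

/-- At time `t` the first interarrival time is known only up to truncation at `t`; the truncation
loses nothing on `{W 0 ≤ t}`. -/
lemma measurable_min_W_filt (t : ℝ≥0) :
    Measurable[filt t] fun ω : CanonSpace D => min (W 0 ω : ℝ) t := by
  refine measurable_of_Iic fun s => ?_
  rcases le_or_gt (t : ℝ) s with h | h
  · have : (fun ω : CanonSpace D => min (W 0 ω : ℝ) t) ⁻¹' Set.Iic s = Set.univ := by
      ext ω; simp [h]
    rw [this]; exact @MeasurableSet.univ _ (filt t)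
  · rcases lt_or_ge s 0 with h0 | h0
    · have : (fun ω : CanonSpace D => min (W 0 ω : ℝ) t) ⁻¹' Set.Iic s = ∅ := by
        ext ω
        have hW : (0 : ℝ) < W 0 ω := (W 0 ω).2
        have ht : (0 : ℝ) ≤ t := t.2
        simp only [Set.mem_preimage, Set.mem_Iic, Set.mem_empty_iff_false, iff_false, not_le,
          lt_min_iff]
        exact ⟨h0.trans hW, h⟩
      rw [this]; exact @MeasurableSet.empty _ (filt t)
    · have : (fun ω : CanonSpace D => min (W 0 ω : ℝ) t) ⁻¹' Set.Iic s =
          {ω | ((1 : ℕ) : ℕ∞) ≤ N ⟨s, h0⟩ ω} := by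
        ext ω
        simp only [Set.mem_preimage, Set.mem_Iic, min_le_iff, Set.mem_ofPred_eq, Nat.cast_one,
          not_le.2 h, or_false]
        exact (one_le_N_iff ⟨s, h0⟩ ω).symm
      rw [this]
      exact filt_mono (show (⟨s, h0⟩ : ℝ≥0) ≤ t from h.le) _ (measurableSet_le_N_filt 1 _)

lemma measurableSet_filt_arrival (t : ℝ≥0) {C : Set (D × PosReal)} (hC : MeasurableSet C) :
    MeasurableSet[filt t] ({ω : CanonSpace D | (W 0 ω : ℝ) ≤ t} ∩ {ω | (Th ω, W 0 ω) ∈ C}) := by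
  have : {ω : CanonSpace D | (W 0 ω : ℝ) ≤ t} ∩ {ω | (Th ω, W 0 ω) ∈ C} =
      {ω | ((1 : ℕ) : ℕ∞) ≤ N t ω} ∩
        {ω | (Th ω, toPos (ENNReal.ofReal (min (W 0 ω : ℝ) t))) ∈ C} := by
    ext ω
    simp only [Set.mem_inter_iff, Set.mem_ofPred_eq, Nat.cast_one, one_le_N_iff]
    refine and_congr_right fun h => ?_
    rw [min_eq_left h, toPos_ofReal]
  rw [this]
  refine MeasurableSet.inter (measurableSet_le_N_filt 1 t) ?_
  exact ((measurable_Th_filt t).prodMk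
    (measurable_toPos.comp (measurable_min_W_filt t).ennreal_ofReal)) hC

end Events

/-! ### Absolute continuity on the filtration descends to the three ingredients -/

section AbsolutelyContinuous

variable {D : Type} [MeasurableSpace D] (π : Measure D)
  (K : Kernel D PosReal) [IsMarkovKernel K] (ν : Measure PosReal) [IsProbabilityMeasure ν]

/-- The event of one arrival involves `W` only, so it is independent of the first claim. -/
lemma point_claim (θ : D) (k : Measure PosReal) [IsProbabilityMeasure k] (t : ℝ≥0) {B : Set PosReal}
    (hB : MeasurableSet B) :
    point k ν θ ({ω | N t ω = 1} ∩ {ω | X 0 ω ∈ B}) = point k ν θ {ω | N t ω = 1} * ν B := by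
  set A : Set (ℕ → PosReal) := {w | N t ((w, w, ()) : CanonSpace Unit) = 1} with hA
  have h := point_WX ν k θ A ((fun x => x 0) ⁻¹' B)
  rw [← point_W ν k θ A] at h
  refine h.trans ?_
  congr 1
  rw [← Measure.map_apply (measurable_pi_apply 0) hB, Measure.infinitePi_map_eval]

lemma canon_claim (t : ℝ≥0) {B : Set PosReal} (hB : MeasurableSet B) :
    canon π K ν ({ω | N t ω = 1} ∩ {ω | X 0 ω ∈ B}) = canon π K ν {ω | N t ω = 1} * ν B := by
  have hN : MeasurableSet {ω : CanonSpace D | N t ω = 1} :=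
    measurable_N t (measurableSet_singleton _)
  have hX : MeasurableSet {ω : CanonSpace D | X 0 ω ∈ B} := measurable_X 0 hB
  rw [canon_apply _ _ _ (hN.inter hX), canon_apply _ _ _ hN]
  simp only [point_claim ν _ _ t hB]
  exact lintegral_mul_const _ (measurable_point_apply K ν hN)

lemma exists_canon_N_eq_one [IsProbabilityMeasure π] : ∃ t, canon π K ν {ω | N t ω = 1} ≠ 0 := by
  by_contra! h
  have hun : (Set.univ : Set (CanonSpace D)) =
      ⋃ i, {ω | N (TopologicalSpace.denseSeq ℝ≥0 i) ω = 1} := by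
    ext ω
    obtain ⟨i, hi, -⟩ := exists_N_eq 1 ω
    simp only [Set.mem_univ, Set.mem_iUnion, Set.mem_ofPred_eq, true_iff]
    exact ⟨i, by simpa using hi⟩
  have h1 : canon π K ν Set.univ = 0 := by
    rw [hun]; exact measure_iUnion_null fun i => h _
  simp at h1

lemma point_Th_W (θ : D) {C : Set (D × PosReal)} (hC : MeasurableSet C) :
    point (K θ) ν θ {ω | (Th ω, W 0 ω) ∈ C} = K θ (Prod.mk θ ⁻¹' C) := by
  have hm : MeasurableSet {ω : CanonSpace D | (Th ω, W 0 ω) ∈ C} :=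
    (measurable_Th.prodMk (measurable_W 0)) hC
  rw [← lintegral_indicator_one hm, ← lintegral_indicator_one (measurable_prodMk_left hC)]
  have h := lintegral_point_Th (K θ) ν θ
    (f := fun p : D × CanonSpace D => C.indicator (1 : D × PosReal → ℝ≥0∞) (p.1, W 0 p.2))
    ((measurable_one.indicator hC).comp
      (measurable_fst.prodMk ((measurable_W 0).comp measurable_snd)))
  refine Eq.trans ?_ (h.trans ?_)
  · rfl
  · exact lintegral_point_W (K θ) ν θ
      (f := fun y => C.indicator (1 : D × PosReal → ℝ≥0∞) (θ, y))
      ((measurable_one.indicator hC).comp measurable_prodMk_left) 0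

variable (π' : Measure D) (K' : Kernel D PosReal) [IsMarkovKernel K']
  (ν' : Measure PosReal) [IsProbabilityMeasure ν']

lemma ac_structural (h : ∀ t : ℝ≥0, ∀ A, MeasurableSet[filt t] A →
    canon π K ν A = 0 → canon π' K' ν' A = 0) : π' ≪ π := by
  refine Measure.AbsolutelyContinuous.mk fun C hC h0 => ?_
  rw [← canon_map_Th π' K' ν', Measure.map_apply measurable_Th hC]
  refine h 0 _ (measurable_Th_filt 0 hC) ?_
  rwa [← Measure.map_apply measurable_Th hC, canon_map_Th]

/-- Test on `{N t = 1}` intersected with an event of the first claim, at a time `t` where `{N t =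
1}` has positive probability under the second measure. -/
lemma ac_claims [IsProbabilityMeasure π'] (h : ∀ t : ℝ≥0, ∀ A, MeasurableSet[filt t] A →
    canon π K ν A = 0 → canon π' K' ν' A = 0) : ν' ≪ ν := by
  refine Measure.AbsolutelyContinuous.mk fun B hB h0 => ?_
  obtain ⟨t, ht⟩ := exists_canon_N_eq_one π' K' ν'
  have hm : MeasurableSet[filt t] ({ω : CanonSpace D | N t ω = 1} ∩ {ω | X 0 ω ∈ B}) :=
    measurableSet_filt_claim t (measurable_fst hB : MeasurableSet (Prod.fst ⁻¹' B))
  have h1 := h t _ hm (by rw [canon_claim _ _ _ _ hB, h0, mul_zero])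
  rw [canon_claim _ _ _ _ hB] at h1
  exact (mul_eq_zero.1 h1).resolve_left ht

/-- The jointly measurable set `C` is null for every `K θ` and carries the singular part of `K' θ`.
The event `(Θ, W 0) ∈ C` belongs to no single time, but its parts with `W 0 ≤ n` are observed by
time `n`. All are null under the first measure, hence under the second, so the singular part
vanishes almost surely. -/
lemma ac_kernel (h : ∀ t : ℝ≥0, ∀ A, MeasurableSet[filt t] A →
    canon π K ν A = 0 → canon π' K' ν' A = 0) : ∀ᵐ θ ∂π', K' θ ≪ K θ := by
  set C : Set (D × PosReal) := Kernel.mutuallySingularSet K' K with hCdef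
  have hC : MeasurableSet C := Kernel.measurableSet_mutuallySingularSet K' K
  have hm : MeasurableSet {ω : CanonSpace D | (Th ω, W 0 ω) ∈ C} :=
    (measurable_Th.prodMk (measurable_W 0)) hC
  have h0 : canon π K ν {ω | (Th ω, W 0 ω) ∈ C} = 0 := by
    rw [canon_apply _ _ _ hm]
    simp only [point_Th_W K ν _ hC]
    refine (lintegral_congr fun θ => ?_).trans lintegral_zero
    exact Kernel.measure_mutuallySingularSetSlice K' K θ
  have h1 : canon π' K' ν' {ω | (Th ω, W 0 ω) ∈ C} = 0 := by
    have hun : {ω : CanonSpace D | (Th ω, W 0 ω) ∈ C} =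
        ⋃ n : ℕ, ({ω | (W 0 ω : ℝ) ≤ (n : ℝ≥0)} ∩ {ω | (Th ω, W 0 ω) ∈ C}) := by
      ext ω
      simp only [Set.mem_iUnion, Set.mem_inter_iff, Set.mem_ofPred_eq]
      refine ⟨fun hω => ?_, fun ⟨_, _, hω⟩ => hω⟩
      obtain ⟨n, hn⟩ := exists_nat_ge (W 0 ω : ℝ)
      exact ⟨n, by simpa using hn, hω⟩
    rw [hun]
    exact measure_iUnion_null fun n => h n _ (measurableSet_filt_arrival n hC)
      (measure_mono_null Set.inter_subset_right h0)
  rw [canon_apply _ _ _ hm] at h1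
  simp only [point_Th_W K' ν' _ hC] at h1
  rw [lintegral_eq_zero_iff (Kernel.measurable_kernel_prodMk_left hC)] at h1
  filter_upwards [h1] with θ hθ
  rw [← Kernel.singularPart_eq_zero_iff_absolutelyContinuous,
    Kernel.singularPart_eq_zero_iff_measure_eq_zero]
  exact hθ

end AbsolutelyContinuous

/-! ### Auxiliary facts on densities -/

section General

lemma integral_eq_one_of_withDensity {E : Type*} [MeasurableSpace E] {μ : Measure E} {h : E → ℝ}
    (hm : Measurable h) (h0 : 0 ≤ᵐ[μ] h)
    [IsProbabilityMeasure (μ.withDensity fun x => ENNReal.ofReal (h x))] : ∫ x, h x ∂μ = 1 := by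
  rw [integral_eq_lintegral_of_nonneg_ae h0 hm.aestronglyMeasurable]
  have := measure_univ (μ := μ.withDensity fun x => ENNReal.ofReal (h x))
  rw [withDensity_apply _ MeasurableSet.univ, Measure.restrict_univ] at this
  simp [this]

lemma isProbabilityMeasure_withDensity_of_integral {E : Type*} [MeasurableSpace E] {μ : Measure E}
    {h : E → ℝ} (h0 : 0 ≤ᵐ[μ] h) (h1 : ∫ x, h x ∂μ = 1) :
    IsProbabilityMeasure (μ.withDensity fun x => ENNReal.ofReal (h x)) := by
  have hint : Integrable h μ := by
    by_contra hc
    rw [integral_undef hc] at h1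
    exact zero_ne_one h1
  constructor
  rw [withDensity_apply _ MeasurableSet.univ, Measure.restrict_univ,
    ← ofReal_integral_eq_lintegral_ofReal hint h0, h1, ENNReal.ofReal_one]

/-- If `F ≤ G` on `A` and both have the same finite integral over `A`, then the subset of `A` where
`F < G` is null. -/
lemma measure_inter_eq_zero_of_lt {Ω : Type*} [MeasurableSpace Ω] {μ : Measure Ω} {A E : Set Ω}
    (hA : MeasurableSet A) {F G : Ω → ℝ} (hG : Measurable G)
    (hle : ∀ᵐ ω ∂μ, ω ∈ A → F ω ≤ G ω)
    (hlt : ∀ᵐ ω ∂μ, ω ∈ A → ω ∈ E → F ω < G ω ∧ 0 < G ω)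
    (hfin : ∫⁻ ω in A, ENNReal.ofReal (F ω) ∂μ ≠ ⊤)
    (heq : ∫⁻ ω in A, ENNReal.ofReal (G ω) ∂μ = ∫⁻ ω in A, ENNReal.ofReal (F ω) ∂μ) :
    μ (A ∩ E) = 0 := by
  have h1 : (fun ω => ENNReal.ofReal (F ω)) ≤ᵐ[μ.restrict A] fun ω => ENNReal.ofReal (G ω) := by
    rw [Filter.EventuallyLE, ae_restrict_iff' hA]
    filter_upwards [hle] with ω h hω using ENNReal.ofReal_le_ofReal (h hω)
  have h2 := ae_eq_of_ae_le_of_lintegral_le h1 hfin hG.ennreal_ofReal.aemeasurable heq.le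
  rw [Filter.EventuallyEq, ae_restrict_iff' hA] at h2
  have h3 : ∀ᵐ ω ∂μ, ω ∉ A ∩ E := by
    filter_upwards [h2, hlt] with ω ha hb hω
    obtain ⟨h4, h5⟩ := hb hω.1 hω.2
    exact absurd (ha hω.1) ((ENNReal.ofReal_lt_ofReal_iff h5).2 h4).ne
  exact measure_eq_zero_iff_ae_notMem.2 h3

lemma setLIntegral_ofReal_eq_zero_iff {Ω : Type*} [MeasurableSpace Ω] {μ : Measure Ω} {A : Set Ω}
    (hA : MeasurableSet A) {F : Ω → ℝ} (hF : Measurable F) (hpos : ∀ᵐ ω ∂μ, 0 < F ω) :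
    ∫⁻ ω in A, ENNReal.ofReal (F ω) ∂μ = 0 ↔ μ A = 0 := by
  rw [lintegral_eq_zero_iff hF.ennreal_ofReal]
  constructor
  · intro h
    rw [Filter.EventuallyEq, ae_restrict_iff' hA] at h
    refine measure_eq_zero_iff_ae_notMem.2 ?_
    filter_upwards [h, hpos] with ω h1 h2 h3
    exact absurd (h1 h3) (ENNReal.ofReal_pos.2 h2).ne'
  · intro h
    rw [Measure.restrict_zero_set h]
    exact ae_zero.symm ▸ trivial

/-- The real-valued version of `Measure.withDensity_rnDeriv_eq`. -/
lemma withDensity_ofReal_rnDeriv_toReal {E : Type*} [MeasurableSpace E] {μ ν : Measure E}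
    [SigmaFinite μ] [SigmaFinite ν] (h : μ ≪ ν) :
    ν.withDensity (fun x => ENNReal.ofReal (μ.rnDeriv ν x).toReal) = μ := by
  conv_rhs => rw [← Measure.withDensity_rnDeriv_eq μ ν h]
  refine withDensity_congr_ae ?_
  filter_upwards [Measure.rnDeriv_lt_top μ ν] with x hx
  exact ENNReal.ofReal_toReal hx.ne

end General

/-! ### Change of measure for mixtures, and uniqueness -/

section ChangeOfMeasure

variable {D : Type} [MeasurableSpace D]

/-- The mean of `K θ` as a real number. -/
def meanR (K : Kernel D PosReal) (θ : D) : ℝ := (mean K θ).toReal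

lemma measurable_meanR (K : Kernel D PosReal) : Measurable (meanR K) :=
  (measurable_mean K).ennreal_toReal

lemma Decomp.measurable {P : Measure (CanonSpace D)} {β : PosReal × D → ℝ} {γ : PosReal → ℝ}
    {α : D → ℝ} (h : Decomp P β γ α) : Measurable β := by
  have h1 := h.mem_left.measurable
  have h2 := h.measurable_right
  have : β = fun p => γ p.1 + α p.2 := by ext ⟨x, θ⟩; exact h.eq_add x θ
  rw [this]; fun_prop

variable (π : Measure D) [IsProbabilityMeasure π]
  (K : Kernel D PosReal) [IsMarkovKernel K] (ν : Measure PosReal) [IsProbabilityMeasure ν]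
  (ρ : PosFun D)

lemma rpmxi_canon_iff (β : PosReal × D → ℝ) (ξ : D → ℝ) (Q : Measure (CanonSpace D)) :
    RPMxi (canon π K ν) K ρ β ξ Q ↔ ∀ t : ℝ≥0, ∀ A, MeasurableSet[filt t] A →
      Q A = ∫⁻ ω in A, ENNReal.ofReal
        (ξ (Th ω) * density K ρ β t (meanR K (Th ω)) (Th ω) ω) ∂(canon π K ν) := by
  have key : ∀ (t : ℝ≥0) (A : Set (CanonSpace D)), ∫⁻ ω in A, ENNReal.ofReal
      (ξ (Th ω) * density K ρ β t (condMeanW (canon π K ν) ω).toReal (Th ω) ω) ∂(canon π K ν) =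
      ∫⁻ ω in A, ENNReal.ofReal
        (ξ (Th ω) * density K ρ β t (meanR K (Th ω)) (Th ω) ω) ∂(canon π K ν) := by
    intro t A
    refine lintegral_congr_ae (ae_restrict_of_ae ?_)
    filter_upwards [condMeanW_canon π K ν] with ω hω
    rw [hω, meanR]
  constructor
  · intro h t A hA
    rw [h t t le_rfl A hA, key]
  · intro h u t hut A hA
    rw [key]
    exact h t A (filt_mono hut _ hA)

omit [IsProbabilityMeasure π] in
lemma lintegral_Th_mul_density_zero (β : PosReal × D → ℝ) {ξ : D → ℝ} (hξ : Measurable ξ)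
    {C : Set D} (hC : MeasurableSet C) :
    ∫⁻ ω in Th ⁻¹' C, ENNReal.ofReal
        (ξ (Th ω) * density K ρ β 0 (meanR K (Th ω)) (Th ω) ω) ∂(canon π K ν) =
      ∫⁻ θ in C, ENNReal.ofReal (ξ θ) ∂π := by
  simp only [density_zero, mul_one]
  refine (setLIntegral_map hC (f := fun θ => ENNReal.ofReal (ξ θ)) (by fun_prop)
    measurable_Th).symm.trans ?_
  rw [canon_map_Th]

omit [IsProbabilityMeasure π] in
lemma ae_canon_Th {p : D → Prop} (h : ∀ᵐ θ ∂π, p θ) : ∀ᵐ ω ∂(canon π K ν), p (Th ω) :=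
  ae_of_ae_map (p := p) (f := (Th : CanonSpace D → D)) measurable_Th.aemeasurable
    ((canon_map_Th π K ν).symm ▸ h)

variable [MeasurableSingletonClass D]

omit [MeasurableSingletonClass D] in
-- It is enough that the first interarrival time is at most `1` and the second exceeds `1`; these
-- events are independent, and both are charged since `k` dominates an exponential law.
lemma point_N_one_ne_zero (k : Measure PosReal) [IsProbabilityMeasure k] (θ : D)
    (hac : expKernel ρ θ ≪ k) : point k ν θ {ω | N 1 ω = 1} ≠ 0 := by
  have h1 : k {y : PosReal | (y : ℝ) ≤ 1} ≠ 0 := fun h => expKernel_le_pos ρ θ one_pos (hac h)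
  have h2 : k {y : PosReal | (1 : ℝ) < y} ≠ 0 := fun h => expKernel_lt_ne_zero ρ θ 1 (hac h)
  have hm1 : MeasurableSet {y : PosReal | (y : ℝ) ≤ 1} :=
    measurableSet_le (by fun_prop) measurable_const
  have hm2 : MeasurableSet {y : PosReal | (1 : ℝ) < y} :=
    measurableSet_lt measurable_const (by fun_prop)
  set B : ℕ → Set PosReal := fun n => if n = 0 then {y : PosReal | (y : ℝ) ≤ 1} else
    {y : PosReal | (1 : ℝ) < y} with hB
  have hbox : (Measure.infinitePi fun _ : ℕ => k) (Set.pi (Finset.range 2) B) ≠ 0 := by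
    rw [Measure.infinitePi_pi _ fun i _ => by simp only [hB]; split_ifs; exacts [hm1, hm2]]
    simp [Finset.prod_range_succ, hB, h1, h2]
  rw [← point_W ν k θ] at hbox
  refine fun h0 => hbox (measure_mono_null ?_ h0)
  intro ω hω
  have hω' : ∀ i ∈ Finset.range 2, W i ω ∈ B i := hω
  have ha : (W 0 ω : ℝ) ≤ 1 := by simpa [hB] using hω' 0 (by simp)
  have hb : (1 : ℝ) < W 1 ω := by simpa [hB] using hω' 1 (by simp)
  have hc : (0 : ℝ) < W 0 ω := (W 0 ω).2
  have := (N_eq_iff 1 1 ω).2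
  simp only [T_succ, T_zero, zero_add, NNReal.coe_one, Nat.cast_one] at this
  exact this ⟨ha, by linarith⟩

omit [IsProbabilityMeasure π] in
-- For almost every `θ`, the event of one arrival by time `1` has positive probability and is
-- independent of the first claim, so it can be divided out and each slice of `B` is null. This
-- turns null events at time `1` into null sets for the pair of claim and parameter.
lemma prod_eq_zero_of_claim [SFinite π] (hac : ∀ᵐ θ ∂π, expKernel ρ θ ≪ K θ)
    {B : Set (PosReal × D)} (hB : MeasurableSet B)
    (h : canon π K ν ({ω | N 1 ω = 1} ∩ {ω | (X 0 ω, Th ω) ∈ B}) = 0) : (ν.prod π) B = 0 := by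
  have hm : MeasurableSet ({ω : CanonSpace D | N 1 ω = 1} ∩ {ω | (X 0 ω, Th ω) ∈ B}) :=
    filt_le 1 _ (measurableSet_filt_claim 1 hB)
  rw [canon_apply _ _ _ hm, lintegral_eq_zero_iff (measurable_point_apply K ν hm)] at h
  rw [Measure.prod_apply_symm hB, lintegral_eq_zero_iff (measurable_measure_prodMk_right hB)]
  filter_upwards [h, hac] with θ h1 h2
  have hcongr : point (K θ) ν θ ({ω | N 1 ω = 1} ∩ {ω | (X 0 ω, Th ω) ∈ B}) =
      point (K θ) ν θ ({ω | N 1 ω = 1} ∩ {ω | X 0 ω ∈ (fun x => (x, θ)) ⁻¹' B}) := by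
    refine measure_congr ?_
    filter_upwards [ae_Th_eq (K θ) ν θ (p := fun θ' => θ' = θ) rfl
      (measurableSet_singleton θ)] with ω hω
    refine propext (and_congr_right fun _ => ?_)
    change (X 0 ω, Th ω) ∈ B ↔ (X 0 ω, θ) ∈ B
    rw [hω]
  have h3 : point (K θ) ν θ ({ω | N 1 ω = 1} ∩ {ω | (X 0 ω, Th ω) ∈ B}) = 0 := h1
  rw [hcongr, point_claim ν θ (K θ) 1 (measurable_prodMk_right hB)] at h3
  exact (mul_eq_zero.1 h3).resolve_left (point_N_one_ne_zero ν ρ (K θ) θ h2)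

omit [MeasurableSingletonClass D] in
lemma rpmxi_canon (hac : ∀ᵐ θ ∂π, expKernel ρ θ ≪ K θ) {γ : PosReal → ℝ} (hγ : Measurable γ)
    [IsProbabilityMeasure (ν.withDensity fun x => ENNReal.ofReal (Real.exp (γ x)))]
    {β : PosReal × D → ℝ} {α : D → ℝ} (hα : Measurable α)
    (hβ : ∀ x θ, β (x, θ) = γ x + α θ) (ham : ∀ᵐ θ ∂π, Real.exp (α θ) = ρ θ * meanR K θ)
    {ξ : D → ℝ} (hξ : Measurable ξ) :
    RPMxi (canon π K ν) K ρ β ξ (canon (π.withDensity fun θ => ENNReal.ofReal (ξ θ)) (expKernel ρ)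
      (ν.withDensity fun x => ENNReal.ofReal (Real.exp (γ x)))) :=
  (rpmxi_canon_iff π K ν ρ β ξ _).2 fun _ _ hA =>
    canon_expKernel_apply K ρ π ν hac hγ hα (measurable_meanR K)
      (fun _ => ENNReal.toReal_nonneg) hβ ham hξ hA

/-- The measure obtained by the change of measure is in the class. -/
lemma memM_canon (hac : ∀ᵐ θ ∂π, expKernel ρ θ ≪ K θ ∧ K θ ≪ expKernel ρ θ)
    (hmean : ∀ᵐ θ ∂π, 0 < meanR K θ) {γ : PosReal → ℝ} (hγ : Measurable γ)
    [IsProbabilityMeasure (ν.withDensity fun x => ENNReal.ofReal (Real.exp (γ x)))]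
    {ξ : D → ℝ} (hξ : Measurable ξ) (hξ0 : ∀ᵐ θ ∂π, 0 < ξ θ)
    [IsProbabilityMeasure (π.withDensity fun θ => ENNReal.ofReal (ξ θ))] :
    MemM (canon π K ν) (expKernel ρ)
      (canon (π.withDensity fun θ => ENNReal.ofReal (ξ θ)) (expKernel ρ)
        (ν.withDensity fun x => ENNReal.ofReal (Real.exp (γ x)))) := by
  refine ⟨inferInstance, condA1_canon _ _ _, condA2_canon _ _ _, ?_, isCMRP_canon _ _ _⟩
  intro t A hA
  -- The target measure does not depend on `α`; this choice makes the explicit density available,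
  -- and its almost sure positivity gives the equivalence.
  have hα : Measurable fun θ => Real.log (ρ θ * meanR K θ) :=
    (ρ.measurable.mul (measurable_meanR K)).log
  have hβ : Measurable fun p : PosReal × D => γ p.1 + Real.log (ρ p.2 * meanR K p.2) :=
    (hγ.comp measurable_fst).add (hα.comp measurable_snd)
  rw [(rpmxi_canon_iff π K ν ρ _ ξ _).1 (rpmxi_canon π K ν ρ (hac.mono fun θ h => h.1) hγ hα
    (β := fun p : PosReal × D => γ p.1 + Real.log (ρ p.2 * meanR K p.2))
    (α := fun θ => Real.log (ρ θ * meanR K θ)) (fun _ _ => rfl)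
    (hmean.mono fun θ h => Real.exp_log (mul_pos (ρ.pos θ) h)) hξ) t A hA]
  refine setLIntegral_ofReal_eq_zero_iff (filt_le t A hA) ((hξ.comp measurable_Th).mul
    (measurable_density_Th K ρ hβ (measurable_meanR K) t)) ?_
  filter_upwards [ae_canon_Th π K ν hξ0, ae_density_pos K ρ π ν hac hβ (measurable_meanR K) hmean t]
    with ω h2 h3 using mul_pos h2 h3

/-- Essential uniqueness of the pair `(β, ξ)`. -/
lemma rpmxi_unique_left (hac : ∀ᵐ θ ∂π, expKernel ρ θ ≪ K θ ∧ K θ ≪ expKernel ρ θ)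
    (hmean : ∀ᵐ θ ∂π, 0 < meanR K θ) {β β' : PosReal × D → ℝ} (hβ : Measurable β)
    (hβ' : Measurable β') {ξ ξ' : D → ℝ} (hξ : Measurable ξ) (hξ' : Measurable ξ')
    (hξ0 : ∀ᵐ θ ∂π, 0 < ξ θ) (hξ0' : ∀ᵐ θ ∂π, 0 < ξ' θ) {Q : Measure (CanonSpace D)}
    [IsProbabilityMeasure Q] (h : RPMxi (canon π K ν) K ρ β ξ Q)
    (h' : RPMxi (canon π K ν) K ρ β' ξ' Q) :
    β' =ᵐ[ν.prod π] β ∧ ξ' =ᵐ[π] ξ := by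
  rw [rpmxi_canon_iff] at h h'
  -- At time `0` the density is `1`, so both `ξ` and `ξ'` represent the structural law of `Q`.
  have hξeq : ξ' =ᵐ[π] ξ := by
    have : (fun θ => ENNReal.ofReal (ξ' θ)) =ᵐ[π] fun θ => ENNReal.ofReal (ξ θ) := by
      refine ae_eq_of_forall_setLIntegral_eq_of_sigmaFinite (by fun_prop) (by fun_prop)
        fun C hC _ => ?_
      rw [← lintegral_Th_mul_density_zero π K ν ρ β hξ hC,
        ← lintegral_Th_mul_density_zero π K ν ρ β' hξ' hC,
        ← h 0 _ (measurable_Th_filt 0 hC), ← h' 0 _ (measurable_Th_filt 0 hC)]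
    filter_upwards [this, hξ0, hξ0'] with θ h1 h2 h3
    exact (ENNReal.ofReal_eq_ofReal_iff h3.le h2.le).1 h1
  refine ⟨?_, hξeq⟩
  -- Consider the event of exactly one arrival at time `1` with `β₁ < β₂` at the first claim. There
  -- the second density is strictly larger, yet both integrate to the same finite value of `Q`;
  -- hence the event is null.
  have one_side : ∀ {β₁ β₂ : PosReal × D → ℝ} {ξ₁ ξ₂ : D → ℝ}, Measurable β₁ → Measurable β₂ →
      Measurable ξ₂ → ξ₂ =ᵐ[π] ξ₁ → (∀ᵐ θ ∂π, 0 < ξ₁ θ) →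
      (∀ t : ℝ≥0, ∀ A, MeasurableSet[filt t] A → Q A = ∫⁻ ω in A, ENNReal.ofReal
        (ξ₁ (Th ω) * density K ρ β₁ t (meanR K (Th ω)) (Th ω) ω) ∂(canon π K ν)) →
      (∀ t : ℝ≥0, ∀ A, MeasurableSet[filt t] A → Q A = ∫⁻ ω in A, ENNReal.ofReal
        (ξ₂ (Th ω) * density K ρ β₂ t (meanR K (Th ω)) (Th ω) ω) ∂(canon π K ν)) →
      ∀ᵐ p ∂(ν.prod π), β₂ p ≤ β₁ p := by
    intro β₁ β₂ ξ₁ ξ₂ hβ₁ hβ₂ hξ₂ hξe hξp h1 h2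
    have hB : MeasurableSet {p : PosReal × D | β₁ p < β₂ p} := measurableSet_lt hβ₁ hβ₂
    have hAf := measurableSet_filt_claim 1 hB
    have hA := filt_le 1 _ hAf
    have hξe' : ∀ᵐ ω ∂(canon π K ν), ξ₂ (Th ω) = ξ₁ (Th ω) ∧ 0 < ξ₁ (Th ω) :=
      ae_canon_Th π K ν (p := fun θ => ξ₂ θ = ξ₁ θ ∧ 0 < ξ₁ θ) (hξe.and hξp)
    have hlt : ∀ᵐ ω ∂(canon π K ν), ω ∈ {ω : CanonSpace D | N 1 ω = 1} ∩
        {ω | (X 0 ω, Th ω) ∈ {p : PosReal × D | β₁ p < β₂ p}} →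
        ξ₁ (Th ω) * density K ρ β₁ 1 (meanR K (Th ω)) (Th ω) ω <
          ξ₂ (Th ω) * density K ρ β₂ 1 (meanR K (Th ω)) (Th ω) ω ∧
        0 < ξ₂ (Th ω) * density K ρ β₂ 1 (meanR K (Th ω)) (Th ω) ω := by
      filter_upwards [hξe', ae_density_pos K ρ π ν hac hβ₁ (measurable_meanR K) hmean 1]
        with ω h3 h4 hω
      have hN : N 1 ω = 1 := hω.1
      have hlt : β₁ (X 0 ω, Th ω) < β₂ (X 0 ω, Th ω) := hω.2
      have hd : density K ρ β₂ 1 (meanR K (Th ω)) (Th ω) ω =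
          Real.exp (β₂ (X 0 ω, Th ω) - β₁ (X 0 ω, Th ω)) *
            density K ρ β₁ 1 (meanR K (Th ω)) (Th ω) ω := by
        simp only [density, hN, ENat.toNat_one, Finset.sum_range_one]
        rw [show β₂ (X 0 ω, Th ω) - ρ (Th ω) * (((1 : ℝ≥0) : ℝ) - T 1 ω) =
          (β₂ (X 0 ω, Th ω) - β₁ (X 0 ω, Th ω)) +
          (β₁ (X 0 ω, Th ω) - ρ (Th ω) * (((1 : ℝ≥0) : ℝ) - T 1 ω)) by ring, Real.exp_add]
        ring
      have he : 1 < Real.exp (β₂ (X 0 ω, Th ω) - β₁ (X 0 ω, Th ω)) :=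
        Real.one_lt_exp_iff.2 (sub_pos.2 hlt)
      have hpos := mul_pos h3.2 h4
      rw [h3.1, hd]
      have : ξ₁ (Th ω) * density K ρ β₁ 1 (meanR K (Th ω)) (Th ω) ω <
          ξ₁ (Th ω) * (Real.exp (β₂ (X 0 ω, Th ω) - β₁ (X 0 ω, Th ω)) *
            density K ρ β₁ 1 (meanR K (Th ω)) (Th ω) ω) := by nlinarith
      exact ⟨this, hpos.trans this⟩
    have h0 := measure_inter_eq_zero_of_lt (E := Set.univ) hA
      ((hξ₂.comp measurable_Th).mul (measurable_density_Th K ρ hβ₂ (measurable_meanR K) 1))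
      (hlt.mono fun ω h hω => (h hω).1.le) (hlt.mono fun ω h hω _ => h hω)
      (by rw [← h1 1 _ hAf]; exact measure_ne_top _ _) ((h2 1 _ hAf).symm.trans (h1 1 _ hAf))
    rw [Set.inter_univ] at h0
    have h5 := prod_eq_zero_of_claim π K ν ρ (hac.mono fun θ h => h.1) hB h0
    filter_upwards [measure_eq_zero_iff_ae_notMem.1 h5] with p hp
    exact not_lt.1 hp
  filter_upwards [one_side hβ hβ' hξ' hξeq hξ0 h h',
    one_side hβ' hβ hξ hξeq.symm hξ0' h' h] with p h1 h2
  exact le_antisymm h1 h2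

/-- The rate `ρ` is determined by `α`. -/
lemma exp_eq_of_rpmxi (hac : ∀ᵐ θ ∂π, expKernel ρ θ ≪ K θ ∧ K θ ≪ expKernel ρ θ)
    (hmean : ∀ᵐ θ ∂π, 0 < meanR K θ) {γ : PosReal → ℝ} (hγ : Measurable γ)
    [IsProbabilityMeasure (ν.withDensity fun x => ENNReal.ofReal (Real.exp (γ x)))]
    {β : PosReal × D → ℝ} {α : D → ℝ} (hα : Measurable α) (hβ : ∀ x θ, β (x, θ) = γ x + α θ)
    {ξ : D → ℝ} (hξ : Measurable ξ) (hξ0 : ∀ᵐ θ ∂π, 0 < ξ θ)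
    [IsProbabilityMeasure (π.withDensity fun θ => ENNReal.ofReal (ξ θ))]
    {Q : Measure (CanonSpace D)} [IsProbabilityMeasure Q]
    (h : RPMxi (canon π K ν) K ρ β ξ Q) : ∀ᵐ θ ∂π, Real.exp (α θ) = ρ θ * meanR K θ := by
  -- The value `α` ought to have; it comes with a genuine measure satisfying (RPM_ξ), to which `Q`
  -- is compared.
  set α' : D → ℝ := fun θ => Real.log (ρ θ * meanR K θ) with hα'
  set β' : PosReal × D → ℝ := fun p => γ p.1 + α' p.2 with hβ'
  have hα'm : Measurable α' := (ρ.measurable.mul (measurable_meanR K)).log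
  have hβm : Measurable β := by
    have : β = fun p => γ p.1 + α p.2 := by ext ⟨x, θ⟩; exact hβ x θ
    rw [this]; fun_prop
  have hβ'm : Measurable β' := by fun_prop
  have hexp : ∀ᵐ θ ∂π, Real.exp (α' θ) = ρ θ * meanR K θ :=
    hmean.mono fun θ h => Real.exp_log (mul_pos (ρ.pos θ) h)
  have h' := rpmxi_canon π K ν ρ (hac.mono fun θ h => h.1) hγ hα'm
    (β := β') (fun _ _ => rfl) hexp hξ
  rw [rpmxi_canon_iff] at h h'
  -- Changing `α` tilts the density by `exp (N (α - α'))`: monotone in `α`, strictly so as soon as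
  -- there is an arrival.
  have hd : ∀ ω, density K ρ β 1 (meanR K (Th ω)) (Th ω) ω =
      Real.exp ((N 1 ω).toNat * (α (Th ω) - α' (Th ω))) *
        density K ρ β' 1 (meanR K (Th ω)) (Th ω) ω := by
    intro ω
    simp only [density, hβ, hβ', Finset.sum_add_distrib, Finset.sum_const, Finset.card_range,
      nsmul_eq_mul]
    rw [show ∀ a b c : ℝ, a + (N 1 ω).toNat * α (Th ω) - c =
      ((N 1 ω).toNat * (α (Th ω) - α' (Th ω))) + (a + (N 1 ω).toNat * α' (Th ω) - c) from
      fun a b c => by ring, Real.exp_add]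
    · ring
    -- The variable `b` occurs on neither side of the identity, so any value serves.
    · exact 0
  -- The two measures need not be known to coincide. Both have structural density `ξ`, by time `0`,
  -- so they agree on `σ(Θ)`, and that is all the comparison uses.
  have hint : ∀ C : Set D, MeasurableSet C →
      ∫⁻ ω in Th ⁻¹' C, ENNReal.ofReal
        (ξ (Th ω) * density K ρ β 1 (meanR K (Th ω)) (Th ω) ω) ∂(canon π K ν) =
      ∫⁻ ω in Th ⁻¹' C, ENNReal.ofReal
        (ξ (Th ω) * density K ρ β' 1 (meanR K (Th ω)) (Th ω) ω) ∂(canon π K ν) := by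
    intro C hC
    rw [← h 1 _ (measurable_Th_filt 1 hC), ← h' 1 _ (measurable_Th_filt 1 hC),
      h 0 _ (measurable_Th_filt 0 hC), h' 0 _ (measurable_Th_filt 0 hC),
      lintegral_Th_mul_density_zero π K ν ρ β hξ hC,
      lintegral_Th_mul_density_zero π K ν ρ β' hξ hC]
  have hfin : ∀ C : Set D, MeasurableSet C → ∫⁻ ω in Th ⁻¹' C, ENNReal.ofReal
      (ξ (Th ω) * density K ρ β 1 (meanR K (Th ω)) (Th ω) ω) ∂(canon π K ν) ≠ ⊤ := by
    intro C hC
    rw [← h 1 _ (measurable_Th_filt 1 hC)]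
    exact measure_ne_top _ _
  have hξ' : ∀ᵐ ω ∂(canon π K ν), 0 < ξ (Th ω) :=
    ae_canon_Th π K ν hξ0
  have hnull : ∀ C : Set D, MeasurableSet C →
      canon π K ν (Th ⁻¹' C ∩ {ω | N 1 ω = 1}) = 0 → π C = 0 := by
    intro C hC h0
    have h1 := prod_eq_zero_of_claim π K ν ρ (hac.mono fun θ h => h.1)
      (B := Set.univ ×ˢ C) (MeasurableSet.univ.prod hC) (by
        rw [Set.inter_comm] at h0
        convert h0 using 2
        ext ω
        simp)
    rwa [Measure.prod_prod, measure_univ, one_mul] at h1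
  have hpos := ae_density_pos K ρ π ν hac hβm (measurable_meanR K) hmean 1
  have hpos' := ae_density_pos K ρ π ν hac hβ'm (measurable_meanR K) hmean 1
  have hm := (hξ.comp measurable_Th).mul (measurable_density_Th K ρ hβm (measurable_meanR K) 1)
  have hm' := (hξ.comp measurable_Th).mul (measurable_density_Th K ρ hβ'm (measurable_meanR K) 1)
  have hC1 : MeasurableSet {θ | α' θ < α θ} := measurableSet_lt hα'm hα
  have hC2 : MeasurableSet {θ | α θ < α' θ} := measurableSet_lt hα hα'm
  -- On `{α' < α}` the tilt is at least `1`, and strictly above `1` when there is one arrival; equal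
  -- finite integrals exclude this. The set `{α < α'}` is handled with the roles exchanged.
  have h1 := hnull _ hC1 (measure_inter_eq_zero_of_lt (measurable_Th hC1) hm
    (F := fun ω => ξ (Th ω) * density K ρ β' 1 (meanR K (Th ω)) (Th ω) ω)
    (by
      filter_upwards [hξ', hpos'] with ω h2 h3 h4
      have h4' : α' (Th ω) < α (Th ω) := h4
      have h5 : 1 ≤ Real.exp ((N 1 ω).toNat * (α (Th ω) - α' (Th ω))) :=
        Real.one_le_exp (mul_nonneg (Nat.cast_nonneg _) (sub_pos.2 h4').le)
      have h6 := mul_pos h2 h3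
      simp only [Pi.mul_apply, Function.comp_apply, hd]
      nlinarith)
    (by
      filter_upwards [hξ', hpos', hpos] with ω h2 h3 h3' h4 hN
      have h4' : α' (Th ω) < α (Th ω) := h4
      have hN' : N 1 ω = 1 := hN
      have h5 : 1 < Real.exp ((N 1 ω).toNat * (α (Th ω) - α' (Th ω))) := by
        rw [hN', ENat.toNat_one, Nat.cast_one, one_mul]
        exact Real.one_lt_exp_iff.2 (sub_pos.2 h4')
      have h6 := mul_pos h2 h3
      refine ⟨?_, mul_pos h2 h3'⟩
      simp only [Pi.mul_apply, Function.comp_apply, hd]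
      nlinarith)
    (by rw [← hint _ hC1]; exact hfin _ hC1) (hint _ hC1))
  have h2 := hnull _ hC2 (measure_inter_eq_zero_of_lt (measurable_Th hC2) hm'
    (F := fun ω => ξ (Th ω) * density K ρ β 1 (meanR K (Th ω)) (Th ω) ω)
    (by
      filter_upwards [hξ', hpos'] with ω h2 h3 h4
      have h4' : α (Th ω) < α' (Th ω) := h4
      have h5 : Real.exp ((N 1 ω).toNat * (α (Th ω) - α' (Th ω))) ≤ 1 :=
        Real.exp_le_one_iff.2 (mul_nonpos_of_nonneg_of_nonpos (Nat.cast_nonneg _)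
          (sub_neg.2 h4').le)
      have h6 := mul_pos h2 h3
      simp only [Pi.mul_apply, Function.comp_apply, hd]
      nlinarith)
    (by
      filter_upwards [hξ', hpos'] with ω h2 h3 h4 hN
      have h4' : α (Th ω) < α' (Th ω) := h4
      have hN' : N 1 ω = 1 := hN
      have h5 : Real.exp ((N 1 ω).toNat * (α (Th ω) - α' (Th ω))) < 1 := by
        rw [hN', ENat.toNat_one, Nat.cast_one, one_mul]
        exact Real.exp_lt_one_iff.2 (sub_neg.2 h4')
      have h6 := mul_pos h2 h3
      refine ⟨?_, h6⟩
      simp only [Pi.mul_apply, Function.comp_apply, hd]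
      nlinarith)
    (hfin _ hC2) (hint _ hC2).symm)
  filter_upwards [measure_eq_zero_iff_ae_notMem.1 h1, measure_eq_zero_iff_ae_notMem.1 h2, hexp]
    with θ h3 h4 h5
  rw [← h5, le_antisymm (not_lt.1 h3) (not_lt.1 h4)]

omit [MeasurableSingletonClass D] in
lemma canon_congr {Λ Λ' : Kernel D PosReal} [IsMarkovKernel Λ] [IsMarkovKernel Λ']
    {π : Measure D} (h : ∀ᵐ θ ∂π, Λ θ = Λ' θ) : canon π Λ ν = canon π Λ' ν := by
  ext A hA
  rw [canon_apply _ _ _ hA, canon_apply _ _ _ hA]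
  refine lintegral_congr_ae ?_
  filter_upwards [h] with θ hθ
  have : ∀ (k k' : Measure PosReal), k = k' → point k ν θ A = point k' ν θ A := by
    rintro k _ rfl; rfl
  exact this _ _ hθ

omit [IsMarkovKernel K] [MeasurableSingletonClass D] in
/-- A probability measure is determined by `(ρ, β, ξ)`. -/
lemma eq_of_rpmxi {β : PosReal × D → ℝ} {ξ : D → ℝ} {Q Q' : Measure (CanonSpace D)}
    [IsProbabilityMeasure Q] [IsProbabilityMeasure Q'] {P : Measure (CanonSpace D)}
    (h : RPMxi P K ρ β ξ Q) (h' : RPMxi P K ρ β ξ Q') : Q = Q' :=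
  ext_of_filt fun t A hA => (h t t le_rfl A hA).trans (h' t t le_rfl A hA).symm

end ChangeOfMeasure

/-! ### Regular conditional probabilities and their uniqueness -/

section RegularConditionalProbability

variable {Ω Y : Type} [MeasurableSpace Ω] [MeasurableSpace Y]

/-- Consistency for `B` and for its complement shows that `κ y` gives `f ⁻¹' B` mass `1` or `0`
according to whether `y ∈ B`, so intersecting with that set amounts to restricting the integral. -/
lemma IsRCP.setLIntegral {Q : Measure Ω} {f : Ω → Y} (hf : Measurable f) {κ : Kernel Y Ω}
    (h : IsRCP Q f κ) {E : Set Ω} (hE : MeasurableSet E) {B : Set Y} (hB : MeasurableSet B) :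
    ∫⁻ y in B, κ y E ∂(Q.map f) = Q (E ∩ f ⁻¹' B) := by
  rw [← h.disint _ (hE.inter (hf hB)), ← lintegral_indicator hB]
  refine lintegral_congr_ae ?_
  filter_upwards [h.consistent B hB, h.consistent Bᶜ hB.compl] with y h1 h2
  have := h.prob y
  by_cases hy : y ∈ B
  · rw [Set.indicator_of_mem hy]
    have h3 : ∀ᵐ ω ∂(κ y), ω ∈ f ⁻¹' B := by
      rw [← prob_compl_eq_zero_iff (hf hB)] at h1
      exact h1 hy
    refine measure_congr ?_
    filter_upwards [h3] with ω hω
    exact propext ⟨fun h => ⟨h, hω⟩, fun h => h.1⟩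
  · rw [Set.indicator_of_notMem hy]
    have h3 : κ y (f ⁻¹' B) = 0 := by
      rw [← prob_compl_eq_one_iff (hf hB)]
      exact h2 hy
    exact (measure_mono_null Set.inter_subset_right h3).symm

/-- Both kernels induce the same measure on `Y × Ω`, as seen on rectangles; countable generation
upgrades this to equality of the kernels at almost every point. -/
lemma IsRCP.ae_eq [MeasurableSpace.CountableOrCountablyGenerated Y Ω] {Q : Measure Ω}
    [IsFiniteMeasure Q] {f : Ω → Y} (hf : Measurable f) {κ κ' : Kernel Y Ω}
    (h : IsRCP Q f κ) (h' : IsRCP Q f κ') : ∀ᵐ y ∂(Q.map f), κ y = κ' y := by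
  have : IsMarkovKernel κ := ⟨h.prob⟩
  have : IsMarkovKernel κ' := ⟨h'.prob⟩
  refine Kernel.ae_eq_of_compProd_eq (Measure.ext_prod fun {B E} hB hE => ?_)
  rw [Measure.compProd_apply_prod hB hE, Measure.compProd_apply_prod hB hE,
    h.setLIntegral hf hE hB, h'.setLIntegral hf hE hB]

variable {D : Type} [MeasurableSpace D] (π : Measure D) (Λ : Kernel D PosReal) [IsMarkovKernel Λ]
  (ν : Measure PosReal) [IsProbabilityMeasure ν]

lemma isRCP_pointKernel : IsRCP (canon π Λ ν) Th (pointKernel Λ ν) where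
  prob θ := inferInstance
  disint E hE := by
    rw [canon_map_Th, canon_apply _ _ _ hE]
    simp only [pointKernel_apply]
  consistent B hB := by
    refine Filter.Eventually.of_forall fun θ hθ => ?_
    rw [pointKernel_apply, ← prob_compl_eq_zero_iff (measurable_Th hB)]
    exact ae_Th_eq (Λ θ) ν θ (p := fun θ' => θ' ∈ B) hθ hB

end RegularConditionalProbability

/-! ### The four claims for canonical mixtures -/

section Canonical

variable {D : Type} [MeasurableSpace D]

lemma exists_eq_canon (Λ : Kernel D PosReal) [IsMarkovKernel Λ] {P : Measure (CanonSpace D)}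
    [IsProbabilityMeasure P] (h1 : CondA1 P) (h2 : CondA2 P) (hS : IsCMRP P Λ) :
    ∃ (π : Measure D) (ν : Measure PosReal) (_ : IsProbabilityMeasure π)
      (_ : IsProbabilityMeasure ν), P = canon π Λ ν :=
  have := Measure.isProbabilityMeasure_map (μ := P) (measurable_X 0).aemeasurable
  ⟨P.map Th, P.map (X 0), Measure.isProbabilityMeasure_map measurable_Th.aemeasurable, this,
    eq_canon Λ h1 h2 hS⟩

variable (π : Measure D) [IsProbabilityMeasure π]
  (K : Kernel D PosReal) [IsMarkovKernel K] (ν : Measure PosReal) [IsProbabilityMeasure ν]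

lemma memFln_canon_iff {γ : PosReal → ℝ} :
    MemFln (canon π K ν) γ ↔ Measurable γ ∧ ∫ x, Real.exp (γ x) ∂ν = 1 := by
  have key : Measurable γ →
      ∫ ω, Real.exp (γ (X 0 ω)) ∂(canon π K ν) = ∫ x, Real.exp (γ x) ∂ν := by
    intro h
    conv_rhs => rw [← canon_map_X π K ν 0]
    exact (integral_map (measurable_X 0).aemeasurable h.exp.aestronglyMeasurable).symm
  exact ⟨fun h => ⟨h.1, (key h.1).symm.trans h.2⟩, fun h => ⟨h.1, (key h.1).trans h.2⟩⟩

omit [IsProbabilityMeasure π] in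
lemma memRplus_canon_iff {ξ : D → ℝ} :
    MemRplus (canon π K ν) ξ ↔ Measurable ξ ∧ (∀ᵐ θ ∂π, 0 < ξ θ) ∧ ∫ θ, ξ θ ∂π = 1 := by
  have key : Measurable ξ → ∫ ω, ξ (Th ω) ∂(canon π K ν) = ∫ θ, ξ θ ∂π := by
    intro h
    conv_rhs => rw [← canon_map_Th π K ν]
    exact (integral_map measurable_Th.aemeasurable h.aestronglyMeasurable).symm
  constructor
  · rintro ⟨h1, h2, h3⟩
    rw [canon_map_Th] at h2
    exact ⟨h1, h2, (key h1).symm.trans h3⟩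
  · rintro ⟨h1, h2, h3⟩
    rw [← canon_map_Th π K ν] at h2
    exact ⟨h1, h2, (key h1).trans h3⟩

lemma alpha_canon_iff (ρ : PosFun D) {α : D → ℝ} (hα : Measurable α) :
    (∀ᵐ ω ∂(canon π K ν), α (Th ω) =
      Real.log (ρ (Th ω)) + Real.log (condMeanW (canon π K ν) ω).toReal) ↔
    ∀ᵐ θ ∂π, α θ = Real.log (ρ θ) + Real.log (meanR K θ) := by
  have hm : MeasurableSet {θ | α θ = Real.log (ρ θ) + Real.log (meanR K θ)} :=
    measurableSet_eq_fun hα (ρ.measurable.log.add (measurable_meanR K).log)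
  rw [← canon_map_Th π K ν, ae_map_iff measurable_Th.aemeasurable hm, canon_map_Th]
  refine Filter.eventually_congr ?_
  filter_upwards [condMeanW_canon π K ν] with ω hω
  rw [hω, meanR]

lemma ae_meanR_pos (h : ∀ᵐ ω ∂(canon π K ν),
    0 < condMeanW (canon π K ν) ω ∧ condMeanW (canon π K ν) ω < ⊤) : ∀ᵐ θ ∂π, 0 < meanR K θ := by
  rw [← canon_map_Th π K ν, ae_map_iff measurable_Th.aemeasurable
    (measurableSet_lt measurable_const (measurable_meanR K))]
  filter_upwards [h, condMeanW_canon π K ν] with ω h1 h2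
  rw [h2] at h1
  exact ENNReal.toReal_pos h1.1.ne' h1.2.ne

omit [IsProbabilityMeasure π] in
lemma ac_of_equivLebesgue (h : EquivLebesgue (canon π K ν) K) (ρ : PosFun D) :
    ∀ᵐ θ ∂π, expKernel ρ θ ≪ K θ ∧ K θ ≪ expKernel ρ θ := by
  rw [EquivLebesgue, canon_map_Th] at h
  filter_upwards [h] with θ hθ
  exact ⟨(expKernel_ac ρ θ).1.trans hθ.2, hθ.1.trans (expKernel_ac ρ θ).2⟩

/-- Progressive equivalence is symmetric, so each one-sided result is used in both directions. The
kernel statements hold almost everywhere for different structural laws, which are equivalent by the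
first part. -/
lemma ac_of_progEquiv (K' : Kernel D PosReal) [IsMarkovKernel K'] (π' : Measure D)
    [IsProbabilityMeasure π'] (ν' : Measure PosReal) [IsProbabilityMeasure ν']
    (h : ProgEquiv (canon π' K' ν') (canon π K ν)) :
    (π' ≪ π ∧ π ≪ π') ∧ (ν' ≪ ν ∧ ν ≪ ν') ∧ ∀ᵐ θ ∂π, K' θ ≪ K θ ∧ K θ ≪ K' θ := by
  have h1 := fun t A hA => (h t A hA).2
  have h2 := fun t A hA => (h t A hA).1
  have hπ := ac_structural π' K' ν' π K ν h2
  refine ⟨⟨ac_structural π K ν π' K' ν' h1, hπ⟩, ⟨ac_claims π K ν π' K' ν' h1,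
    ac_claims π' K' ν' π K ν h2⟩, ?_⟩
  filter_upwards [hπ.ae_le (ac_kernel π K ν π' K' ν' h1), ac_kernel π' K' ν' π K ν h2]
    with θ h3 h4 using ⟨h3, h4⟩

variable [MeasurableSingletonClass D]

lemma exists_pair_of_memM (hmean : ∀ᵐ θ ∂π, 0 < meanR K θ) (ρ : PosFun D)
    {Q : Measure (CanonSpace D)} (hQ : MemM (canon π K ν) (expKernel ρ) Q) :
    ∃ (β : PosReal × D → ℝ) (γ : PosReal → ℝ) (α : D → ℝ) (ξ : D → ℝ),
      Decomp (canon π K ν) β γ α ∧ MemRplus (canon π K ν) ξ ∧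
      IsRNDeriv ξ (Q.map Th) ((canon π K ν).map Th) ∧
      StarCond (canon π K ν) Q ρ γ α ∧ RPMxi (canon π K ν) K ρ β ξ Q ∧
      ∀ (β' : PosReal × D → ℝ) (ξ' : D → ℝ), MemFTh (canon π K ν) β' →
        MemRplus (canon π K ν) ξ' → RPMxi (canon π K ν) K ρ β' ξ' Q →
          β' =ᵐ[((canon π K ν).map (X 0)).prod ((canon π K ν).map Th)] β ∧
            ξ' =ᵐ[(canon π K ν).map Th] ξ := by
  have := hQ.prob
  obtain ⟨π', ν', _, _, rfl⟩ := exists_eq_canon (expKernel ρ) hQ.a1 hQ.a2 hQ.cmrp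
  obtain ⟨⟨hπ1, hπ2⟩, ⟨hν1, hν2⟩, hac⟩ := ac_of_progEquiv π K ν (expKernel ρ) π' ν' hQ.progEquiv
  set ξ : D → ℝ := fun θ => (π'.rnDeriv π θ).toReal with hξd
  set f : PosReal → ℝ := fun x => (ν'.rnDeriv ν x).toReal with hfd
  set γ : PosReal → ℝ := fun x => Real.log (f x) with hγd
  set α : D → ℝ := fun θ => Real.log (ρ θ) + Real.log (meanR K θ) with hαd
  have hξ : Measurable ξ := (Measure.measurable_rnDeriv _ _).ennreal_toReal
  have hf : Measurable f := (Measure.measurable_rnDeriv _ _).ennreal_toReal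
  have hγ : Measurable γ := hf.log
  have hα : Measurable α := ρ.measurable.log.add (measurable_meanR K).log
  have hξ0 : ∀ᵐ θ ∂π, 0 < ξ θ := by
    filter_upwards [Measure.rnDeriv_pos' hπ2, Measure.rnDeriv_lt_top π' π] with θ h1 h2
    exact ENNReal.toReal_pos h1.ne' h2.ne
  have hf0 : ∀ᵐ x ∂ν, 0 < f x := by
    filter_upwards [Measure.rnDeriv_pos' hν2, Measure.rnDeriv_lt_top ν' ν] with θ h1 h2
    exact ENNReal.toReal_pos h1.ne' h2.ne
  have hξw : π.withDensity (fun θ => ENNReal.ofReal (ξ θ)) = π' :=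
    withDensity_ofReal_rnDeriv_toReal hπ1
  have hfw : ν.withDensity (fun x => ENNReal.ofReal (f x)) = ν' :=
    withDensity_ofReal_rnDeriv_toReal hν1
  have hγw : ν.withDensity (fun x => ENNReal.ofReal (Real.exp (γ x))) = ν' := by
    rw [← hfw]
    refine withDensity_congr_ae (hf0.mono fun x hx => ?_)
    simp only [hγd, Real.exp_log hx]
  have : IsProbabilityMeasure (π.withDensity fun θ => ENNReal.ofReal (ξ θ)) := by rwa [hξw]
  have : IsProbabilityMeasure (ν.withDensity fun x => ENNReal.ofReal (Real.exp (γ x))) := by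
    rwa [hγw]
  have hξR : MemRplus (canon π K ν) ξ := (memRplus_canon_iff π K ν).2
    ⟨hξ, hξ0, integral_eq_one_of_withDensity hξ (hξ0.mono fun _ h => h.le)⟩
  have hdec : Decomp (canon π K ν) (fun p => γ p.1 + α p.2) γ α :=
    ⟨(memFln_canon_iff π K ν).2 ⟨hγ, integral_eq_one_of_withDensity hγ.exp
      (Filter.Eventually.of_forall fun x => (Real.exp_pos _).le)⟩, hα, fun _ _ => rfl⟩
  have hR : RPMxi (canon π K ν) K ρ (fun p => γ p.1 + α p.2) ξ (canon π' (expKernel ρ) ν') := by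
    have := rpmxi_canon π K ν ρ (hac.mono fun θ h => h.1) hγ hα
      (β := fun p => γ p.1 + α p.2) (fun _ _ => rfl)
      (hmean.mono fun θ h => by
        rw [hαd, Real.exp_add, Real.exp_log (ρ.pos θ), Real.exp_log h]) hξ
    simpa only [hξw, hγw] using this
  refine ⟨fun p => γ p.1 + α p.2, γ, α, ξ, hdec, hξR, ⟨hξ, ?_, ?_⟩, ⟨⟨f, ⟨hf, ?_, ?_⟩, ?_,
    fun _ => rfl⟩, ?_⟩, hR, ?_⟩
  · rw [canon_map_Th]
    exact hξ0.mono fun _ h => h.le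
  · rw [canon_map_Th, canon_map_Th, hξw]
  · exact Filter.Eventually.of_forall fun x => ENNReal.toReal_nonneg
  · rw [canon_map_X, canon_map_X, hfw]
  · rwa [canon_map_X]
  · exact (alpha_canon_iff π K ν ρ hα).2 (Filter.Eventually.of_forall fun _ => rfl)
  · rintro β' ξ' ⟨γ', α', hβ'⟩ hξ' hR'
    rw [canon_map_X, canon_map_Th]
    rw [memRplus_canon_iff] at hξ'
    exact rpmxi_unique_left π K ν ρ hac hmean hdec.measurable hβ'.measurable hξ hξ'.1 hξ0 hξ'.2.1
      hR hR'

lemma exists_memM_of_pair (hmean : ∀ᵐ θ ∂π, 0 < meanR K θ)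
    (hL : EquivLebesgue (canon π K ν) K) {β : PosReal × D → ℝ} {γ : PosReal → ℝ} {α : D → ℝ}
    {ξ : D → ℝ} (hβ : Decomp (canon π K ν) β γ α) (hξ : MemRplus (canon π K ν) ξ) :
    ∃ (ρ : PosFun D) (Q : Measure (CanonSpace D)), MemM (canon π K ν) (expKernel ρ) Q ∧
      RPMxi (canon π K ν) K ρ β ξ Q ∧ StarCond (canon π K ν) Q ρ γ α ∧
      IsRNDeriv ξ (Q.map Th) ((canon π K ν).map Th) ∧
      ∀ (ρ' : PosFun D) (Q' : Measure (CanonSpace D)), IsProbabilityMeasure Q' →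
        RPMxi (canon π K ν) K ρ' β ξ Q' →
          (∀ᵐ θ ∂((canon π K ν).map Th), ρ' θ = ρ θ) ∧ Q' = Q := by
  obtain ⟨hγ, hγ1⟩ := (memFln_canon_iff π K ν).1 hβ.mem_left
  obtain ⟨hξm, hξ0, hξ1⟩ := (memRplus_canon_iff π K ν).1 hξ
  have hα := hβ.measurable_right
  have hac := ac_of_equivLebesgue π K ν hL
  have : IsProbabilityMeasure (π.withDensity fun θ => ENNReal.ofReal (ξ θ)) :=
    isProbabilityMeasure_withDensity_of_integral (hξ0.mono fun _ h => h.le) hξ1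
  have : IsProbabilityMeasure (ν.withDensity fun x => ENNReal.ofReal (Real.exp (γ x))) :=
    isProbabilityMeasure_withDensity_of_integral
      (Filter.Eventually.of_forall fun x => (Real.exp_pos _).le) hγ1
  -- The relation `e^α = ρ m` dictates this value. The default `1` only keeps `ρ` positive on the
  -- null set where the mean, read as a real number, is `0`.
  let ρ : PosFun D := ⟨fun θ => if 0 < meanR K θ then Real.exp (α θ) / meanR K θ else 1,
    Measurable.ite (measurableSet_lt measurable_const (measurable_meanR K))
      (hα.exp.div (measurable_meanR K)) measurable_const, fun θ => by
        beta_reduce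
        split_ifs with h
        · exact div_pos (Real.exp_pos _) h
        · exact one_pos⟩
  have hρ : ∀ θ, 0 < meanR K θ → ρ θ = Real.exp (α θ) / meanR K θ := fun θ h => if_pos h
  have ham : ∀ᵐ θ ∂π, Real.exp (α θ) = ρ θ * meanR K θ := hmean.mono fun θ h => by
    rw [hρ θ h, div_mul_cancel₀ _ h.ne']
  refine ⟨ρ, _, memM_canon π K ν ρ (hac ρ) hmean hγ hξm hξ0,
    rpmxi_canon π K ν ρ ((hac ρ).mono fun θ h => h.1) hγ hα hβ.eq_add ham hξm,
    ⟨⟨fun x => Real.exp (γ x), ⟨hγ.exp, ?_, ?_⟩, ?_, fun x => (Real.log_exp _).symm⟩,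
      (alpha_canon_iff π K ν ρ hα).2 ?_⟩, ⟨hξm, ?_, ?_⟩, ?_⟩
  · exact Filter.Eventually.of_forall fun x => (Real.exp_pos _).le
  · rw [canon_map_X, canon_map_X]
  · exact Filter.Eventually.of_forall fun x => Real.exp_pos _
  · filter_upwards [hmean, ham] with θ h1 h2
    rw [← Real.log_mul (ρ.pos θ).ne' h1.ne', ← h2, Real.log_exp]
  · rw [canon_map_Th]
    exact hξ0.mono fun _ h => h.le
  · rw [canon_map_Th, canon_map_Th]
  · intro ρ' Q' _ hR
    have ham' := exp_eq_of_rpmxi π K ν ρ' (hac ρ') hmean hγ hα hβ.eq_add hξm hξ0 hR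
    have hρ' : ∀ᵐ θ ∂π, ρ' θ = ρ θ := by
      filter_upwards [hmean, ham'] with θ h1 h2
      rw [hρ θ h1, h2, mul_div_cancel_right₀ _ h1.ne']
    refine ⟨by rwa [canon_map_Th], ?_⟩
    rw [eq_of_rpmxi K ρ' hR
      (rpmxi_canon π K ν ρ' ((hac ρ').mono fun θ h => h.1) hγ hα hβ.eq_add ham' hξm)]
    -- `ρ'` and `ρ` agree only almost everywhere, which is enough because the mixture integrates
    -- over `θ`.
    refine canon_congr _ ((withDensity_absolutelyContinuous _ _).ae_le ?_)
    filter_upwards [hρ'] with θ hθ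
    refine Measure.ext fun s _ => ?_
    rw [expKernel_apply, expKernel_apply, hθ]

omit [MeasurableSingletonClass D] in
lemma integral_point_W (θ : D) : ∫ ω, (W 0 ω : ℝ) ∂(point (K θ) ν θ) = meanR K θ := by
  rw [integral_eq_lintegral_of_nonneg_ae (f := fun ω => (W 0 ω : ℝ))
    (Filter.Eventually.of_forall fun ω => (W 0 ω).2.le)
    (measurable_subtype_coe.comp (measurable_W 0)).aestronglyMeasurable,
    lintegral_point_W (K θ) ν θ (f := fun y => ENNReal.ofReal (y : ℝ)) (by fun_prop) 0, meanR, mean]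

omit [MeasurableSingletonClass D] in
-- The given disintegration of `P` coincides almost everywhere with the laws `point (K θ) ν θ`, and
-- `Q` is disintegrated by the analogous laws with exponential interarrival times. Girsanov's
-- formula for fixed `θ` then applies to each pair.
lemma exists_rcp_of_memM [MeasurableSpace.CountableOrCountablyGenerated D (CanonSpace D)]
    (hmean : ∀ᵐ θ ∂π, 0 < meanR K θ) {Pθ : Kernel D (CanonSpace D)}
    (hP : IsRCP (canon π K ν) Th Pθ) (ρ : PosFun D) {Q : Measure (CanonSpace D)}
    {β : PosReal × D → ℝ} {γ : PosReal → ℝ} {α : D → ℝ}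
    (hQ : MemM (canon π K ν) (expKernel ρ) Q) (hβ : Decomp (canon π K ν) β γ α)
    (hstar : StarCond (canon π K ν) Q ρ γ α) :
    ∃ Qθ : Kernel D (CanonSpace D), IsRCP Q Th Qθ ∧
      (∀ Qθ' : Kernel D (CanonSpace D), IsRCP Q Th Qθ' →
        ∀ᵐ θ ∂(Q.map Th), Qθ' θ = Qθ θ) ∧
      ∀ᵐ θ ∂((canon π K ν).map Th), MemMpoint (Pθ θ) (expKernel ρ θ) (Qθ θ) ∧
        (IsLogRN (canon π K ν) Q γ ∧ ρ θ = Real.exp (α θ) / ∫ ω, (W 0 ω : ℝ) ∂(Pθ θ)) ∧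
        RPMth (Pθ θ) K ρ β θ (Qθ θ) := by
  have := hQ.prob
  obtain ⟨hγ, hγ1⟩ := (memFln_canon_iff π K ν).1 hβ.mem_left
  obtain ⟨π', ν', _, _, rfl⟩ := exists_eq_canon (expKernel ρ) hQ.a1 hQ.a2 hQ.cmrp
  obtain ⟨-, -, hac⟩ := ac_of_progEquiv π K ν (expKernel ρ) π' ν' hQ.progEquiv
  have hν' : ν' = ν.withDensity fun x => ENNReal.ofReal (Real.exp (γ x)) := by
    obtain ⟨f, hf, hf0, hγf⟩ := hstar.gamma_eq
    have h1 := hf.eq_withDensity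
    rw [canon_map_X] at hf0
    rw [canon_map_X, canon_map_X] at h1
    rw [h1]
    refine withDensity_congr_ae (hf0.mono fun x hx => ?_)
    simp only [hγf, Real.exp_log hx]
  have hα := (alpha_canon_iff π K ν ρ hβ.measurable_right).1 hstar.alpha_eq
  refine ⟨pointKernel (expKernel ρ) ν', isRCP_pointKernel _ _ _,
    fun Qθ' h => h.ae_eq measurable_Th (isRCP_pointKernel _ _ _), ?_⟩
  have hPe := hP.ae_eq measurable_Th (isRCP_pointKernel π K ν)
  rw [canon_map_Th] at hPe ⊢
  filter_upwards [hPe, hac, hmean, hα] with θ h1 h2 h3 h4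
  rw [h1, pointKernel_apply, pointKernel_apply, integral_point_W]
  have hexp : Real.exp (α θ) = ρ θ * meanR K θ := by
    rw [h4, Real.exp_add, Real.exp_log (ρ.pos θ), Real.exp_log h3]
  have hR : RPMth (point (K θ) ν θ) K ρ β θ (point (expKernel ρ θ) ν' θ) := by
    intro u t hut A hA
    rw [integral_point_W]
    subst hν'
    exact point_expKernel_apply K ρ ν h2.1 hγ (fun x => hβ.eq_add x θ) hexp (filt_mono hut _ hA)
  refine ⟨⟨inferInstance, fun t A hA => ?_, isCRP_point _ _ _⟩, ⟨hstar.gamma_eq, ?_⟩, hR⟩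
  · rw [hR t t le_rfl A hA, integral_point_W]
    exact setLIntegral_ofReal_eq_zero_iff (filt_le t A hA)
      (measurable_density K ρ hβ.measurable t measurable_const measurable_const measurable_id)
      (ae_point_density_pos K ρ ν h2.1 h2.2 β h3 t)
  · rw [hexp, mul_div_cancel_right₀ _ h3.ne']

lemma exists_memM (hmean : ∀ᵐ θ ∂π, 0 < meanR K θ) (hL : EquivLebesgue (canon π K ν) K)
    (ρ : PosFun D) : ∃ Q, MemM (canon π K ν) (expKernel ρ) Q := by
  have h1 : IsProbabilityMeasure (π.withDensity fun _ => ENNReal.ofReal 1) :=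
    isProbabilityMeasure_withDensity_of_integral (Filter.Eventually.of_forall fun _ => zero_le_one)
      (by simp)
  have h2 : IsProbabilityMeasure (ν.withDensity fun _ => ENNReal.ofReal (Real.exp 0)) :=
    isProbabilityMeasure_withDensity_of_integral
      (Filter.Eventually.of_forall fun _ => (Real.exp_pos _).le) (by simp)
  exact ⟨_, memM_canon π K ν ρ (ac_of_equivLebesgue π K ν hL ρ) hmean (γ := fun _ => 0)
    measurable_const (ξ := fun _ => 1) measurable_const
    (Filter.Eventually.of_forall fun _ => one_pos)⟩

end Canonical

end CMRP

end

theorem mainTheorem2 {d : ℕ} (D : Set (EuclideanSpace ℝ (Fin d)))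
    (K : Kernel D PosReal) [IsMarkovKernel K]
    (P : Measure (CanonSpace D)) [IsProbabilityMeasure P]
    (ha1 : CondA1 P) (ha2 : CondA2 P) (hS : IsCMRP P K)
    (hE : ∀ᵐ ω ∂P, 0 < condMeanW P ω ∧ condMeanW P ω < ⊤) :
    -- (i) from `(ρ, Q)` to an essentially unique `(β, ξ)`
    (∀ (ρ : PosFun D) (Q : Measure (CanonSpace D)), MemM P (expKernel ρ) Q →
      ∃ (β : PosReal × D → ℝ) (γ : PosReal → ℝ) (α : D → ℝ) (ξ : D → ℝ),
        Decomp P β γ α ∧ MemRplus P ξ ∧ IsRNDeriv ξ (Q.map Th) (P.map Th) ∧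
        StarCond P Q ρ γ α ∧ RPMxi P K ρ β ξ Q ∧
        ∀ (β' : PosReal × D → ℝ) (ξ' : D → ℝ), MemFTh P β' → MemRplus P ξ' →
          RPMxi P K ρ β' ξ' Q →
            β' =ᵐ[(P.map (X 0)).prod (P.map Th)] β ∧ ξ' =ᵐ[P.map Th] ξ) ∧
    -- (ii) from `(β, ξ)` to a unique `(ρ, Q)`
    (EquivLebesgue P K →
      ∀ (β : PosReal × D → ℝ) (γ : PosReal → ℝ) (α : D → ℝ) (ξ : D → ℝ),
        Decomp P β γ α → MemRplus P ξ →
        ∃ (ρ : PosFun D) (Q : Measure (CanonSpace D)), MemM P (expKernel ρ) Q ∧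
          RPMxi P K ρ β ξ Q ∧ StarCond P Q ρ γ α ∧ IsRNDeriv ξ (Q.map Th) (P.map Th) ∧
          ∀ (ρ' : PosFun D) (Q' : Measure (CanonSpace D)), IsProbabilityMeasure Q' →
            RPMxi P K ρ' β ξ Q' → (∀ᵐ θ ∂(P.map Th), ρ' θ = ρ θ) ∧ Q' = Q) ∧
    -- (iii) the version conditional on `Θ = θ`
    (∀ Pθ : Kernel D (CanonSpace D), IsRCP P Th Pθ →
      ∀ (ρ : PosFun D) (Q : Measure (CanonSpace D)) (β : PosReal × D → ℝ) (γ : PosReal → ℝ)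
        (α : D → ℝ) (ξ : D → ℝ), MemM P (expKernel ρ) Q → Decomp P β γ α → MemRplus P ξ →
        StarCond P Q ρ γ α → RPMxi P K ρ β ξ Q →
        ∃ Qθ : Kernel D (CanonSpace D), IsRCP Q Th Qθ ∧
          (∀ Qθ' : Kernel D (CanonSpace D), IsRCP Q Th Qθ' →
            ∀ᵐ θ ∂(Q.map Th), Qθ' θ = Qθ θ) ∧
          ∀ᵐ θ ∂(P.map Th), MemMpoint (Pθ θ) (expKernel ρ θ) (Qθ θ) ∧
            (IsLogRN P Q γ ∧ ρ θ = Real.exp (α θ) / ∫ ω, (W 0 ω : ℝ) ∂(Pθ θ)) ∧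
            RPMth (Pθ θ) K ρ β θ (Qθ θ)) ∧
    -- (iv) `S` can be converted into a compound mixed Poisson process
    (EquivLebesgue P K →
      ∀ ρ : PosFun D, ∃ Q : Measure (CanonSpace D), MemM P (expKernel ρ) Q) := by
  -- Replacing `P` by its canonical form reduces each claim to the corresponding one for mixtures.
  obtain ⟨π, ν, _, _, rfl⟩ := exists_eq_canon K ha1 ha2 hS
  have hmean := ae_meanR_pos π K ν hE
  exact ⟨fun ρ Q hQ => exists_pair_of_memM π K ν hmean ρ hQ,
    fun hL β γ α ξ hβ hξ => exists_memM_of_pair π K ν hmean hL hβ hξ,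
    fun Pθ hP ρ Q β γ α ξ hQ hβ _ hstar _ => exists_rcp_of_memM π K ν hmean hP ρ hQ hβ hstar,
    fun hL ρ => exists_memM π K ν hmean hL ρ⟩
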